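/- Work over $\mathbb C$. A \emph{sextic double solid} is an irreducible hypersurface $\mathbb V(w^2+g)\subseteq\mathbb P(1,1,1,1,3)$, with variables $x,y,z,t,w$, where $g\in\mathbb C[x,y,z,t]$ is homogeneous of degree $6$. A point of a threefold (not necessarily an isolated singular point) is a \emph{$cA_n$ singularity} if the general hyperplane section through it is a Du Val singularity $A_n$, i.e. analytically isomorphic to the germ at the origin of $x_1^2+x_2^2+x_3^{n+1}=0$ in $\mathbb C^3$. A singularity is \emph{isolated} if it has a smooth punctured analytic neighbourhood. Let $\xi_2,a_j\,(0\le j\le 3),b_j\,(0\le j\le 4),c_j\,(0\le j\le 5),d_j\,(0\le j\le 6)$ in $\mathbb C[y,z]$ be homogeneous of degree equal to their index, and let $X=\mathbb V(f)\subseteq\mathbb P(1,1,1,1,3)$ where $$\begin{aligned} f={}&-w^2+x^4t^2+x^4\xi_2+x^3(4t^3a_0+4t^2a_1+2ta_2+a_3)+x^2(2t^4b_0+2t^3b_1+2t^2b_2+2tb_3+b_4)\\&+x(2t^5c_0+2t^4c_1+2t^3c_2+2t^2c_3+2tc_4+c_5)+t^6d_0+2t^5d_1+t^4d_2+2t^3d_3+t^2d_4+2td_5+d_6,\end{aligned}$$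 and let $P_x=[1,0,0,0,0]$. Consider the following conditions. (2) $\xi_2=0$. (3) $a_3=0$. (4) $b_4=a_2^2$. (5) $c_5=2a_2b_3-4a_1a_2^2$. (6) $d_6=2a_2c_4+b_3^2-8a_1a_2b_3-2a_2^2b_2+4a_0a_2^3+16a_1^2a_2^2$. (7) There exist unique $q,r,s,e\in\mathbb C[y,z]$ such that $r,s$ have no common prime divisor, $q,e$ have no common prime divisor, $$\begin{aligned}a_2&=qr,\qquad b_3=qs+4a_1qr,\qquad c_4=2a_1qs-6a_0q^2r^2+8a_1^2qr+er,\\ d_5&=2b_2qs-8a_1^2qs-es-b_1q^2r^2+c_3qr,\end{aligned}$$ and $q,r,s,e$ are homogeneous of degrees (7.1) $0,2,3,2$ with $q=1$; or (7.2) $1,1,2,3$ with the leading coefficient of $q$ (for $y<z$) equal to $1$; or (7.3) $2,0,1,4$ with $r=1$; or (7.4) $3,*,0,5$ with $r=0$ and $s=1$. (8) Case (7.1) holds, with $r=r_2$, $s=s_3$, $e=e_2$, and there exist a unique $A_0\in\mathbb C$ and a unique $B_1\in\mathbb C[y,z]$ homogeneous of degree $1$ such that $$\begin{aligned}e_2&=4A_0r_2+b_2-6a_1^2,\\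 c_3&=6a_0s_3-4A_0s_3+4a_0a_1r_2-8A_0a_1r_2+B_1r_2+2a_1b_2-4a_1^3,\\ d_4&=-2s_3B_1+16r_2^2A_0^2-8b_2r_2A_0+16a_1^2r_2A_0+4b_1s_3-8a_0a_1s_3-2b_0r_2^2+2c_2r_2+b_2^2-4a_1^2b_2+4a_1^4.\end{aligned}$$ (9) There exists $B_0\in\mathbb C$ such that $A_0=a_0$, $B_1=b_1$ and $$\begin{aligned}d_3&=-s_3B_0+2b_0s_3-2a_0^2s_3+c_1r_2-4a_0b_1r_2+16a_0^2a_1r_2+b_1b_2-4a_0a_1b_2-2a_1^2b_1+8a_0a_1^3,\\ c_2&=r_2B_0-6a_0^2r_2+2a_0b_2+2a_1b_1-12a_0a_1^2.\end{aligned}$$ (10) $B_0=b_0$ and $$\begin{aligned}d_2&=2c_0r_2-8a_0b_0r_2+16a_0^3r_2+2b_0b_2-4a_0^2b_2+b_1^2-8a_0a_1b_1-4a_1^2b_0+24a_0^2a_1^2,\\ c_1&=2a_0b_1+2a_1b_0-12a_0^2a_1.\end{aligned}$$ (11) $c_0=2a_0b_0-4a_0^3$ and $d_1=b_0b_1-2a_0^2b_1-4a_0a_1b_0+8a_0^3a_1$.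 (12) $d_0=b_0^2-4a_0^2b_0+4a_0^4$. Let $9\le n\le 11$. If $X$ satisfies conditions (2) to (8) and (9) to $(n)$ but does not satisfy condition $(n+1)$, then $X$ is a sextic double solid, $P_x$ is a non-isolated $cA_n$ singularity of $X$, and $X$ does not have terminal singularities. -/

import Mathlib

open MvPolynomial Topology
open scoped KaehlerDifferential

noncomputable section

/-! ## Singularities of analytic hypersurface germs at the origin -/

/-- Contact equivalence of (germs at `0` of) holomorphic functions `F`, `G` on `ℂ^k`: there is a
germ of a biholomorphism `φ` of `(ℂ^k, 0)` (with inverse `ψ`) and a holomorphic unit `u` such that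
`G = u · (F ∘ φ)`.  This is isomorphism of the complex space germs `(V(F), 0)`, `(V(G), 0)`. -/
def ContactEquiv {k : ℕ} (F G : (Fin k → ℂ) → ℂ) : Prop :=
  ∃ (φ ψ : (Fin k → ℂ) → (Fin k → ℂ)) (u : (Fin k → ℂ) → ℂ),
    AnalyticAt ℂ φ 0 ∧ AnalyticAt ℂ ψ 0 ∧ AnalyticAt ℂ u 0 ∧
    φ 0 = 0 ∧ ψ 0 = 0 ∧ u 0 ≠ 0 ∧
    (∀ᶠ p in 𝓝 0, ψ (φ p) = p) ∧ (∀ᶠ p in 𝓝 0, φ (ψ p) = p) ∧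
    ∀ᶠ p in 𝓝 0, G p = u p * F (φ p)

/-- The surface germ `(V(G), 0) ⊆ (ℂ^3, 0)` is a Du Val `A_n` singularity. -/
def IsDuValA (n : ℕ) (G : (Fin 3 → ℂ) → ℂ) : Prop :=
  ContactEquiv G (fun p => p 0 ^ 2 + p 1 ^ 2 + p 2 ^ (n + 1))

/-- The germ `(V(F), 0) ⊆ (ℂ^4, 0)` is a (not necessarily isolated) `cA_n` singularity: its general
hyperplane section through `0` is a Du Val `A_n` singularity.  "General" means that the coefficient
vector `c` of the hyperplane `∑ c_i x_i = 0` lies outside a proper Zariski closed subset `Δ = 0`;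
the hyperplane is identified with `ℂ^3` by a linear parametrization `ι`. -/
def IsCompoundA (n : ℕ) (F : (Fin 4 → ℂ) → ℂ) : Prop :=
  ∃ Δ : MvPolynomial (Fin 4) ℂ, Δ ≠ 0 ∧
    ∀ c : Fin 4 → ℂ, eval c Δ ≠ 0 →
      ∀ ι : (Fin 3 → ℂ) →ₗ[ℂ] (Fin 4 → ℂ), Function.Injective ι →
        Set.range ι = {p | ∑ i, c i * p i = 0} → IsDuValA n (fun p => F (ι p))

/-- The hypersurface germ `(V(F), 0)` is at most an isolated singularity: `V(F)` is smooth
(`dF ≠ 0`) at all of its points in some punctured neighbourhood of `0`. -/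
def IsIsolatedSing {k : ℕ} (F : (Fin k → ℂ) → ℂ) : Prop :=
  ∀ᶠ p in 𝓝[≠] (0 : Fin k → ℂ), F p = 0 → fderiv ℂ F p ≠ 0

/-! ## Terminal singularities of affine threefolds -/

section Terminal

/-- The space of rational `3`-forms of a field extension `K / ℂ`. -/
abbrev RatThreeForm (K : Type) [Field K] [Algebra ℂ K] : Type := ⋀[K]^3 (Ω[K⁄ℂ])

/-- The rational `3`-form `dg₀ ∧ dg₁ ∧ dg₂`. -/
def wedgeD {K : Type} [Field K] [Algebra ℂ K] (g : Fin 3 → K) : RatThreeForm K :=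
  exteriorPower.ιMulti K 3 (fun i => KaehlerDifferential.D ℂ K (g i))

/-- `η` generates the rank one `V`-lattice of rational `3`-forms that are regular at the divisor
of `V`, i.e. the `V`-span of all `dg₀ ∧ dg₁ ∧ dg₂` with `g₀, g₁, g₂ ∈ V`.  For a divisorial
valuation ring `V` such an `η` exists and is unique up to a unit of `V`; the order of a rational
form `g • η` along `V` is then the order of `g`. -/
def IsFormGenerator {K : Type} [Field K] [Algebra ℂ K] (V : ValuationSubring K)
    (η : RatThreeForm K) : Prop :=
  Submodule.span V {θ : RatThreeForm K | ∃ g : Fin 3 → K, (∀ i, g i ∈ V) ∧ θ = wedgeD g} =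
    Submodule.span V {η}

variable (A : Type) [CommRing A] [IsDomain A] [Algebra ℂ A]

/-- `V` is (the valuation ring of) a prime divisor over the threefold `Spec A`: a discrete valuation
ring of the function field containing `A` whose residue field has transcendence degree
(at least, hence exactly) `2` over `ℂ`: some `g₀, g₁ ∈ V` have algebraically independent residues,
i.e. every nonzero polynomial in them is a unit of `V`. -/
structure IsPrimeDivisorOver (V : ValuationSubring (FractionRing A)) : Prop where
  mem (a : A) : algebraMap A (FractionRing A) a ∈ V
  dvr : IsDiscreteValuationRing V
  residue : ∃ g : Fin 2 → FractionRing A,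
    ∀ p : MvPolynomial (Fin 2) ℂ, p ≠ 0 → V.valuation (aeval g p) = 1

variable {A} in
/-- The centre on `Spec A` of a prime divisor `V` over `Spec A`: the prime ideal `𝔪_V ∩ A`. -/
def IsPrimeDivisorOver.center {V : ValuationSubring (FractionRing A)}
    (hV : IsPrimeDivisorOver A V) : Ideal A :=
  (IsLocalRing.maximalIdeal V).comap ((algebraMap A (FractionRing A)).codRestrict V hV.mem)

/-- The threefold `Spec A` (`A` a three-dimensional domain of finite type over `ℂ`) has terminal
singularities: it is normal, and for a canonical divisor `K = div ω` and near every point `P`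
* `K` is `ℚ`-Cartier: some multiple `m K`, `m > 0`, is equal to `div φ` near `P`, that is,
  `m · ord_V(ω) = ord_V(φ)` for all prime divisors `V` on `Spec A` passing through `P`
  (those over `Spec A` whose centre has codimension `1`), and
* every exceptional divisor `V` over a neighbourhood of `P` has positive discrepancy
  `ord_V(ω) - ord_V(φ) / m`.

`V.valuation` is multiplicative: a smaller value means a larger order. -/
def IsTerminalThreefold : Prop :=
  IsIntegrallyClosed A ∧
  ∀ ω : RatThreeForm (FractionRing A), ω ≠ 0 → ∀ P : Ideal A, P.IsPrime →
    ∃ (m : ℕ) (φ : FractionRing A), 0 < m ∧ φ ≠ 0 ∧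
      (∀ (V : ValuationSubring (FractionRing A)) (hV : IsPrimeDivisorOver A V),
        hV.center.height = 1 → hV.center ≤ P →
        ∀ (η : RatThreeForm (FractionRing A)) (g : FractionRing A),
          IsFormGenerator V η → ω = g • η → V.valuation g ^ m = V.valuation φ) ∧
      (∀ (V : ValuationSubring (FractionRing A)) (hV : IsPrimeDivisorOver A V),
        2 ≤ hV.center.height → hV.center ≤ P →
        ∀ (η : RatThreeForm (FractionRing A)) (g : FractionRing A),
          IsFormGenerator V η → ω = g • η → V.valuation g ^ m < V.valuation φ)

end Terminal

/-! ## Sextic double solids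

The variables `x, y, z, t, w` of `ℙ(1, 1, 1, 1, 3)` are `X 0, X 1, X 2, X 3, X 4`. -/

/-- `V(f) ⊆ ℙ(1, 1, 1, 1, 3)` is a sextic double solid: an irreducible hypersurface `V(w^2 + g)`
with `g ∈ ℂ[x, y, z, t]` homogeneous of degree `6`. -/
def IsSexticDoubleSolid (f : MvPolynomial (Fin 5) ℂ) : Prop :=
  ∃ g : MvPolynomial (Fin 4) ℂ, g.IsHomogeneous 6 ∧
    Irreducible (X 4 ^ 2 + rename Fin.castSucc g : MvPolynomial (Fin 5) ℂ) ∧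
    Associated f (X 4 ^ 2 + rename Fin.castSucc g)

/-- The equation of `V(f)` in the affine chart `ℂ^4` of `ℙ(1, 1, 1, 1, 3)` where the `i`-th of the
four weight one variables `x, y, z, t` is set to `1` (the others keep their order). -/
def chartEquation (f : MvPolynomial (Fin 5) ℂ) (i : Fin 4) : MvPolynomial (Fin 4) ℂ :=
  aeval (Fin.insertNth (α := fun _ => MvPolynomial (Fin 4) ℂ) i.castSucc 1 X) f

/-- The coordinate ring of the affine chart of `V(f)` given by the `i`-th variable. -/
abbrev ChartRing (f : MvPolynomial (Fin 5) ℂ) (i : Fin 4) : Type :=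
  MvPolynomial (Fin 4) ℂ ⧸ Ideal.span {chartEquation f i}

/-- The sextic double solid `V(f)` has terminal singularities.  As `V(f)` does not contain
`[0, 0, 0, 0, 1]`, it is covered by the four affine charts. -/
def HasTerminalSingularities (f : MvPolynomial (Fin 5) ℂ) : Prop :=
  ∀ i : Fin 4, ∃ _ : IsDomain (ChartRing f i), IsTerminalThreefold (ChartRing f i)

/-- The equation, as a function, of the germ of `V(f)` at `P_x = [1, 0, 0, 0, 0]`, in the
coordinates `y, z, t, w` of the chart `x = 1`. -/
def germAtPx (f : MvPolynomial (Fin 5) ℂ) : (Fin 4 → ℂ) → ℂ :=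
  fun p => eval p (chartEquation f 0)

/-- Polynomials in `y, z`. -/
abbrev PolyYZ : Type := MvPolynomial (Fin 2) ℂ

/-- Two elements of `ℂ[y, z]` have no common prime divisor. -/
def NoCommonPrime (p q : PolyYZ) : Prop := ∀ l : PolyYZ, Prime l → l ∣ p → ¬ l ∣ q

/-- The coefficients `ξ₂, a_j, b_j, c_j, d_j ∈ ℂ[y, z]`, homogeneous of degree the index. -/
structure SexticCoeffs where
  ξ : PolyYZ
  a : Fin 4 → PolyYZ
  b : Fin 5 → PolyYZ
  c : Fin 6 → PolyYZ
  d : Fin 7 → PolyYZ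
  hom_ξ : ξ.IsHomogeneous 2
  hom_a : ∀ j, (a j).IsHomogeneous j
  hom_b : ∀ j, (b j).IsHomogeneous j
  hom_c : ∀ j, (c j).IsHomogeneous j
  hom_d : ∀ j, (d j).IsHomogeneous j

namespace SexticCoeffs

/-- The inclusion `ℂ[y, z] → ℂ[x, y, z, t, w]`. -/
def incl : PolyYZ →ₐ[ℂ] MvPolynomial (Fin 5) ℂ := rename ![1, 2]

variable (D : SexticCoeffs)

/-- The defining polynomial of `X`. -/
def f : MvPolynomial (Fin 5) ℂ :=
  let x : MvPolynomial (Fin 5) ℂ := X 0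
  let t : MvPolynomial (Fin 5) ℂ := X 3
  let w : MvPolynomial (Fin 5) ℂ := X 4
  let a := fun j => incl (D.a j)
  let b := fun j => incl (D.b j)
  let c := fun j => incl (D.c j)
  let d := fun j => incl (D.d j)
  (-w ^ 2) + x ^ 4 * t ^ 2 + x ^ 4 * incl D.ξ
    + x ^ 3 * (4 * t ^ 3 * a 0 + 4 * t ^ 2 * a 1 + 2 * t * a 2 + a 3)
    + x ^ 2 * (2 * t ^ 4 * b 0 + 2 * t ^ 3 * b 1 + 2 * t ^ 2 * b 2 + 2 * t * b 3 + b 4)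
    + x * (2 * t ^ 5 * c 0 + 2 * t ^ 4 * c 1 + 2 * t ^ 3 * c 2 + 2 * t ^ 2 * c 3 + 2 * t * c 4
        + c 5)
    + t ^ 6 * d 0 + 2 * t ^ 5 * d 1 + t ^ 4 * d 2 + 2 * t ^ 3 * d 3 + t ^ 2 * d 4 + 2 * t * d 5
    + d 6

/-- The four equations of condition 7, with the two coprimality requirements. -/
def Eqs7 (q r s e : PolyYZ) : Prop :=
  NoCommonPrime r s ∧ NoCommonPrime q e ∧
  D.a 2 = q * r ∧
  D.b 3 = q * s + 4 * D.a 1 * q * r ∧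
  D.c 4 = 2 * D.a 1 * q * s - 6 * D.a 0 * q ^ 2 * r ^ 2 + 8 * D.a 1 ^ 2 * q * r + e * r ∧
  D.d 5 = 2 * D.b 2 * q * s - 8 * D.a 1 ^ 2 * q * s - e * s - D.b 1 * q ^ 2 * r ^ 2
    + D.c 3 * q * r

/-- Case 7.1: degrees `0, 2, 3, 2` and `q = 1`. -/
def Case71 (q r s e : PolyYZ) : Prop :=
  q = 1 ∧ r.IsHomogeneous 2 ∧ s.IsHomogeneous 3 ∧ e.IsHomogeneous 2

/-- Case 7.2: degrees `1, 1, 2, 3` and the leading coefficient of `q` (for `y < z`) is one. -/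
def Case72 (q r s e : PolyYZ) : Prop :=
  q.IsHomogeneous 1 ∧ r.IsHomogeneous 1 ∧ s.IsHomogeneous 2 ∧ e.IsHomogeneous 3 ∧
  (coeff (Finsupp.single 1 1) q = 1 ∨
    (coeff (Finsupp.single 1 1) q = 0 ∧ coeff (Finsupp.single 0 1) q = 1))

/-- Case 7.3: degrees `2, 0, 1, 4` and `r = 1`. -/
def Case73 (q r s e : PolyYZ) : Prop :=
  q.IsHomogeneous 2 ∧ r = 1 ∧ s.IsHomogeneous 1 ∧ e.IsHomogeneous 4

/-- Case 7.4: `q` and `e` have degrees `3` and `5`, `r = 0` and `s = 1`. -/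
def Case74 (q r s e : PolyYZ) : Prop :=
  q.IsHomogeneous 3 ∧ r = 0 ∧ s = 1 ∧ e.IsHomogeneous 5

/-- Condition 7. -/
def Condition7 : Prop :=
  ∃! T : PolyYZ × PolyYZ × PolyYZ × PolyYZ,
    D.Eqs7 T.1 T.2.1 T.2.2.1 T.2.2.2 ∧
    (Case71 T.1 T.2.1 T.2.2.1 T.2.2.2 ∨ Case72 T.1 T.2.1 T.2.2.1 T.2.2.2 ∨
      Case73 T.1 T.2.1 T.2.2.1 T.2.2.2 ∨ Case74 T.1 T.2.1 T.2.2.1 T.2.2.2)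

/-- Condition 7 holds in case 7.1 with `q = 1`, `r = r₂`, `s = s₃`, `e = e₂`
(these are determined by the coefficients). -/
def Holds71 (r s e : PolyYZ) : Prop := D.Eqs7 1 r s e ∧ Case71 1 r s e

/-- The equations of condition 8 for `A₀ ∈ ℂ` and `B₁ ∈ ℂ[y, z]`. -/
def Eqs8 (r s e : PolyYZ) (A₀ : ℂ) (B₁ : PolyYZ) : Prop :=
  B₁.IsHomogeneous 1 ∧
  e = 4 * C A₀ * r + D.b 2 - 6 * D.a 1 ^ 2 ∧
  D.c 3 = 6 * D.a 0 * s - 4 * C A₀ * s + 4 * D.a 0 * D.a 1 * r - 8 * C A₀ * D.a 1 * r + B₁ * r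
    + 2 * D.a 1 * D.b 2 - 4 * D.a 1 ^ 3 ∧
  D.d 4 = -2 * s * B₁ + 16 * r ^ 2 * C A₀ ^ 2 - 8 * D.b 2 * r * C A₀ + 16 * D.a 1 ^ 2 * r * C A₀
    + 4 * D.b 1 * s - 8 * D.a 0 * D.a 1 * s - 2 * D.b 0 * r ^ 2 + 2 * D.c 2 * r + D.b 2 ^ 2
    - 4 * D.a 1 ^ 2 * D.b 2 + 4 * D.a 1 ^ 4

/-- Condition 8. -/
def Condition8 : Prop :=
  ∃ r s e : PolyYZ, D.Holds71 r s e ∧ ∃! AB : ℂ × PolyYZ, D.Eqs8 r s e AB.1 AB.2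

/-- The equations of condition 9 for `B₀ ∈ ℂ`. -/
def Eqs9 (r s : PolyYZ) (A₀ : ℂ) (B₁ : PolyYZ) (B₀ : ℂ) : Prop :=
  C A₀ = D.a 0 ∧
  B₁ = D.b 1 ∧
  D.d 3 = -s * C B₀ + 2 * D.b 0 * s - 2 * D.a 0 ^ 2 * s + D.c 1 * r - 4 * D.a 0 * D.b 1 * r
    + 16 * D.a 0 ^ 2 * D.a 1 * r + D.b 1 * D.b 2 - 4 * D.a 0 * D.a 1 * D.b 2
    - 2 * D.a 1 ^ 2 * D.b 1 + 8 * D.a 0 * D.a 1 ^ 3 ∧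
  D.c 2 = r * C B₀ - 6 * D.a 0 ^ 2 * r + 2 * D.a 0 * D.b 2 + 2 * D.a 1 * D.b 1
    - 12 * D.a 0 * D.a 1 ^ 2

/-- Condition 9, where `r, s, A₀, B₁` are those of conditions 7 and 8. -/
def Condition9 : Prop :=
  ∃ (r s e : PolyYZ) (A₀ : ℂ) (B₁ : PolyYZ), D.Holds71 r s e ∧ D.Eqs8 r s e A₀ B₁ ∧
    ∃ B₀ : ℂ, D.Eqs9 r s A₀ B₁ B₀

/-- Condition 10, where `r, s, A₀, B₁, B₀` are those of conditions 7, 8 and 9. -/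
def Condition10 : Prop :=
  ∃ (r s e : PolyYZ) (A₀ : ℂ) (B₁ : PolyYZ) (B₀ : ℂ),
    D.Holds71 r s e ∧ D.Eqs8 r s e A₀ B₁ ∧ D.Eqs9 r s A₀ B₁ B₀ ∧
    C B₀ = D.b 0 ∧
    D.d 2 = 2 * D.c 0 * r - 8 * D.a 0 * D.b 0 * r + 16 * D.a 0 ^ 3 * r + 2 * D.b 0 * D.b 2
      - 4 * D.a 0 ^ 2 * D.b 2 + D.b 1 ^ 2 - 8 * D.a 0 * D.a 1 * D.b 1 - 4 * D.a 1 ^ 2 * D.b 0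
      + 24 * D.a 0 ^ 2 * D.a 1 ^ 2 ∧
    D.c 1 = 2 * D.a 0 * D.b 1 + 2 * D.a 1 * D.b 0 - 12 * D.a 0 ^ 2 * D.a 1

/-- Condition `k`, for `2 ≤ k ≤ 12`. -/
def Condition (k : ℕ) : Prop :=
  match k with
  | 2 => D.ξ = 0
  | 3 => D.a 3 = 0
  | 4 => D.b 4 = D.a 2 ^ 2
  | 5 => D.c 5 = 2 * D.a 2 * D.b 3 - 4 * D.a 1 * D.a 2 ^ 2
  | 6 => D.d 6 = 2 * D.a 2 * D.c 4 + D.b 3 ^ 2 - 8 * D.a 1 * D.a 2 * D.b 3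
      - 2 * D.a 2 ^ 2 * D.b 2 + 4 * D.a 0 * D.a 2 ^ 3 + 16 * D.a 1 ^ 2 * D.a 2 ^ 2
  | 7 => D.Condition7
  | 8 => D.Condition8
  | 9 => D.Condition9
  | 10 => D.Condition10
  | 11 => D.c 0 = 2 * D.a 0 * D.b 0 - 4 * D.a 0 ^ 3 ∧
      D.d 1 = D.b 0 * D.b 1 - 2 * D.a 0 ^ 2 * D.b 1 - 4 * D.a 0 * D.a 1 * D.b 0
        + 8 * D.a 0 ^ 3 * D.a 1
  | 12 => D.d 0 = D.b 0 ^ 2 - 4 * D.a 0 ^ 2 * D.b 0 + 4 * D.a 0 ^ 4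
  | _ => True

end SexticCoeffs

end

open MvPolynomial Topology
open scoped KaehlerDifferential
noncomputable section


/-! ## The normal form `w² = S² + t² E` -/

/-! Conditions 2 to 9 say that the sextic part of `D.f` is `S² + t² E`, with `S = t S₁ + S₀` a cubic
form, `S₀ = x r + (s + 2 a₁ r)`, `r` and `s` coprime of degrees 2 and 3, and `E` a quartic form. All
four claims are read off from this normal form. Conditions 10, 11 and 12 say that the coefficients
of `E` vanish in stages; this is `Level`.

Type of the singularity. On a hyperplane `z = lam y + mu t + nu w` in the chart `x = 1` the equation
has no linear terms in `t, w`, and its quadratic part in them is `t² - w²`. By the splitting lemma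
with parameter `y`, the section is `A_n` as soon as the value of the equation on the branch `∂_t =
∂_w = 0` has order exactly `n + 1` in `y`. The branch is nearly a solution of `S = 0`, so `t = -y² r
- y³ s + ...`, while `S` and `w` are `O(y⁶)`. The critical value is then `t² E` up to order 12. The
form `E` is built so that substituting this `t` gives `E = O(y⁶)`. The coefficient of `y^(n+1)` is a
binary form `lead n` evaluated at `(1, lam)`, and coprimality of `r` and `s` makes it nonzero as a
form. A general hyperplane therefore works (`critical_value`, `lead_ne_zero`, `isCompoundA`).

Irreducibility. If `h` were a square, the critical value on every such section would vanish
identically, against the same computation (`h_ne_sq`).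

Non-isolatedness. The equation lies in the square of the ideal `(S₀, t, w)`, so the double solid is
singular along the curve `S₀ = t = w = 0`. This curve passes through `P_x`; punctured neighbourhoods
meet it because `r` has a zero where `s` does not vanish (`not_isIsolatedSing`).

Non-terminality. A threefold with a double curve admits a crepant divisor over that curve. In the
chart `z = 1` the double solid is a double cover `w² = h` of affine 3-space. If it is normal, `dx ∧
dy ∧ dt / w` generates the regular forms in codimension one, so the function `φ` in the definition
of terminality is regular by Hartogs. Blow up the curve, with `σ = S₀ / t` and `W = w / t`. From `S₀
= t σ` one gets `r dx ∧ dy ∧ dt = t dσ ∧ dy ∧ dt`, and the factor `t` cancels against `w = t W`. The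
form thus has order zero along the exceptional divisor, while terminality asks for positive order
(`residueForm_eq`, `not_isTerminalThreefold`).

Existence of this divisor as a valuation is proved by hand. A power series arc through its generic
point defines the residue map of the ring `ℂ[y, σ, t, W]`, and `t` generates the kernel locally. -/

/-- Coefficients of a sextic of the form `S² + t² E`, see `SplitSextic.S` and `SplitSextic.E`. -/
structure SplitSextic where
  r : PolyYZ
  s : PolyYZ
  a₁ : PolyYZ
  l : PolyYZ
  m : PolyYZ
  c₁ : PolyYZ
  d₁ : PolyYZ
  d₂ : PolyYZ
  α : ℂ
  β : ℂ
  δ : ℂ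
  c₀ : ℂ
  d₀ : ℂ
  hom_r : r.IsHomogeneous 2
  hom_s : s.IsHomogeneous 3
  hom_a₁ : a₁.IsHomogeneous 1
  hom_l : l.IsHomogeneous 1
  hom_m : m.IsHomogeneous 2
  hom_c₁ : c₁.IsHomogeneous 1
  hom_d₁ : d₁.IsHomogeneous 1
  hom_d₂ : d₂.IsHomogeneous 2
  coprime : NoCommonPrime r s

namespace SplitSextic

variable (Q : SplitSextic) {R R' : Type*} [CommRing R] [Algebra ℂ R] [CommRing R'] [Algebra ℂ R']

/-- The part of `S` that is divisible by `t`, divided by `t`. -/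
def S₁ (x y z t : R) : R :=
  x ^ 2 + x * (algebraMap ℂ R Q.α * t + 2 * aeval ![y, z] Q.a₁)
    + algebraMap ℂ R Q.β * t ^ 2 + aeval ![y, z] Q.l * t + aeval ![y, z] Q.m

/-- The value of `S` at `t = 0`. -/
def S₀ (x y z : R) : R :=
  x * aeval ![y, z] Q.r + (aeval ![y, z] Q.s + 2 * aeval ![y, z] Q.a₁ * aeval ![y, z] Q.r)

/-- The cubic form whose square is the sextic modulo `t²`. -/
def S (x y z t : R) : R := t * Q.S₁ x y z t + Q.S₀ x y z

/-- The quartic form `E` in `S² + t² E`. -/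
def E (x y z t : R) : R :=
  2 * algebraMap ℂ R Q.δ * (aeval ![y, z] Q.r ^ 2 + x * t * aeval ![y, z] Q.r
      - aeval ![y, z] Q.s * t)
    + 2 * aeval ![y, z] Q.c₁ * (aeval ![y, z] Q.r * t + x * t ^ 2)
    + aeval ![y, z] Q.d₂ * t ^ 2
    + 2 * (algebraMap ℂ R Q.c₀ * x + aeval ![y, z] Q.d₁) * t ^ 3
    + algebraMap ℂ R Q.d₀ * t ^ 4

/-- The sextic form `S² + t² E`. -/
def h (x y z t : R) : R := Q.S x y z t ^ 2 + t ^ 2 * Q.E x y z t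

/-- The equation of the double solid. -/
def poly : MvPolynomial (Fin 5) ℂ := -X 4 ^ 2 + Q.h (X 0) (X 1) (X 2) (X 3)

lemma map_aeval_pair (φ : R →ₐ[ℂ] R') (p : PolyYZ) (y z : R) :
    φ (aeval ![y, z] p) = aeval ![φ y, φ z] p := by
  rw [← AlgHom.comp_apply]
  congr 1
  ext i
  fin_cases i <;> simp

lemma map_S₁ (φ : R →ₐ[ℂ] R') (x y z t : R) :
    φ (Q.S₁ x y z t) = Q.S₁ (φ x) (φ y) (φ z) (φ t) := by
  simp [S₁, map_aeval_pair, map_ofNat φ 2]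

lemma map_S₀ (φ : R →ₐ[ℂ] R') (x y z : R) :
    φ (Q.S₀ x y z) = Q.S₀ (φ x) (φ y) (φ z) := by
  simp [S₀, map_aeval_pair, map_ofNat φ 2]

lemma map_S (φ : R →ₐ[ℂ] R') (x y z t : R) :
    φ (Q.S x y z t) = Q.S (φ x) (φ y) (φ z) (φ t) := by
  simp [S, map_S₁, map_S₀]

lemma map_E (φ : R →ₐ[ℂ] R') (x y z t : R) :
    φ (Q.E x y z t) = Q.E (φ x) (φ y) (φ z) (φ t) := by
  simp [E, map_aeval_pair, map_ofNat φ 2]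

lemma map_h (φ : R →ₐ[ℂ] R') (x y z t : R) :
    φ (Q.h x y z t) = Q.h (φ x) (φ y) (φ z) (φ t) := by
  simp [h, map_S, map_E]

/-- The condition that decides on the order `n + 1` of the critical value. -/
def Level (n : ℕ) : Prop :=
  (n = 9 ∧ ¬ (Q.δ = 0 ∧ Q.c₁ = 0 ∧ Q.d₂ = 2 * C Q.c₀ * Q.r)) ∨
  (n = 10 ∧ Q.δ = 0 ∧ Q.c₁ = 0 ∧ Q.d₂ = 2 * C Q.c₀ * Q.r ∧ ¬ (Q.c₀ = 0 ∧ Q.d₁ = 0)) ∨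
  (n = 11 ∧ Q.δ = 0 ∧ Q.c₁ = 0 ∧ Q.d₂ = 2 * C Q.c₀ * Q.r ∧ Q.c₀ = 0 ∧ Q.d₁ = 0 ∧ Q.d₀ ≠ 0)

end SplitSextic

lemma exists_C_of_isHomogeneous_zero {p : PolyYZ} (hp : p.IsHomogeneous 0) : ∃ c : ℂ, p = C c :=
  ⟨coeff 0 p, by
    rw [← totalDegree_zero_iff_isHomogeneous] at hp
    exact totalDegree_eq_zero_iff_eq_C.1 hp⟩

/-! ### From the numbered conditions to the normal form -/

namespace SexticCoeffs

variable (D : SexticCoeffs)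

lemma incl_eq_aeval (p : PolyYZ) : incl p = aeval ![X 1, X 2] p := by
  unfold incl
  rw [rename_eq_aeval]
  congr 1
  ext i
  fin_cases i <;> simp

/-- `S` is the truncated square root of the sextic, and `E` collects what is left. Conditions 10 to
12 are translated one by one into vanishing of coefficients of `E`, so the failing condition gives
the last clause of `Level`. -/
theorem exists_splitSextic (n : ℕ) (hn9 : 9 ≤ n) (hn11 : n ≤ 11)
    (hcond : ∀ k : ℕ, 2 ≤ k → k ≤ n → D.Condition k) (hnot : ¬ D.Condition (n + 1)) :
    ∃ Q : SplitSextic, Q.Level n ∧ D.f = Q.poly := by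
  have h2 : D.ξ = 0 := hcond 2 (by omega) (by omega)
  have h3 : D.a 3 = 0 := hcond 3 (by omega) (by omega)
  have h4 : D.b 4 = D.a 2 ^ 2 := hcond 4 (by omega) (by omega)
  have h5 : D.c 5 = 2 * D.a 2 * D.b 3 - 4 * D.a 1 * D.a 2 ^ 2 := hcond 5 (by omega) (by omega)
  have h6 : D.d 6 = 2 * D.a 2 * D.c 4 + D.b 3 ^ 2 - 8 * D.a 1 * D.a 2 * D.b 3
      - 2 * D.a 2 ^ 2 * D.b 2 + 4 * D.a 0 * D.a 2 ^ 3 + 16 * D.a 1 ^ 2 * D.a 2 ^ 2 :=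
    hcond 6 (by omega) (by omega)
  have h9 : D.Condition9 := hcond 9 (by omega) hn9
  have h10 : 10 ≤ n → D.Condition10 := fun h => hcond 10 (by omega) h
  obtain ⟨r, s, e, A₀, B₁, B₀, H71, H8, H9, H10⟩ : ∃ (r s e : PolyYZ) (A₀ : ℂ) (B₁ : PolyYZ) (B₀ : ℂ),
      D.Holds71 r s e ∧ D.Eqs8 r s e A₀ B₁ ∧ D.Eqs9 r s A₀ B₁ B₀ ∧ (10 ≤ n → C B₀ = D.b 0 ∧
    D.d 2 = 2 * D.c 0 * r - 8 * D.a 0 * D.b 0 * r + 16 * D.a 0 ^ 3 * r + 2 * D.b 0 * D.b 2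
      - 4 * D.a 0 ^ 2 * D.b 2 + D.b 1 ^ 2 - 8 * D.a 0 * D.a 1 * D.b 1 - 4 * D.a 1 ^ 2 * D.b 0
      + 24 * D.a 0 ^ 2 * D.a 1 ^ 2 ∧
    D.c 1 = 2 * D.a 0 * D.b 1 + 2 * D.a 1 * D.b 0 - 12 * D.a 0 ^ 2 * D.a 1) := by
    -- Conditions 9 and 10 each quantify over their own `r, s, e, A₀, B₁, B₀`. Taking the data of
    -- condition 10 whenever it holds avoids comparing the two choices.
    by_cases hn : 10 ≤ n
    · obtain ⟨r, s, e, A₀, B₁, B₀, H71, H8, H9, H10⟩ := h10 hn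
      exact ⟨r, s, e, A₀, B₁, B₀, H71, H8, H9, fun _ => H10⟩
    · obtain ⟨r, s, e, A₀, B₁, H71, H8, B₀, H9⟩ := h9
      exact ⟨r, s, e, A₀, B₁, B₀, H71, H8, H9, fun h => absurd h hn⟩
  obtain ⟨A, hA⟩ := exists_C_of_isHomogeneous_zero (D.hom_a 0)
  obtain ⟨B, hB⟩ := exists_C_of_isHomogeneous_zero (D.hom_b 0)
  obtain ⟨c, hc⟩ := exists_C_of_isHomogeneous_zero (D.hom_c 0)
  obtain ⟨d, hd⟩ := exists_C_of_isHomogeneous_zero (D.hom_d 0)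
  obtain ⟨⟨hrs, -, ha2, hb3, hc4, hd5⟩, -, hr, hs, -⟩ := id H71
  obtain ⟨-, he, hc3, hd4⟩ := id H8
  obtain ⟨hA0, hB1, hd3, hc2⟩ := id H9
  have ha1 := D.hom_a 1
  have hb1 := D.hom_b 1
  have hb2 := D.hom_b 2
  have hc1 := D.hom_c 1
  have hd1 := D.hom_d 1
  have hd2 := D.hom_d 2
  simp only [Fin.val_one, Fin.val_two] at ha1 hb1 hb2 hc1 hd1 hd2
  have ha11 : (D.a 1 ^ 2).IsHomogeneous 2 := ha1.pow 2
  have hb11 : (D.b 1 ^ 2).IsHomogeneous 2 := hb1.pow 2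
  have hab : (D.a 1 * D.b 1).IsHomogeneous 2 := ha1.mul hb1
  -- Since `t² E` has degree at most one in `x`, the fields `α, β, l, m` are forced by the
  -- coefficients of `x³t³, x²t⁴, x²t³, x²t²` in `S²`. The fields `δ, c₁, d₂, c₀, d₁, d₀` are the
  -- remaining differences in the terms of degree at most one in `x`.
  let Q : SplitSextic :=
    { r := r, s := s, a₁ := D.a 1
      l := D.b 1 - C (4 * A) * D.a 1
      m := D.b 2 - C (2 * A) * r - C 2 * D.a 1 ^ 2
      c₁ := D.c 1 - C (2 * A) * D.b 1 - C (2 * B) * D.a 1 + C (12 * A ^ 2) * D.a 1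
      d₁ := D.d 1 - C B * D.b 1 + C (2 * A ^ 2) * D.b 1 + C (4 * A * B) * D.a 1 - C (8 * A ^ 3) * D.a 1
      d₂ := D.d 2 - D.b 1 ^ 2 + C (8 * A) * (D.a 1 * D.b 1) - C (2 * B) * D.b 2
        + C (4 * A ^ 2) * D.b 2 + C (4 * A * B) * r - C (8 * A ^ 3) * r
        + C (4 * B - 24 * A ^ 2) * D.a 1 ^ 2
      α := 2 * A
      β := B - 2 * A ^ 2
      δ := B₀ - B
      c₀ := c - 2 * A * B + 4 * A ^ 3
      d₀ := d - B ^ 2 + 4 * A ^ 2 * B - 4 * A ^ 4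
      hom_r := hr
      hom_s := hs
      hom_a₁ := ha1
      hom_l := hb1.sub (ha1.C_mul _)
      hom_m := (hb2.sub (hr.C_mul _)).sub (ha11.C_mul _)
      hom_c₁ := ((hc1.sub (hb1.C_mul _)).sub (ha1.C_mul _)).add (ha1.C_mul _)
      hom_d₁ := (((hd1.sub (hb1.C_mul _)).add (hb1.C_mul _)).add (ha1.C_mul _)).sub (ha1.C_mul _)
      hom_d₂ := ((((((hd2.sub hb11).add (hab.C_mul _)).sub (hb2.C_mul _)).add (hb2.C_mul _)).add
        (hr.C_mul _)).sub (hr.C_mul _)).add (ha11.C_mul _)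
      coprime := hrs }
  have e0 : Q.δ = 0 ↔ C B₀ = D.b 0 := by
    rw [hB, (C_injective (Fin 2) ℂ).eq_iff]; exact sub_eq_zero
  have e1 : Q.c₁ = 0 ↔ D.c 1 = 2 * D.a 0 * D.b 1 + 2 * D.a 1 * D.b 0 - 12 * D.a 0 ^ 2 * D.a 1 := by
    rw [← sub_eq_zero (a := D.c 1), hA, hB]
    congr! 1
    simp only [Q, map_mul, map_ofNat, map_pow]
    ring
  have e2 : Q.d₂ = 2 * C Q.c₀ * Q.r ↔
      D.d 2 = 2 * D.c 0 * r - 8 * D.a 0 * D.b 0 * r + 16 * D.a 0 ^ 3 * r + 2 * D.b 0 * D.b 2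
      - 4 * D.a 0 ^ 2 * D.b 2 + D.b 1 ^ 2 - 8 * D.a 0 * D.a 1 * D.b 1 - 4 * D.a 1 ^ 2 * D.b 0
      + 24 * D.a 0 ^ 2 * D.a 1 ^ 2 := by
    rw [← sub_eq_zero (a := D.d 2), ← sub_eq_zero, hA, hB, hc]
    congr! 1
    simp only [Q, map_mul, map_ofNat, map_pow, map_add, map_sub]
    ring
  have e3 : Q.c₀ = 0 ↔ D.c 0 = 2 * D.a 0 * D.b 0 - 4 * D.a 0 ^ 3 := by
    rw [← sub_eq_zero (a := D.c 0), hA, hB, hc, ← C_eq_zero (σ := Fin 2)]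
    congr! 1
    simp only [Q, map_mul, map_ofNat, map_pow, map_add, map_sub]
    ring
  have e4 : Q.d₁ = 0 ↔ D.d 1 = D.b 0 * D.b 1 - 2 * D.a 0 ^ 2 * D.b 1 - 4 * D.a 0 * D.a 1 * D.b 0
        + 8 * D.a 0 ^ 3 * D.a 1 := by
    rw [← sub_eq_zero (a := D.d 1), hA, hB]
    congr! 1
    simp only [Q, map_mul, map_ofNat, map_pow]
    ring
  have e5 : Q.d₀ = 0 ↔ D.d 0 = D.b 0 ^ 2 - 4 * D.a 0 ^ 2 * D.b 0 + 4 * D.a 0 ^ 4 := by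
    rw [← sub_eq_zero (a := D.d 0), hA, hB, hd, ← C_eq_zero (σ := Fin 2)]
    congr! 1
    simp only [Q, map_mul, map_ofNat, map_pow, map_add, map_sub]
    ring
  have H10' : 10 ≤ n → Q.δ = 0 ∧ Q.c₁ = 0 ∧ Q.d₂ = 2 * C Q.c₀ * Q.r := fun h =>
    ⟨e0.2 (H10 h).1, e1.2 (H10 h).2.2, e2.2 (H10 h).2.1⟩
  refine ⟨Q, ?_, ?_⟩
  · obtain rfl | rfl | rfl : n = 9 ∨ n = 10 ∨ n = 11 := by omega
    · refine Or.inl ⟨rfl, fun h => hnot ?_⟩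
      exact ⟨r, s, e, A₀, B₁, B₀, H71, H8, H9, e0.1 h.1, e2.1 h.2.2, e1.1 h.2.1⟩
    · obtain ⟨h1, h2, h3⟩ := H10' le_rfl
      exact Or.inr (Or.inl ⟨rfl, h1, h2, h3, fun h => hnot ⟨e3.1 h.1, e4.1 h.2⟩⟩)
    · obtain ⟨h1, h2, h3⟩ := H10' (by norm_num)
      have h11 : D.c 0 = 2 * D.a 0 * D.b 0 - 4 * D.a 0 ^ 3 ∧
        D.d 1 = D.b 0 * D.b 1 - 2 * D.a 0 ^ 2 * D.b 1 - 4 * D.a 0 * D.a 1 * D.b 0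
        + 8 * D.a 0 ^ 3 * D.a 1 := hcond 11 (by norm_num) le_rfl
      exact Or.inr (Or.inr ⟨rfl, h1, h2, h3, e3.2 h11.1, e4.2 h11.2, fun h => hnot (e5.1 h)⟩)
  · subst hB1
    simp only [f, SplitSextic.poly, SplitSextic.h, SplitSextic.S, SplitSextic.S₁, SplitSextic.S₀,
      SplitSextic.E, ← incl_eq_aeval, Q]
    rw [h2, h3, h6, hd5, hc4, h5, h4, hb3, ha2, hd4, hd3, hc2, hc3, he, hA0, hA, hB, hc, hd]
    simp only [map_mul, map_ofNat, map_pow, map_add, map_sub, map_neg, map_one, map_zero,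
      algebraMap_eq, incl, rename_C]
    ring
end SexticCoeffs


/-! ## Analytic coordinate changes -/

theorem AnalyticAt.exists_local_inverse {V : Type*} [NormedAddCommGroup V] [NormedSpace ℂ V]
    [CompleteSpace V] [FiniteDimensional ℂ V] {f : V → V} {f' : V →L[ℂ] V} {a : V}
    (hf : AnalyticAt ℂ f a) (hf' : HasFDerivAt f f' a) (hinj : Function.Injective f') :
    ∃ g : V → V, AnalyticAt ℂ g (f a) ∧ g (f a) = a ∧ (∀ᶠ p in 𝓝 a, g (f p) = p) ∧
      ∀ᶠ q in 𝓝 (f a), f (g q) = q := by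
  let i : V ≃L[ℂ] V := (LinearEquiv.ofInjectiveEndo (f' : V →ₗ[ℂ] V) hinj).toContinuousLinearEquiv
  have hi : (i : V →L[ℂ] V) = f' := by ext; rfl
  have hs : HasStrictFDerivAt f (i : V →L[ℂ] V) a := by
    rw [hi, ← hf'.fderiv]; exact hf.hasStrictFDerivAt
  refine ⟨hs.localInverse f i a, ?_, hs.localInverse_apply_image, hs.eventually_left_inverse,
    hs.eventually_right_inverse⟩
  rw [hs.localInverse_def]
  have := (hs.toOpenPartialHomeomorph f).analyticAt_symm' (a := a) (i := i)
    hs.mem_toOpenPartialHomeomorph_source hf hs.hasFDerivAt.fderiv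
  simpa using this

/-- Inverse function theorem: a substitution with injective linear part is a germ of a
biholomorphism, and the unit can be taken to be 1. -/
theorem ContactEquiv.of_coordinates {k : ℕ} {F G : (Fin k → ℂ) → ℂ}
    {Ψ : (Fin k → ℂ) → (Fin k → ℂ)} {Ψ' : (Fin k → ℂ) →L[ℂ] (Fin k → ℂ)}
    (hΨ : AnalyticAt ℂ Ψ 0) (hΨ0 : Ψ 0 = 0) (hΨ' : HasFDerivAt Ψ Ψ' 0)
    (hinj : Function.Injective Ψ') (h : ∀ᶠ p in 𝓝 0, F p = G (Ψ p)) : ContactEquiv F G := by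
  obtain ⟨g, hg, hg0, h1, h2⟩ := hΨ.exists_local_inverse hΨ' hinj
  rw [hΨ0] at hg hg0 h2
  refine ⟨g, Ψ, fun _ => 1, hg, hΨ, analyticAt_const, hg0, hΨ0, one_ne_zero, h2, h1, ?_⟩
  have hgc : Filter.Tendsto g (𝓝 0) (𝓝 0) := by
    have := hg.continuousAt.tendsto
    rwa [hg0] at this
  filter_upwards [hgc.eventually h, h2] with p hp hp2
  rw [one_mul, hp, hp2]

theorem ContactEquiv.comp_linearEquiv {k : ℕ} {F G : (Fin k → ℂ) → ℂ} (h : ContactEquiv F G)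
    (L : (Fin k → ℂ) ≃ₗ[ℂ] (Fin k → ℂ)) : ContactEquiv (fun p => F (L p)) G := by
  obtain ⟨φ, ψ, u, hφ, hψ, hu, hφ0, hψ0, hu0, h1, h2, h3⟩ := h
  let e := L.toContinuousLinearEquiv
  have he0 : Filter.Tendsto L (𝓝 0) (𝓝 0) := by
    have : Filter.Tendsto e (𝓝 0) (𝓝 (e 0)) := e.continuous.tendsto 0
    rwa [map_zero] at this
  refine ⟨fun p => L.symm (φ p), fun p => ψ (L p), u, ?_, ?_, hu, by simp [hφ0], by simp [hψ0],
    hu0, ?_, ?_, ?_⟩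
  · exact ((e.symm : (Fin k → ℂ) →L[ℂ] (Fin k → ℂ)).analyticAt _).comp hφ
  · refine AnalyticAt.fun_comp ?_ ((e : (Fin k → ℂ) →L[ℂ] (Fin k → ℂ)).analyticAt 0)
    simpa using hψ
  · filter_upwards [h1] with p hp
    simpa using hp
  · filter_upwards [he0.eventually h2] with p hp
    rw [hp, L.symm_apply_apply]
  · filter_upwards [h3] with p hp
    rw [hp, L.apply_symm_apply]

/-- Analytic roots of analytic units. -/
theorem AnalyticAt.exists_root {V : Type*} [NormedAddCommGroup V] [NormedSpace ℂ V]
    {f : V → ℂ} {a : V} (hf : AnalyticAt ℂ f a) (h0 : f a ≠ 0) {n : ℕ} (hn : n ≠ 0) :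
    ∃ g : V → ℂ, AnalyticAt ℂ g a ∧ g a ≠ 0 ∧ ∀ᶠ p in 𝓝 a, g p ^ n = f p := by
  obtain ⟨c, hc⟩ := IsAlgClosed.exists_pow_nat_eq (f a) (Nat.pos_of_ne_zero hn)
  have hc0 : c ≠ 0 := by rintro rfl; exact h0 (by rw [← hc, zero_pow hn])
  have hq : AnalyticAt ℂ (fun p => f p / f a) a := hf.div analyticAt_const h0
  have hl : AnalyticAt ℂ (fun p => Complex.log (f p / f a)) a :=
    hq.clog (by simp [div_self h0])
  refine ⟨fun p => c * Complex.exp (Complex.log (f p / f a) / n),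
    analyticAt_const.mul (hl.div analyticAt_const (by exact_mod_cast hn)).cexp, by simp [hc0], ?_⟩
  have hne : ∀ᶠ p in 𝓝 a, f p ≠ 0 := hf.continuousAt.eventually_ne h0
  filter_upwards [hne] with p hp
  rw [mul_pow, hc, ← Complex.exp_nat_mul, mul_div_cancel₀ _ (by exact_mod_cast hn),
    Complex.exp_log (div_ne_zero hp h0), mul_div_cancel₀ _ h0]

/-! ## Order of vanishing in one variable -/

-- Expansions along the branch only produce continuous cofactors; this replaces them by analytic
-- ones. If the order of `f` were smaller than `k`, its leading factor would be `O(y)` and so would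
-- vanish at 0.
open Asymptotics in
theorem AnalyticAt.exists_eventually_eq_pow_mul_of_isBigO {f : ℂ → ℂ} (hf : AnalyticAt ℂ f 0)
    {k : ℕ} (h : f =O[𝓝 0] fun y => y ^ k) :
    ∃ g : ℂ → ℂ, AnalyticAt ℂ g 0 ∧ ∀ᶠ y in 𝓝 0, f y = y ^ k * g y := by
  suffices hk : k ≤ analyticOrderAt f 0 by
    simpa using (natCast_le_analyticOrderAt hf).1 hk
  by_contra! hlt
  obtain ⟨n, hn⟩ := ENat.ne_top_iff_exists.1 hlt.ne_top
  rw [← hn, Nat.cast_lt] at hlt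
  obtain ⟨g, hg, hg0, hfg⟩ := (hf.analyticOrderAt_eq_natCast).1 hn.symm
  obtain ⟨c, hc⟩ := h.bound
  have h1 : ∀ᶠ y in 𝓝[≠] (0 : ℂ), ‖g y‖ ≤ c * ‖y‖ ^ (k - n) := by
    filter_upwards [hc.filter_mono nhdsWithin_le_nhds, hfg.filter_mono nhdsWithin_le_nhds,
      self_mem_nhdsWithin] with y h1 h2 hy
    have hy : 0 < ‖y‖ := norm_pos_iff.2 hy
    rw [h2, sub_zero, norm_smul, norm_pow, norm_pow, show k = n + (k - n) by omega, pow_add,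
      mul_left_comm] at h1
    simpa using le_of_mul_le_mul_left h1 (pow_pos hy n)
  have h2 : Filter.Tendsto (fun y : ℂ => c * ‖y‖ ^ (k - n)) (𝓝[≠] 0) (𝓝 0) := by
    have : Continuous fun y : ℂ => c * ‖y‖ ^ (k - n) := by fun_prop
    have := (this.tendsto 0).mono_left (nhdsWithin_le_nhds (s := {0}ᶜ))
    simpa [show k - n ≠ 0 by omega] using this
  have h3 := squeeze_zero_norm' h1 h2
  exact hg0 (tendsto_nhds_unique (hg.continuousAt.tendsto.mono_left nhdsWithin_le_nhds) h3)

/-! ## Polynomials in three variables near a critical branch -/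

namespace MvPolynomial

theorem hasFDerivAt_eval {σ : Type*} [Fintype σ] (P : MvPolynomial σ ℂ) (p : σ → ℂ) :
    HasFDerivAt (fun q => eval q P)
      (∑ i, eval p (pderiv i P) • ContinuousLinearMap.proj (R := ℂ) (φ := fun _ : σ => ℂ) i) p := by
  classical
  induction P using MvPolynomial.induction_on with
  | C a =>
    refine (hasFDerivAt_const (𝕜 := ℂ) a p).congr_fderiv ?_ |>.congr_of_eventuallyEq ?_
    · ext v; simp
    · simp
  | add P Q hP hQ =>
    simp only [map_add]
    refine (hP.fun_add hQ).congr_fderiv ?_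
    ext v; simp [add_mul, Finset.sum_add_distrib]
  | mul_X P i hP =>
    simp only [map_mul, eval_X]
    have hX : HasFDerivAt (fun q : σ → ℂ => q i)
      (ContinuousLinearMap.proj (R := ℂ) (φ := fun _ : σ => ℂ) i) p := hasFDerivAt_apply i p
    refine (hP.mul hX).congr_fderiv ?_
    ext v
    simp [Derivation.leibniz, pderiv_X, Pi.single_apply, add_mul, Finset.sum_add_distrib,
      Finset.mul_sum, mul_assoc, apply_ite (eval p)]

/-- Second order Taylor expansion with polynomial coefficients in the second and third variable. -/
theorem exists_taylor_two (P : MvPolynomial (Fin 3) ℂ) :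
    ∃ A B D : MvPolynomial (Fin 5) ℂ,
      (∀ y t w τ ω : ℂ, eval ![y, t + τ, w + ω] P = eval ![y, t, w] P
        + eval ![y, t, w] (pderiv 1 P) * τ + eval ![y, t, w] (pderiv 2 P) * ω
        + eval ![y, t, w, τ, ω] A * τ ^ 2 + 2 * eval ![y, t, w, τ, ω] B * (τ * ω)
        + eval ![y, t, w, τ, ω] D * ω ^ 2) ∧
      (∀ y t w : ℂ, 2 * eval ![y, t, w, 0, 0] A = eval ![y, t, w] (pderiv 1 (pderiv 1 P))) ∧
      (∀ y t w : ℂ, 2 * eval ![y, t, w, 0, 0] B = eval ![y, t, w] (pderiv 1 (pderiv 2 P))) ∧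
      (∀ y t w : ℂ, 2 * eval ![y, t, w, 0, 0] D = eval ![y, t, w] (pderiv 2 (pderiv 2 P))) := by
  let j : MvPolynomial (Fin 3) ℂ →ₐ[ℂ] MvPolynomial (Fin 5) ℂ := rename ![0, 1, 2]
  have hj : ∀ (P : MvPolynomial (Fin 3) ℂ) (y t w τ ω : ℂ),
      eval ![y, t, w, τ, ω] (j P) = eval ![y, t, w] P := by
    intro P y t w τ ω
    rw [eval_rename]
    congr 2
    ext i; fin_cases i <;> rfl
  induction P using MvPolynomial.induction_on with
  | C a => exact ⟨0, 0, 0, by simp, by simp, by simp, by simp⟩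
  | add P Q hP hQ =>
    obtain ⟨A, B, D, h, h1, h2, h3⟩ := hP
    obtain ⟨A', B', D', h', h1', h2', h3'⟩ := hQ
    refine ⟨A + A', B + B', D + D', fun y t w τ ω => ?_, fun y t w => ?_, fun y t w => ?_,
      fun y t w => ?_⟩
    · simp only [map_add, h, h']; ring
    · simp only [map_add, ← h1, ← h1']; ring
    · simp only [map_add, ← h2, ← h2']; ring
    · simp only [map_add, ← h3, ← h3']; ring
  | mul_X P i hP =>
    obtain ⟨A, B, D, h, h1, h2, h3⟩ := hP
    fin_cases i
    · refine ⟨A * X 0, B * X 0, D * X 0, fun y t w τ ω => ?_, fun y t w => ?_, fun y t w => ?_,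
        fun y t w => ?_⟩
      all_goals simp [Derivation.leibniz, pderiv_X, h, ← h1, ← h2, ← h3]
      all_goals ring
    -- Multiplication by `t + τ` sends the first order terms of `P`, times `τ`, into the second
    -- order part. The mixed term is written `2 B τ ω`, whence the factor `1 / 2`.
    · refine ⟨A * (X 1 + X 3) + j (pderiv 1 P), B * (X 1 + X 3) + C (1 / 2) * j (pderiv 2 P),
        D * (X 1 + X 3), fun y t w τ ω => ?_, fun y t w => ?_, fun y t w => ?_,
        fun y t w => ?_⟩
      all_goals simp [Derivation.leibniz, pderiv_X, h, ← h1, ← h2, ← h3, hj]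
      all_goals ring
    · refine ⟨A * (X 2 + X 4), B * (X 2 + X 4) + C (1 / 2) * j (pderiv 1 P),
        D * (X 2 + X 4) + j (pderiv 2 P), fun y t w τ ω => ?_, fun y t w => ?_, fun y t w => ?_,
        fun y t w => ?_⟩
      all_goals simp [Derivation.leibniz, pderiv_X, h, ← h1, ← h2, ← h3, hj]
      all_goals ring

/-- The polynomial `P(y, t, w)` has, at the origin, no linear terms in `t, w`, and its quadratic
part in `t, w` is `t² - w²`. -/
structure IsSplitAtZero (P : MvPolynomial (Fin 3) ℂ) : Prop where
  d1 : eval 0 (pderiv 1 P) = 0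
  d2 : eval 0 (pderiv 2 P) = 0
  d11 : eval 0 (pderiv 1 (pderiv 1 P)) = 2
  d12 : eval 0 (pderiv 1 (pderiv 2 P)) = 0
  d21 : eval 0 (pderiv 2 (pderiv 1 P)) = 0
  d22 : eval 0 (pderiv 2 (pderiv 2 P)) = -2

/-- The critical branch of `P` in the variables `t, w`. -/
structure IsCriticalBranch (P : MvPolynomial (Fin 3) ℂ) (t w : ℂ → ℂ) : Prop where
  analytic_t : AnalyticAt ℂ t 0
  analytic_w : AnalyticAt ℂ w 0
  t_zero : t 0 = 0
  w_zero : w 0 = 0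
  d1 : ∀ᶠ y in 𝓝 0, eval ![y, t y, w y] (pderiv 1 P) = 0
  d2 : ∀ᶠ y in 𝓝 0, eval ![y, t y, w y] (pderiv 2 P) = 0

lemma vec3_zero : (![0, 0, 0] : Fin 3 → ℂ) = 0 := by ext i; fin_cases i <;> rfl

lemma vec3_eta (p : Fin 3 → ℂ) : ![p 0, p 1, p 2] = p := by ext i; fin_cases i <;> rfl

/-- The map `(y, ∂_t P, ∂_w P)` is locally invertible at 0, because its `t, w` block is `diag(2,
-2)`. The branch is the preimage of the `y`-axis. -/
theorem IsSplitAtZero.exists_criticalBranch {P : MvPolynomial (Fin 3) ℂ} (hP : P.IsSplitAtZero) :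
    ∃ t w : ℂ → ℂ, P.IsCriticalBranch t w := by
  let Ξ : (Fin 3 → ℂ) → (Fin 3 → ℂ) := fun p i => eval p (![X 0, pderiv 1 P, pderiv 2 P] i)
  have hΞ0 : Ξ 0 = 0 := by
    ext i; fin_cases i
    · simp [Ξ]
    · simpa [Ξ] using hP.d1
    · simpa [Ξ] using hP.d2
  have hΞ : AnalyticAt ℂ Ξ 0 := by
    rw [analyticAt_pi_iff]
    exact fun i => AnalyticOnNhd.eval_mvPolynomial _ _ (Set.mem_univ _)
  have hΞ' := hasFDerivAt_pi.2 fun i => hasFDerivAt_eval (![X 0, pderiv 1 P, pderiv 2 P] i) 0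
  obtain ⟨g, hg, hg0, h1, h2⟩ := hΞ.exists_local_inverse hΞ' (by
    rw [injective_iff_map_eq_zero]
    intro v hv
    have e0 := congrFun hv 0
    have e1 := congrFun hv 1
    have e2 := congrFun hv 2
    have h11 := hP.d11
    have h12 := hP.d12
    have h21 := hP.d21
    have h22 := hP.d22
    simp only [MvPolynomial.eval_zero] at h11 h12 h21 h22
    simp [Fin.sum_univ_three, pderiv_X] at e0 e1 e2
    simp [e0, h11, h12, h21, h22] at e1 e2
    ext i
    fin_cases i
    · simpa using e0
    · simpa using e1
    · simpa using e2)
  rw [hΞ0] at hg hg0 h2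
  let k : ℂ → (Fin 3 → ℂ) := fun y => ![y, 0, 0]
  have hk : AnalyticAt ℂ k 0 := by
    rw [analyticAt_pi_iff]
    intro i; fin_cases i
    · exact analyticAt_id
    · exact analyticAt_const
    · exact analyticAt_const
  have hk0 : k 0 = 0 := vec3_zero
  have hgk : AnalyticAt ℂ (fun y => g (k y)) 0 := by
    refine AnalyticAt.fun_comp ?_ hk
    rwa [hk0]
  have hkt : Filter.Tendsto k (𝓝 0) (𝓝 0) := by
    have := hk.continuousAt.tendsto
    rwa [hk0] at this
  have key : ∀ᶠ y in 𝓝 0, ![y, g (k y) 1, g (k y) 2] = g (k y) ∧ Ξ (g (k y)) = k y := by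
    filter_upwards [hkt.eventually h2] with y hy
    refine ⟨?_, hy⟩
    have := congrFun hy 0
    ext i; fin_cases i
    · simpa [Ξ, k] using this.symm
    · rfl
    · rfl
  refine ⟨fun y => g (k y) 1, fun y => g (k y) 2, analyticAt_pi_iff.1 hgk 1,
    analyticAt_pi_iff.1 hgk 2, by simp [hk0, hg0], by simp [hk0, hg0], ?_, ?_⟩
  · filter_upwards [key] with y hy
    rw [hy.1]
    simpa [Ξ, k] using congrFun hy.2 1
  · filter_upwards [key] with y hy
    rw [hy.1]
    simpa [Ξ, k] using congrFun hy.2 2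

/-- Splitting lemma with parameter `y`. Expanding around the branch kills the linear terms and
leaves `A τ² + 2 B τ ω + D ω² + y^N g`. Completing the square and absorbing the units `A`, `D - B² /
A` and `g` by a square root, a square root and an `N`-th root gives the normal form. -/
theorem IsSplitAtZero.contactEquiv {P : MvPolynomial (Fin 3) ℂ} (hP : P.IsSplitAtZero)
    {t w : ℂ → ℂ} (hb : P.IsCriticalBranch t w) {N : ℕ} (hN : N ≠ 0) {g : ℂ → ℂ}
    (hg : AnalyticAt ℂ g 0) (hg0 : g 0 ≠ 0)
    (hcrit : ∀ᶠ y in 𝓝 0, eval ![y, t y, w y] P = y ^ N * g y) :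
    ContactEquiv (fun p => eval p P) (fun p => p 0 ^ 2 + p 1 ^ 2 + p 2 ^ N) := by
  obtain ⟨A, B, D, hT, hA, hB, hD⟩ := P.exists_taylor_two
  have hpr : ∀ i : Fin 3, HasFDerivAt (fun p : Fin 3 → ℂ => p i)
      (ContinuousLinearMap.proj (R := ℂ) (φ := fun _ : Fin 3 => ℂ) i) 0 :=
    fun i => hasFDerivAt_apply i 0
  have han : ∀ i : Fin 3, AnalyticAt ℂ (fun p : Fin 3 → ℂ => p i) 0 := fun i =>
    (ContinuousLinearMap.proj (R := ℂ) (φ := fun _ : Fin 3 => ℂ) i).analyticAt 0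
  have hcomp : ∀ {f : ℂ → ℂ}, AnalyticAt ℂ f 0 → AnalyticAt ℂ (fun p : Fin 3 → ℂ => f (p 0)) 0 :=
    fun hf => AnalyticAt.fun_comp hf (han 0)
  let τ : (Fin 3 → ℂ) → ℂ := fun p => p 1 - t (p 0)
  let ω : (Fin 3 → ℂ) → ℂ := fun p => p 2 - w (p 0)
  have hτ : AnalyticAt ℂ τ 0 := (han 1).sub (hcomp hb.analytic_t)
  have hω : AnalyticAt ℂ ω 0 := (han 2).sub (hcomp hb.analytic_w)
  let c : (Fin 3 → ℂ) → (Fin 5 → ℂ) := fun p => ![p 0, t (p 0), w (p 0), τ p, ω p]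
  have hc : ∀ i, AnalyticAt ℂ (fun p => c p i) 0 := by
    intro i; fin_cases i
    · exact han 0
    · exact hcomp hb.analytic_t
    · exact hcomp hb.analytic_w
    · exact hτ
    · exact hω
  have hc0 : c 0 = ![0, 0, 0, 0, 0] := by simp [c, τ, ω, hb.t_zero, hb.w_zero]
  have hpoly : ∀ G : MvPolynomial (Fin 5) ℂ, AnalyticAt ℂ (fun p => eval (c p) G) 0 := fun G =>
    AnalyticAt.aeval_mvPolynomial hc G
  have hA0 : eval (c 0) A = 1 := by
    have := (hA 0 0 0).trans ((congrArg (fun v => eval v _) vec3_zero).trans hP.d11)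
    rw [hc0]; linear_combination this / 2
  have hB0 : eval (c 0) B = 0 := by
    have := (hB 0 0 0).trans ((congrArg (fun v => eval v _) vec3_zero).trans hP.d12)
    rw [hc0]; linear_combination this / 2
  have hD0 : eval (c 0) D = -1 := by
    have := (hD 0 0 0).trans ((congrArg (fun v => eval v _) vec3_zero).trans hP.d22)
    rw [hc0]; linear_combination this / 2
  have hBA : AnalyticAt ℂ (fun p => eval (c p) B / eval (c p) A) 0 :=
    (hpoly B).div (hpoly A) (by simp [hA0])
  obtain ⟨α, hα, hα0, hαA⟩ := (hpoly A).exists_root (by simp [hA0]) two_ne_zero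
  obtain ⟨γ, hγ, hγ0, hγD⟩ := (((hpoly D).sub (((hpoly B).pow 2).div (hpoly A)
    (by simp [hA0]))).exists_root (by simp [hA0, hB0, hD0]) two_ne_zero)
  obtain ⟨κ, hκ, hκ0, hκg⟩ := hg.exists_root hg0 hN
  let u : Fin 3 → (Fin 3 → ℂ) → ℂ := ![α, γ, fun p => κ (p 0)]
  let v : Fin 3 → (Fin 3 → ℂ) → ℂ :=
    ![fun p => τ p + eval (c p) B / eval (c p) A * ω p, ω, fun p => p 0]
  have hu : ∀ i, AnalyticAt ℂ (u i) 0 := by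
    intro i; fin_cases i
    exacts [hα, hγ, hcomp hκ]
  have hu0 : ∀ i, u i 0 ≠ 0 := by
    intro i; fin_cases i
    exacts [hα0, hγ0, hκ0]
  have hv : ∀ i, AnalyticAt ℂ (v i) 0 := by
    intro i; fin_cases i
    exacts [hτ.add (hBA.mul hω), hω, han 0]
  have hv0 : ∀ i, v i 0 = 0 := by
    intro i; fin_cases i <;> simp [v, τ, ω, hb.t_zero, hb.w_zero]
  have ht' := (hb.analytic_t.differentiableAt.hasDerivAt.comp_hasFDerivAt (0 : Fin 3 → ℂ) (hpr 0))
  have hw' := (hb.analytic_w.differentiableAt.hasDerivAt.comp_hasFDerivAt (0 : Fin 3 → ℂ) (hpr 0))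
  have hτ' := (hpr 1).sub ht'
  have hω' := (hpr 2).sub hw'
  have hv0' := hτ'.add (hBA.differentiableAt.hasFDerivAt.mul hω')
  -- The coordinates are units `u i` times functions `v i` vanishing at 0, so only `u i 0` and the
  -- differential of `v i` enter the linear part.
  refine ContactEquiv.of_coordinates (Ψ := fun p i => u i p * v i p)
    (Ψ' := ContinuousLinearMap.pi fun i => u i 0 • fderiv ℂ (v i) 0)
    (analyticAt_pi_iff.2 fun i => (hu i).mul (hv i)) (by ext i; simp [hv0])
    (hasFDerivAt_pi.2 fun i => ?_) ?_ ?_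
  · refine ((hu i).differentiableAt.hasFDerivAt.mul
      (hv i).differentiableAt.hasFDerivAt).congr_fderiv ?_
    ext x
    simp [hv0 i]
  · rw [injective_iff_map_eq_zero]
    intro x hx
    have e : ∀ i, fderiv ℂ (v i) 0 x = 0 := fun i => by
      have := congrFun hx i
      simpa [hu0 i] using this
    have e2 := e 2
    have e1 := e 1
    have e0 := e 0
    have f2 : fderiv ℂ (v 2) 0 = _ := (hpr 0).fderiv
    have f1 : fderiv ℂ (v 1) 0 = _ := hω'.fderiv
    have f0 : fderiv ℂ (v 0) 0 = _ := hv0'.fderiv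
    rw [f2] at e2
    rw [f1] at e1
    rw [f0] at e0
    simp only [ContinuousLinearMap.proj_apply] at e2
    simp [e2] at e1
    simp [e2, e1] at e0
    ext i
    fin_cases i
    · exact e2
    · simpa [hb.w_zero, e1, e2] using e0
    · exact e1
  · have hpr0 : Filter.Tendsto (fun p : Fin 3 → ℂ => p 0) (𝓝 0) (𝓝 0) := (han 0).continuousAt.tendsto
    have hAne : ∀ᶠ p in 𝓝 0, eval (c p) A ≠ 0 :=
      (hpoly A).continuousAt.eventually_ne (by simp [hA0])
    filter_upwards [hαA, hγD, hAne, hpr0.eventually hκg, hpr0.eventually hb.d1,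
      hpr0.eventually hb.d2, hpr0.eventually hcrit] with p h1 h2 h3 h4 h5 h6 h7
    have := hT (p 0) (t (p 0)) (w (p 0)) (τ p) (ω p)
    simp only [τ, ω, add_sub_cancel, vec3_eta] at this
    rw [this, h5, h6, h7]
    simp only [u, v, Matrix.cons_val_zero, Matrix.cons_val_one, Matrix.cons_val, mul_pow, h4, h1]
    simp only [Pi.sub_apply, Pi.div_apply, Pi.pow_apply] at h2
    rw [h2]
    have h3' : eval ![p 0, t (p 0), w (p 0), p 1 - t (p 0), p 2 - w (p 0)] A ≠ 0 := h3
    simp only [c, τ, ω]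
    field_simp
    ring

end MvPolynomial


/-! ## The germ of the double solid along a hyperplane section -/

theorem Derivation.aeval_pair {R M : Type*} [CommRing R] [Algebra ℂ R] [AddCommGroup M] [Module R M]
    [Module ℂ M] [IsScalarTower ℂ R M] (d : Derivation ℂ R M) (y z : R) (p : PolyYZ) :
    d (aeval ![y, z] p) = aeval ![y, z] (pderiv 0 p) • d y + aeval ![y, z] (pderiv 1 p) • d z := by
  induction p using MvPolynomial.induction_on with
  | C a => simp [algHom_C]
  | add p q hp hq => simp only [map_add, hp, hq, add_smul]; abel
  | mul_X p i hp =>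
    fin_cases i <;>
    · simp only [Derivation.leibniz, map_mul, map_add, smul_eq_mul, pderiv_X, hp, aeval_X]
      simp
      module

theorem MvPolynomial.aeval_mul_left_of_isHomogeneous {σ A : Type*} [Fintype σ] [CommRing A]
    [Algebra ℂ A] {p : MvPolynomial σ ℂ} {k : ℕ} (hp : p.IsHomogeneous k) (c : A) (v : σ → A) :
    aeval (fun i => c * v i) p = c ^ k * aeval v p := by
  rw [aeval_def, eval₂_eq', aeval_def, eval₂_eq', Finset.mul_sum]
  refine Finset.sum_congr rfl fun d hd => ?_
  have : ∑ i, d i = k := by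
    rw [hp.degree_eq_sum_deg_support hd]
    exact (Finset.sum_subset (Finset.subset_univ _) (by simp)).symm
  simp only [mul_pow, Finset.prod_mul_distrib, Finset.prod_pow_eq_pow_sum, this]
  ring

theorem MvPolynomial.aeval_pair_mul_of_isHomogeneous {A : Type*} [CommRing A]
    [Algebra ℂ A] {p : PolyYZ} {k : ℕ} (hp : p.IsHomogeneous k)
    (c y z : A) : aeval ![c * y, c * z] p = c ^ k * aeval ![y, z] p := by
  rw [← aeval_mul_left_of_isHomogeneous hp]
  congr 2
  ext i
  fin_cases i <;> simp

theorem MvPolynomial.pderiv_two {σ : Type*} (i : σ) : pderiv i (2 : MvPolynomial σ ℂ) = 0 := by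
  exact_mod_cast (pderiv (R := ℂ) i).map_natCast 2

namespace SplitSextic

variable (Q : SplitSextic) 

/-- The hyperplane `z = lam y + mu t + nu w` in the coordinates `y, t, w`. -/
def planeZ (lam mu nu : ℂ) : MvPolynomial (Fin 3) ℂ := C lam * X 0 + C mu * X 1 + C nu * X 2

/-- The equation of the hyperplane section. -/
def section₃ (lam mu nu : ℂ) : MvPolynomial (Fin 3) ℂ :=
  -X 2 ^ 2 + Q.h 1 (X 0) (planeZ lam mu nu) (X 1)

lemma pderiv_planeZ_one (lam mu nu : ℂ) : pderiv 1 (planeZ lam mu nu) = C mu := by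
  simp [planeZ, Derivation.leibniz, pderiv_X]

lemma pderiv_planeZ_two (lam mu nu : ℂ) : pderiv 2 (planeZ lam mu nu) = C nu := by
  simp [planeZ, Derivation.leibniz, pderiv_X]

lemma eval_zero_aeval_pair {p : PolyYZ} {k : ℕ} (hp : p.IsHomogeneous k) (hk : k ≠ 0)
    (lam mu nu : ℂ) :
    eval 0 (aeval ![X 0, planeZ lam mu nu] p) = 0 := by
  have := map_aeval_pair (aeval (0 : Fin 3 → ℂ)) p (X 0) (planeZ lam mu nu)
  rw [← coe_aeval_eq_eval]
  refine this.trans ?_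
  have h2 := aeval_pair_mul_of_isHomogeneous hp (0 : ℂ) 0 0
  rw [zero_pow hk, zero_mul, zero_mul] at h2
  rw [← h2]
  congr 3
  · simp
  · simp [planeZ]

theorem eval_zero_S (lam mu nu : ℂ) :
    eval 0 (Q.S 1 (X 0) (planeZ lam mu nu) (X 1)) = 0 := by
  have hr := eval_zero_aeval_pair Q.hom_r two_ne_zero lam mu nu
  have hs := eval_zero_aeval_pair Q.hom_s three_ne_zero lam mu nu
  simp [S, S₀, hr, hs, -aeval_eq_bind₁, -MvPolynomial.eval_zero]

theorem eval_zero_E (lam mu nu : ℂ) : eval 0 (Q.E 1 (X 0) (planeZ lam mu nu) (X 1)) = 0 := by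
  have hr := eval_zero_aeval_pair Q.hom_r two_ne_zero lam mu nu
  simp [E, hr, -aeval_eq_bind₁, -MvPolynomial.eval_zero]

theorem eval_zero_pderiv_S (lam mu nu : ℂ) :
    eval 0 (pderiv 1 (Q.S 1 (X 0) (planeZ lam mu nu) (X 1))) = 1 := by
  have hr := fun i => eval_zero_aeval_pair (Q.hom_r.pderiv (i := i)) one_ne_zero lam mu nu
  have hs := fun i => eval_zero_aeval_pair (Q.hom_s.pderiv (i := i)) two_ne_zero lam mu nu
  have hr0 := eval_zero_aeval_pair Q.hom_r two_ne_zero lam mu nu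
  have ha0 := eval_zero_aeval_pair Q.hom_a₁ one_ne_zero lam mu nu
  have hl0 := eval_zero_aeval_pair Q.hom_l one_ne_zero lam mu nu
  have hm0 := eval_zero_aeval_pair Q.hom_m two_ne_zero lam mu nu
  simp [S, S₀, S₁, hr0, hr, hs, ha0, hl0, hm0, Derivation.leibniz, pderiv_X,
    Derivation.aeval_pair, pderiv_two, -aeval_eq_bind₁, -MvPolynomial.eval_zero]

theorem eval_zero_pderiv_two_S (lam mu nu : ℂ) :
    eval 0 (pderiv 2 (Q.S 1 (X 0) (planeZ lam mu nu) (X 1))) = 0 := by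
  have hr := fun i => eval_zero_aeval_pair (Q.hom_r.pderiv (i := i)) one_ne_zero lam mu nu
  have hs := fun i => eval_zero_aeval_pair (Q.hom_s.pderiv (i := i)) two_ne_zero lam mu nu
  have hr0 := eval_zero_aeval_pair Q.hom_r two_ne_zero lam mu nu
  have ha0 := eval_zero_aeval_pair Q.hom_a₁ one_ne_zero lam mu nu
  simp [S, S₀, S₁, hr0, hr, hs, ha0, Derivation.leibniz, pderiv_X,
    Derivation.aeval_pair, pderiv_two, -aeval_eq_bind₁, -MvPolynomial.eval_zero]

/-- `S` vanishes at 0 with `∂_t S = 1` and `∂_w S = 0`, so `S²` contributes `t²`. The term `t² E`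
contributes nothing, since `E` vanishes at 0. -/
theorem isSplitAtZero (lam mu nu : ℂ) : (Q.section₃ lam mu nu).IsSplitAtZero := by
  have hS := Q.eval_zero_S lam mu nu
  have hE := Q.eval_zero_E lam mu nu
  have hS1 := Q.eval_zero_pderiv_S lam mu nu
  have hS2 := Q.eval_zero_pderiv_two_S lam mu nu
  unfold section₃ h
  generalize Q.S 1 (X 0) (planeZ lam mu nu) (X 1) = S at *
  generalize Q.E 1 (X 0) (planeZ lam mu nu) (X 1) = E at *
  constructor <;>
  simp [Derivation.leibniz, Derivation.leibniz_pow, pderiv_X, hS, hE, hS1, hS2,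
    map_ofNat (eval 0) 2, -MvPolynomial.eval_zero]

/-- The derivative of `E` at `x = 1` in a direction with components `κ` along `z` and `ε` along
`t`. -/
def dE (κ ε y z t : ℂ) : ℂ :=
  2 * Q.δ * (2 * aeval ![y, z] Q.r * aeval ![y, z] (pderiv 1 Q.r) * κ
      + t * aeval ![y, z] (pderiv 1 Q.r) * κ + ε * aeval ![y, z] Q.r
      - t * aeval ![y, z] (pderiv 1 Q.s) * κ - ε * aeval ![y, z] Q.s)
    + 2 * aeval ![y, z] Q.c₁ * (aeval ![y, z] Q.r + 2 * t) * ε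
    + 2 * aeval ![y, z] Q.c₁ * t * aeval ![y, z] (pderiv 1 Q.r) * κ
    + 2 * aeval ![y, z] (pderiv 1 Q.c₁) * κ * (aeval ![y, z] Q.r * t + t ^ 2)
    + aeval ![y, z] (pderiv 1 Q.d₂) * κ * t ^ 2 + 2 * aeval ![y, z] Q.d₂ * t * ε
    + 6 * (Q.c₀ + aeval ![y, z] Q.d₁) * t ^ 2 * ε + 2 * aeval ![y, z] (pderiv 1 Q.d₁) * κ * t ^ 3
    + 4 * Q.d₀ * t ^ 3 * ε

/-- The values of `z, S, E` along a branch, together with the critical equations. -/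
structure BranchEqs (lam mu nu : ℂ) (t w z U U' : ℂ → ℂ) : Prop where
  U_cont : ContinuousAt U 0
  U_zero : U 0 = 1
  U'_cont : ContinuousAt U' 0
  z_eq : ∀ y, z y = lam * y + mu * t y + nu * w y
  d1 : ∀ᶠ y in 𝓝[≠] (0 : ℂ), 2 * Q.S 1 y (z y) (t y) * U y
    + t y * (2 * Q.E 1 y (z y) (t y) + t y * Q.dE mu 1 y (z y) (t y)) = 0
  d2 : ∀ᶠ y in 𝓝[≠] (0 : ℂ), -2 * w y + 2 * Q.S 1 y (z y) (t y) * U' y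
    + t y ^ 2 * Q.dE nu 0 y (z y) (t y) = 0

lemma eval_section₃ (lam mu nu y t w : ℂ) : eval ![y, t, w] (Q.section₃ lam mu nu)
    = -w ^ 2 + Q.S 1 y (lam * y + mu * t + nu * w) t ^ 2
      + t ^ 2 * Q.E 1 y (lam * y + mu * t + nu * w) t := by
  change aeval ![y, t, w] (Q.section₃ lam mu nu) = _
  have hz : aeval ![y, t, w] (planeZ lam mu nu) = lam * y + mu * t + nu * w := by simp [planeZ]
  simp only [section₃, h, map_add, map_neg, map_pow, map_S, map_E, map_one, aeval_X, map_mul, hz]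
  simp
  ring

/-- `U` and `U'` are `∂_t S` and `∂_w S` on the branch. Moving `t` on the hyperplane moves `z` by
`mu`, and moving `w` moves `z` by `nu` with `t` fixed, whence the arguments `mu 1` and `nu 0` of
`dE`. -/
theorem branchEqs {lam mu nu : ℂ} {t w : ℂ → ℂ}
    (hb : (Q.section₃ lam mu nu).IsCriticalBranch t w) :
    ∃ U U' : ℂ → ℂ, Q.BranchEqs lam mu nu t w (fun y => lam * y + mu * t y + nu * w y) U U' := by
  set Sp := Q.S 1 (X 0) (planeZ lam mu nu) (X 1) with hSp
  set Ep := Q.E 1 (X 0) (planeZ lam mu nu) (X 1) with hEp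
  have hcont : ∀ G : MvPolynomial (Fin 3) ℂ, ContinuousAt (fun y => eval ![y, t y, w y] G) 0 := by
    intro G
    refine (AnalyticAt.aeval_mvPolynomial (𝕜 := ℂ) (f := fun y : ℂ => ![y, t y, w y]) (z := (0 : ℂ))
      (fun i => ?_) G).continuousAt
    fin_cases i
    exacts [analyticAt_id, hb.analytic_t, hb.analytic_w]
  have hz : ∀ y, aeval ![y, t y, w y] (planeZ lam mu nu) = lam * y + mu * t y + nu * w y := by
    intro y; simp [planeZ]
  have hS : ∀ y, eval ![y, t y, w y] Sp = Q.S 1 y (lam * y + mu * t y + nu * w y) (t y) := by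
    intro y
    change aeval ![y, t y, w y] Sp = _
    rw [hSp, map_S, hz]; simp
  have hE : ∀ y, eval ![y, t y, w y] Ep = Q.E 1 y (lam * y + mu * t y + nu * w y) (t y) := by
    intro y
    change aeval ![y, t y, w y] Ep = _
    rw [hEp, map_E, hz]; simp
  have hev : ∀ (p : PolyYZ) y, eval ![y, t y, w y] (aeval ![X 0, planeZ lam mu nu] p)
      = aeval ![y, lam * y + mu * t y + nu * w y] p := by
    intro p y
    change aeval ![y, t y, w y] (aeval ![X 0, planeZ lam mu nu] p) = _
    rw [map_aeval_pair, hz]; simp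
  have hE1 : ∀ y, eval ![y, t y, w y] (pderiv 1 Ep)
      = Q.dE mu 1 y (lam * y + mu * t y + nu * w y) (t y) := by
    intro y
    simp [hEp, E, Derivation.leibniz, Derivation.leibniz_pow, pderiv_X, Derivation.aeval_pair,
      pderiv_two, -aeval_eq_bind₁, hev, pderiv_planeZ_one, map_ofNat (eval _) 2, dE]
    ring
  have hE2 : ∀ y, eval ![y, t y, w y] (pderiv 2 Ep)
      = Q.dE nu 0 y (lam * y + mu * t y + nu * w y) (t y) := by
    intro y
    simp [hEp, E, Derivation.leibniz, Derivation.leibniz_pow, pderiv_X, Derivation.aeval_pair,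
      pderiv_two, -aeval_eq_bind₁, hev, pderiv_planeZ_two, map_ofNat (eval _) 2, dE]
    ring
  refine ⟨fun y => eval ![y, t y, w y] (pderiv 1 Sp), fun y => eval ![y, t y, w y] (pderiv 2 Sp),
    hcont _, ?_, hcont _, fun _ => rfl, ?_, ?_⟩
  · simp only [hb.t_zero, hb.w_zero, vec3_zero]
    exact Q.eval_zero_pderiv_S lam mu nu
  · filter_upwards [hb.d1.filter_mono nhdsWithin_le_nhds] with y hy
    have : pderiv 1 (Q.section₃ lam mu nu) = 2 * Sp * pderiv 1 Sp + X 1 * (2 * Ep + X 1 * pderiv 1 Ep) := by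
      unfold section₃ h
      rw [← hSp, ← hEp]
      simp [Derivation.leibniz, Derivation.leibniz_pow, pderiv_X]
      ring
    rw [this] at hy
    simp only [map_add, map_mul, map_ofNat, eval_X, hS, hE, hE1] at hy
    simpa using hy
  · filter_upwards [hb.d2.filter_mono nhdsWithin_le_nhds] with y hy
    have : pderiv 2 (Q.section₃ lam mu nu) = -2 * X 2 + 2 * Sp * pderiv 2 Sp + X 1 ^ 2 * pderiv 2 Ep := by
      unfold section₃ h
      rw [← hSp, ← hEp]
      simp [Derivation.leibniz, Derivation.leibniz_pow, pderiv_X]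
      ring
    rw [this] at hy
    simp only [map_add, map_mul, map_ofNat, map_pow, map_neg, eval_X, hS, hE2] at hy
    simpa using hy
end SplitSextic


/-! ### First order estimates on the critical branch -/

namespace SplitSextic

variable (Q : SplitSextic)

lemma continuousAt_hat {z : ℂ → ℂ} (hz : ContinuousAt z 0) (p : PolyYZ) :
    ContinuousAt (fun y => aeval ![1, z y] p) 0 := by
  have h1 : ContinuousAt (fun y => ![1, z y]) (0 : ℂ) := by
    rw [continuousAt_pi]
    intro i; fin_cases i
    exacts [continuousAt_const, hz]
  exact ContinuousAt.comp (g := fun v => aeval v p) (p.continuous_eval).continuousAt h1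

lemma aeval_pair_one_mul {p : PolyYZ} {k : ℕ} (hp : p.IsHomogeneous k) (y z : ℂ) :
    aeval ![y, y * z] p = y ^ k * aeval ![1, z] p := by
  have := aeval_pair_mul_of_isHomogeneous hp y 1 z
  rwa [mul_one] at this

/-- Values of the coefficients of `S` on the line through `(1, z)`. -/
lemma S_scaled (y z t : ℂ) : Q.S 1 y (y * z) t = t * (1 + Q.α * t + 2 * y * aeval ![1, z] Q.a₁
      + Q.β * t ^ 2 + y * aeval ![1, z] Q.l * t + y ^ 2 * aeval ![1, z] Q.m)
    + y ^ 2 * (aeval ![1, z] Q.r + y * (aeval ![1, z] Q.s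
      + 2 * aeval ![1, z] Q.a₁ * aeval ![1, z] Q.r)) := by
  simp only [S, S₁, S₀, aeval_pair_one_mul Q.hom_r, aeval_pair_one_mul Q.hom_s,
    aeval_pair_one_mul Q.hom_a₁, aeval_pair_one_mul Q.hom_l, aeval_pair_one_mul Q.hom_m]
  simp only [Algebra.algebraMap_self, RingHom.id_apply]
  ring

lemma E_scaled (y z t : ℂ) : Q.E 1 y (y * z) t =
    2 * Q.δ * (y ^ 4 * aeval ![1, z] Q.r ^ 2 + t * y ^ 2 * aeval ![1, z] Q.r
      - y ^ 3 * aeval ![1, z] Q.s * t)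
    + 2 * y * aeval ![1, z] Q.c₁ * (y ^ 2 * aeval ![1, z] Q.r * t + t ^ 2)
    + y ^ 2 * aeval ![1, z] Q.d₂ * t ^ 2
    + 2 * (Q.c₀ + y * aeval ![1, z] Q.d₁) * t ^ 3 + Q.d₀ * t ^ 4 := by
  simp only [E, aeval_pair_one_mul Q.hom_r, aeval_pair_one_mul Q.hom_s,
    aeval_pair_one_mul Q.hom_c₁, aeval_pair_one_mul Q.hom_d₁, aeval_pair_one_mul Q.hom_d₂]
  simp only [Algebra.algebraMap_self, RingHom.id_apply]
  ring

lemma dE_scaled (κ ε y z t : ℂ) : Q.dE κ ε y (y * z) t =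
  2 * Q.δ * (2 * y ^ 3 * aeval ![1, z] Q.r * aeval ![1, z] (pderiv 1 Q.r) * κ
      + t * y * aeval ![1, z] (pderiv 1 Q.r) * κ + ε * y ^ 2 * aeval ![1, z] Q.r
      - t * y ^ 2 * aeval ![1, z] (pderiv 1 Q.s) * κ - ε * y ^ 3 * aeval ![1, z] Q.s)
    + 2 * y * aeval ![1, z] Q.c₁ * (y ^ 2 * aeval ![1, z] Q.r + 2 * t) * ε
    + 2 * y ^ 2 * aeval ![1, z] Q.c₁ * t * aeval ![1, z] (pderiv 1 Q.r) * κ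
    + 2 * aeval ![1, z] (pderiv 1 Q.c₁) * κ * (y ^ 2 * aeval ![1, z] Q.r * t + t ^ 2)
    + y * aeval ![1, z] (pderiv 1 Q.d₂) * κ * t ^ 2 + 2 * y ^ 2 * aeval ![1, z] Q.d₂ * t * ε
    + 6 * (Q.c₀ + y * aeval ![1, z] Q.d₁) * t ^ 2 * ε
    + 2 * aeval ![1, z] (pderiv 1 Q.d₁) * κ * t ^ 3
    + 4 * Q.d₀ * t ^ 3 * ε := by
  simp only [dE, aeval_pair_one_mul Q.hom_r, aeval_pair_one_mul Q.hom_s,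
    aeval_pair_one_mul Q.hom_c₁, aeval_pair_one_mul Q.hom_d₁, aeval_pair_one_mul Q.hom_d₂,
    aeval_pair_one_mul Q.hom_r.pderiv, aeval_pair_one_mul Q.hom_s.pderiv,
    aeval_pair_one_mul Q.hom_c₁.pderiv, aeval_pair_one_mul Q.hom_d₁.pderiv,
    aeval_pair_one_mul Q.hom_d₂.pderiv]
  ring

lemma exists_eq_mul_of_analyticAt {f : ℂ → ℂ} (hf : AnalyticAt ℂ f 0) (h0 : f 0 = 0) :
    ∃ g : ℂ → ℂ, ContinuousAt g 0 ∧ ∀ y, f y = y * g y := by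
  refine ⟨dslope f 0, continuousAt_dslope_same.2 hf.differentiableAt, fun y => ?_⟩
  have := sub_smul_dslope f 0 y
  simpa [h0] using this.symm

/-- The critical branch satisfies `t, w = O(y²)`. -/
lemma BranchEqs.exists_order_two {lam mu nu : ℂ} {t w z U U' : ℂ → ℂ}
    (hb : Q.BranchEqs lam mu nu t w z U U') (ht : AnalyticAt ℂ t 0) (hw : AnalyticAt ℂ w 0)
    (ht0 : t 0 = 0) (hw0 : w 0 = 0) :
    ∃ t₂ w₂ : ℂ → ℂ, ContinuousAt t₂ 0 ∧ ContinuousAt w₂ 0 ∧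
      ∀ᶠ y in 𝓝[≠] (0 : ℂ), t y = y ^ 2 * t₂ y ∧ w y = y ^ 2 * w₂ y := by
  obtain ⟨t₁, ht₁, htt⟩ := exists_eq_mul_of_analyticAt ht ht0
  obtain ⟨w₁, hw₁, hww⟩ := exists_eq_mul_of_analyticAt hw hw0
  have hUc := hb.U_cont
  have hU'c := hb.U'_cont
  have hU : U 0 ≠ 0 := by simp [hb.U_zero]
  have hUne := (hUc.eventually_ne hU).filter_mono (nhdsWithin_le_nhds (s := {0}ᶜ))
  obtain ⟨zh, hzh⟩ : ∃ zh : ℂ → ℂ, zh = fun y => lam + mu * t₁ y + nu * w₁ y := ⟨_, rfl⟩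
  have hzc : ContinuousAt zh 0 := by rw [hzh]; fun_prop
  have hz : ∀ y, z y = y * zh y := fun y => by rw [hb.z_eq, hzh, htt, hww]; ring
  have hat := continuousAt_hat hzc
  obtain ⟨E₁, hE₁c, hE₁⟩ : ∃ E₁ : ℂ → ℂ, ContinuousAt E₁ 0 ∧
      ∀ y, Q.E 1 y (z y) (t y) = y ^ 3 * E₁ y := by
    refine ⟨fun y => 2 * Q.δ * (y * aeval ![1, zh y] Q.r ^ 2 + t₁ y * aeval ![1, zh y] Q.r
        - y * aeval ![1, zh y] Q.s * t₁ y)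
      + 2 * aeval ![1, zh y] Q.c₁ * (y * aeval ![1, zh y] Q.r * t₁ y + t₁ y ^ 2)
      + y * aeval ![1, zh y] Q.d₂ * t₁ y ^ 2
      + 2 * (Q.c₀ + y * aeval ![1, zh y] Q.d₁) * t₁ y ^ 3 + y * Q.d₀ * t₁ y ^ 4, ?_, fun y => ?_⟩
    · have h1 := hat Q.r
      have h2 := hat Q.s
      have h3 := hat Q.c₁
      have h4 := hat Q.d₂
      have h5 := hat Q.d₁
      fun_prop
    · rw [hz, htt, E_scaled]; ring
  have hV : ∀ κ ε : ℂ, ∃ V : ℂ → ℂ, ContinuousAt V 0 ∧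
      ∀ y, Q.dE κ ε y (z y) (t y) = y ^ 2 * V y := by
    intro κ ε
    refine ⟨fun y => 2 * Q.δ * (2 * y * aeval ![1, zh y] Q.r * aeval ![1, zh y] (pderiv 1 Q.r) * κ
      + t₁ y * aeval ![1, zh y] (pderiv 1 Q.r) * κ + ε * aeval ![1, zh y] Q.r
      - t₁ y * y * aeval ![1, zh y] (pderiv 1 Q.s) * κ - ε * y * aeval ![1, zh y] Q.s)
    + 2 * aeval ![1, zh y] Q.c₁ * (y * aeval ![1, zh y] Q.r + 2 * t₁ y) * ε
    + 2 * y * aeval ![1, zh y] Q.c₁ * t₁ y * aeval ![1, zh y] (pderiv 1 Q.r) * κ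
    + 2 * aeval ![1, zh y] (pderiv 1 Q.c₁) * κ * (y * aeval ![1, zh y] Q.r * t₁ y + t₁ y ^ 2)
    + y * aeval ![1, zh y] (pderiv 1 Q.d₂) * κ * t₁ y ^ 2
    + 2 * y * aeval ![1, zh y] Q.d₂ * t₁ y * ε
    + 6 * (Q.c₀ + y * aeval ![1, zh y] Q.d₁) * t₁ y ^ 2 * ε
    + 2 * y * aeval ![1, zh y] (pderiv 1 Q.d₁) * κ * t₁ y ^ 3
    + 4 * y * Q.d₀ * t₁ y ^ 3 * ε, ?_, fun y => ?_⟩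
    · have h1 := hat Q.r
      have h2 := hat Q.s
      have h3 := hat Q.c₁
      have h4 := hat Q.d₂
      have h5 := hat Q.d₁
      have h6 := hat (pderiv 1 Q.r)
      have h7 := hat (pderiv 1 Q.s)
      have h8 := hat (pderiv 1 Q.c₁)
      have h9 := hat (pderiv 1 Q.d₂)
      have h10 := hat (pderiv 1 Q.d₁)
      fun_prop
    · rw [hz, htt, dE_scaled]; ring
  obtain ⟨V, hVc, hV1⟩ := hV mu 1
  obtain ⟨V', hV'c, hV2⟩ := hV nu 0
  -- The first critical equation, solved for `S` by means of the unit `U`: it expresses `S` through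
  -- `t E` and `t² dE`, which are `O(y⁴)` already from `t = O(y)`.
  obtain ⟨S₄, hS₄c, hS₄⟩ : ∃ S₄ : ℂ → ℂ, ContinuousAt S₄ 0 ∧
      ∀ᶠ y in 𝓝[≠] (0 : ℂ), Q.S 1 y (z y) (t y) = y ^ 4 * S₄ y := by
    refine ⟨fun y => -t₁ y * (2 * E₁ y + t₁ y * V y) / (2 * U y), ?_, ?_⟩
    · exact ContinuousAt.div₀ (by fun_prop) (by fun_prop) (by simpa using hU)
    · filter_upwards [hb.d1, hUne] with y hy hUy
      rw [hE₁, hV1, htt] at hy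
      field_simp
      rw [htt]
      linear_combination hy
  -- `T` is the unit `S₁` on the branch. From `S = t T + y² (...)` and `S = O(y⁴)` it follows that
  -- `t = O(y²)`.
  obtain ⟨T, hT⟩ : ∃ T : ℂ → ℂ, T = fun y => 1 + Q.α * t y + 2 * y * aeval ![1, zh y] Q.a₁
      + Q.β * t y ^ 2 + y * aeval ![1, zh y] Q.l * t y + y ^ 2 * aeval ![1, zh y] Q.m := ⟨_, rfl⟩
  have hTc : ContinuousAt T 0 := by
    have h1 := hat Q.a₁
    have h2 := hat Q.l
    have h3 := hat Q.m
    have h4 := ht.continuousAt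
    rw [hT]; fun_prop
  have hT0 : T 0 ≠ 0 := by simp [hT, ht0]
  have hTne := (hTc.eventually_ne hT0).filter_mono (nhdsWithin_le_nhds (s := {0}ᶜ))
  refine ⟨fun y => (y ^ 2 * S₄ y - (aeval ![1, zh y] Q.r + y * (aeval ![1, zh y] Q.s
      + 2 * aeval ![1, zh y] Q.a₁ * aeval ![1, zh y] Q.r))) / T y,
    fun y => y ^ 2 * S₄ y * U' y + y ^ 2 * t₁ y ^ 2 * V' y / 2, ?_, by fun_prop, ?_⟩
  · have h1 := hat Q.a₁
    have h2 := hat Q.r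
    have h3 := hat Q.s
    exact ContinuousAt.div₀ (by fun_prop) hTc hT0
  · filter_upwards [hS₄, hb.d2, hTne] with y h1 h2 h3
    constructor
    · rw [hz, S_scaled] at h1
      rw [mul_div_assoc', eq_div_iff h3, hT]
      linear_combination h1
    · rw [h1, hV2, htt] at h2
      linear_combination -h2 / 2
end SplitSextic


/-! ### Expansion of the critical branch and the critical value -/

namespace SplitSextic

variable (Q : SplitSextic)

lemma eq_at_zero_of_eventually {f g : ℂ → ℂ} (hf : ContinuousAt f 0) (hg : ContinuousAt g 0)
    (h : ∀ᶠ y in 𝓝[≠] (0 : ℂ), f y = g y) : f 0 = g 0 :=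
  tendsto_nhds_unique_of_eventuallyEq (hf.tendsto.mono_left nhdsWithin_le_nhds)
    (hg.tendsto.mono_left nhdsWithin_le_nhds) h

/-- Expansion of the critical branch: `z = y zh`, `t = y² t₂`. -/
structure BranchExpansion (lam : ℂ) (t z zh t₂ q : ℂ → ℂ) : Prop where
  zh_cont : ContinuousAt zh 0
  t₂_cont : ContinuousAt t₂ 0
  q_cont : ContinuousAt q 0
  zh_zero : zh 0 = lam
  t₂_zero : t₂ 0 = -aeval ![1, lam] Q.r
  q_zero : q 0 = 2 * aeval ![1, lam] Q.a₁ * aeval ![1, lam] Q.s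
    + (aeval ![1, lam] Q.m - Q.α * aeval ![1, lam] Q.r) * aeval ![1, lam] Q.r
  z_eq : ∀ᶠ y in 𝓝[≠] (0 : ℂ), z y = y * zh y
  t_eq : ∀ᶠ y in 𝓝[≠] (0 : ℂ), t y = y ^ 2 * t₂ y
  t₂_eq : ∀ᶠ y in 𝓝[≠] (0 : ℂ),
    t₂ y = -aeval ![1, zh y] Q.r + y * (-aeval ![1, zh y] Q.s + y * q y)

/-- If `E` and its derivatives vanish to order `k + 2` and `k` on the critical branch, then `S` and
`w` vanish to order `k + 4`. -/
lemma BranchEqs.order_S_w {lam mu nu : ℂ} {t w z U U' t₂ E₂ V V' : ℂ → ℂ} {k : ℕ}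
    (hb : Q.BranchEqs lam mu nu t w z U U') (ht₂ : ContinuousAt t₂ 0) (hE₂ : ContinuousAt E₂ 0)
    (hV : ContinuousAt V 0) (hV' : ContinuousAt V' 0)
    (ht : ∀ᶠ y in 𝓝[≠] (0 : ℂ), t y = y ^ 2 * t₂ y)
    (hE : ∀ᶠ y in 𝓝[≠] (0 : ℂ), Q.E 1 y (z y) (t y) = y ^ (k + 2) * E₂ y)
    (h1 : ∀ᶠ y in 𝓝[≠] (0 : ℂ), Q.dE mu 1 y (z y) (t y) = y ^ k * V y)
    (h2 : ∀ᶠ y in 𝓝[≠] (0 : ℂ), Q.dE nu 0 y (z y) (t y) = y ^ k * V' y) :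
    ∃ S' w' : ℂ → ℂ, ContinuousAt S' 0 ∧ ContinuousAt w' 0 ∧
      (∀ᶠ y in 𝓝[≠] (0 : ℂ), Q.S 1 y (z y) (t y) = y ^ (k + 4) * S' y) ∧
      ∀ᶠ y in 𝓝[≠] (0 : ℂ), w y = y ^ (k + 4) * w' y := by
  have hUc := hb.U_cont
  have hU'c := hb.U'_cont
  have hU : U 0 ≠ 0 := by simp [hb.U_zero]
  have hUne := (hUc.eventually_ne hU).filter_mono (nhdsWithin_le_nhds (s := {0}ᶜ))
  obtain ⟨S', hS'c, hS'⟩ : ∃ S' : ℂ → ℂ, ContinuousAt S' 0 ∧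
      ∀ᶠ y in 𝓝[≠] (0 : ℂ), Q.S 1 y (z y) (t y) = y ^ (k + 4) * S' y := by
    refine ⟨fun y => -t₂ y * (2 * E₂ y + t₂ y * V y) / (2 * U y), ?_, ?_⟩
    · exact ContinuousAt.div₀ (by fun_prop) (by fun_prop) (by simpa using hU)
    · filter_upwards [hb.d1, hUne, ht, hE, h1] with y hy hUy ht hE h1
      rw [hE, h1, ht] at hy
      rw [mul_div_assoc', eq_div_iff (by simpa using hUy), ht]
      linear_combination hy
  refine ⟨S', fun y => S' y * U' y + t₂ y ^ 2 * V' y / 2, hS'c, by fun_prop, hS', ?_⟩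
  filter_upwards [hS', hb.d2, ht, h2] with y h1 h2 h3 h4
  rw [h1, h4, h3] at h2
  linear_combination -h2 / 2

/-- With `t = O(y²)` known, `E = O(y⁴)` and its derivatives are `O(y²)`, so `S = O(y⁶)`. The
relation `S = O(y⁶)` then determines `t` recursively. Binary forms are kept at the moving point `(1,
zh y)`; only `zh 0 = lam` matters for leading coefficients. -/
lemma BranchEqs.exists_expansion {lam mu nu : ℂ} {t w z U U' : ℂ → ℂ}
    (hb : Q.BranchEqs lam mu nu t w z U U') (ht : AnalyticAt ℂ t 0) (hw : AnalyticAt ℂ w 0)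
    (ht0 : t 0 = 0) (hw0 : w 0 = 0) :
    ∃ zh t₂ q S₆ w₆ : ℂ → ℂ, Q.BranchExpansion lam t z zh t₂ q ∧
      ContinuousAt S₆ 0 ∧ ContinuousAt w₆ 0 ∧
      (∀ᶠ y in 𝓝[≠] (0 : ℂ), Q.S 1 y (z y) (t y) = y ^ 6 * S₆ y) ∧
      ∀ᶠ y in 𝓝[≠] (0 : ℂ), w y = y ^ 6 * w₆ y := by
  obtain ⟨t₂, w₂, ht₂, hw₂, htw⟩ := hb.exists_order_two Q ht hw ht0 hw0
  have htt : ∀ᶠ y in 𝓝[≠] (0 : ℂ), t y = y ^ 2 * t₂ y := htw.mono fun _ h => h.1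
  obtain ⟨zh, hzh⟩ : ∃ zh : ℂ → ℂ, zh = fun y => lam + y * (mu * t₂ y + nu * w₂ y) := ⟨_, rfl⟩
  have hzc : ContinuousAt zh 0 := by rw [hzh]; fun_prop
  have hz0 : zh 0 = lam := by simp [hzh]
  have hz : ∀ᶠ y in 𝓝[≠] (0 : ℂ), z y = y * zh y := by
    filter_upwards [htw] with y hy
    rw [hb.z_eq, hzh, hy.1, hy.2]; ring
  have hat := continuousAt_hat hzc
  have hr := hat Q.r
  have hs := hat Q.s
  obtain ⟨E₂, hE₂c, hE₂⟩ : ∃ E₂ : ℂ → ℂ, ContinuousAt E₂ 0 ∧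
      ∀ᶠ y in 𝓝[≠] (0 : ℂ), Q.E 1 y (z y) (t y) = y ^ (2 + 2) * E₂ y := by
    refine ⟨fun y => 2 * Q.δ * (aeval ![1, zh y] Q.r ^ 2 + t₂ y * aeval ![1, zh y] Q.r
        - y * aeval ![1, zh y] Q.s * t₂ y)
      + 2 * y * aeval ![1, zh y] Q.c₁ * (aeval ![1, zh y] Q.r * t₂ y + t₂ y ^ 2)
      + y ^ 2 * aeval ![1, zh y] Q.d₂ * t₂ y ^ 2
      + 2 * y ^ 2 * (Q.c₀ + y * aeval ![1, zh y] Q.d₁) * t₂ y ^ 3 + y ^ 4 * Q.d₀ * t₂ y ^ 4,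
      ?_, ?_⟩
    · have h3 := hat Q.c₁
      have h4 := hat Q.d₂
      have h5 := hat Q.d₁
      fun_prop
    · filter_upwards [hz, htt] with y h1 h2
      rw [h1, h2, E_scaled]; ring
  have hV : ∀ κ ε : ℂ, ∃ V : ℂ → ℂ, ContinuousAt V 0 ∧
      ∀ᶠ y in 𝓝[≠] (0 : ℂ), Q.dE κ ε y (z y) (t y) = y ^ 2 * V y := by
    intro κ ε
    refine ⟨fun y => 2 * Q.δ * (2 * y * aeval ![1, zh y] Q.r * aeval ![1, zh y] (pderiv 1 Q.r) * κ
      + y * t₂ y * aeval ![1, zh y] (pderiv 1 Q.r) * κ + ε * aeval ![1, zh y] Q.r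
      - t₂ y * y ^ 2 * aeval ![1, zh y] (pderiv 1 Q.s) * κ - ε * y * aeval ![1, zh y] Q.s)
    + 2 * y * aeval ![1, zh y] Q.c₁ * (aeval ![1, zh y] Q.r + 2 * t₂ y) * ε
    + 2 * y ^ 2 * aeval ![1, zh y] Q.c₁ * t₂ y * aeval ![1, zh y] (pderiv 1 Q.r) * κ
    + 2 * y ^ 2 * aeval ![1, zh y] (pderiv 1 Q.c₁) * κ * (aeval ![1, zh y] Q.r * t₂ y + t₂ y ^ 2)
    + y ^ 3 * aeval ![1, zh y] (pderiv 1 Q.d₂) * κ * t₂ y ^ 2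
    + 2 * y ^ 2 * aeval ![1, zh y] Q.d₂ * t₂ y * ε
    + 6 * y ^ 2 * (Q.c₀ + y * aeval ![1, zh y] Q.d₁) * t₂ y ^ 2 * ε
    + 2 * y ^ 4 * aeval ![1, zh y] (pderiv 1 Q.d₁) * κ * t₂ y ^ 3
    + 4 * y ^ 4 * Q.d₀ * t₂ y ^ 3 * ε, ?_, ?_⟩
    · have h3 := hat Q.c₁
      have h4 := hat Q.d₂
      have h5 := hat Q.d₁
      have h6 := hat (pderiv 1 Q.r)
      have h7 := hat (pderiv 1 Q.s)
      have h8 := hat (pderiv 1 Q.c₁)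
      have h9 := hat (pderiv 1 Q.d₂)
      have h10 := hat (pderiv 1 Q.d₁)
      fun_prop
    · filter_upwards [hz, htt] with y h1 h2
      rw [h1, h2, dE_scaled]; ring
  obtain ⟨V, hVc, hV1⟩ := hV mu 1
  obtain ⟨V', hV'c, hV2⟩ := hV nu 0
  obtain ⟨S₆, w₆, hS₆c, hw₆c, hS₆, hw₆⟩ := hb.order_S_w Q ht₂ hE₂c hVc hV'c htt hE₂ hV1 hV2
  have ha := hat Q.a₁
  have hl := hat Q.l
  have hm := hat Q.m
  obtain ⟨n, hn⟩ : ∃ n : ℂ → ℂ, n = fun y => Q.α * t₂ y + y ^ 2 * Q.β * t₂ y ^ 2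
      + y * aeval ![1, zh y] Q.l * t₂ y + aeval ![1, zh y] Q.m := ⟨_, rfl⟩
  have hnc : ContinuousAt n 0 := by rw [hn]; fun_prop
  have hS : ∀ᶠ y in 𝓝[≠] (0 : ℂ), t₂ y * (1 + 2 * y * aeval ![1, zh y] Q.a₁ + y ^ 2 * n y)
      + aeval ![1, zh y] Q.r + y * (aeval ![1, zh y] Q.s
        + 2 * aeval ![1, zh y] Q.a₁ * aeval ![1, zh y] Q.r) = y ^ 4 * S₆ y := by
    filter_upwards [hS₆, hz, htt, self_mem_nhdsWithin] with y h1 h2 h3 h4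
    have h4 : y ≠ 0 := h4
    rw [h2, h3, S_scaled] at h1
    apply mul_left_cancel₀ (pow_ne_zero 2 h4)
    rw [hn]
    linear_combination h1
  obtain ⟨q₁, hq₁⟩ : ∃ q₁ : ℂ → ℂ, q₁ = fun y => -(aeval ![1, zh y] Q.s
    + 2 * aeval ![1, zh y] Q.a₁ * (aeval ![1, zh y] Q.r + t₂ y)) - y * n y * t₂ y
    + y ^ 3 * S₆ y := ⟨_, rfl⟩
  have hq₁c : ContinuousAt q₁ 0 := by rw [hq₁]; fun_prop
  have h1 : ∀ᶠ y in 𝓝[≠] (0 : ℂ), t₂ y = -aeval ![1, zh y] Q.r + y * q₁ y := by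
    filter_upwards [hS] with y hy
    rw [hq₁]; linear_combination hy
  have ht₂0 : t₂ 0 = -aeval ![1, lam] Q.r := by
    have := eq_at_zero_of_eventually ht₂ (by fun_prop) h1
    simpa [hz0] using this
  -- Second pass: `r + t₂ = y q₁` turns `2 a₁ (r + t₂)` into a term of higher order. This is why
  -- `S₀` contains `2 a₁ r`: the coefficient after `-r` becomes exactly `-s`.
  obtain ⟨q, hq⟩ : ∃ q : ℂ → ℂ, q = fun y =>
    -2 * aeval ![1, zh y] Q.a₁ * q₁ y - n y * t₂ y + y ^ 2 * S₆ y := ⟨_, rfl⟩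
  have hqc : ContinuousAt q 0 := by rw [hq]; fun_prop
  refine ⟨zh, t₂, q, S₆, w₆, ⟨hzc, ht₂, hqc, hz0, ht₂0, ?_, hz, htt, ?_⟩, hS₆c, hw₆c, hS₆, hw₆⟩
  · simp only [hq, hq₁, hn, hz0, ht₂0]; ring
  · filter_upwards [h1] with y hy
    have h5 : aeval ![1, zh y] Q.r + t₂ y = y * q₁ y := by linear_combination hy
    have h6 : q₁ y = -aeval ![1, zh y] Q.s + y * q y := by
      rw [hq]
      conv_lhs => rw [hq₁]
      simp only [h5]
      ring
    rw [← h6]; exact hy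

/-- The leading coefficient of the critical value, by level. -/
def lead : ℕ → PolyYZ
  | 9 => Q.r ^ 2 * (2 * C Q.δ * (Q.s ^ 2 + Q.r * (2 * Q.a₁ * Q.s + (Q.m - C Q.α * Q.r) * Q.r))
      + 2 * Q.c₁ * Q.r * Q.s + Q.d₂ * Q.r ^ 2 - 2 * C Q.c₀ * Q.r ^ 3)
  | 10 => -Q.r ^ 2 * (2 * Q.r ^ 2 * (C Q.c₀ * Q.s + Q.d₁ * Q.r))
  | _ => C Q.d₀ * Q.r ^ 6

/-- `S² - w²` has order at least 12, so up to that order the value is `t² E`. After substituting `r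
= -t₂ + y (-s + y q)`, the cancellation of `r` against `t₂` raises the order of `E` to 6 at level 9,
to 7 at level 10 and to 8 at level 11. -/
theorem critical_value {n : ℕ} (hL : Q.Level n) {lam mu nu : ℂ} {t w : ℂ → ℂ}
    (hb : (Q.section₃ lam mu nu).IsCriticalBranch t w) :
    ∃ g : ℂ → ℂ, ContinuousAt g 0 ∧ g 0 = aeval ![1, lam] (Q.lead n) ∧
      ∀ᶠ y in 𝓝[≠] (0 : ℂ), eval ![y, t y, w y] (Q.section₃ lam mu nu) = y ^ (n + 1) * g y := by
  obtain ⟨U, U', hB⟩ := Q.branchEqs hb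
  obtain ⟨zh, t₂, q, S₆, w₆, he, hS₆c, hw₆c, hS₆, hw₆⟩ :=
    hB.exists_expansion Q hb.analytic_t hb.analytic_w hb.t_zero hb.w_zero
  have ht₂ := he.t₂_cont
  have hqc := he.q_cont
  have hat := continuousAt_hat he.zh_cont
  have hr := hat Q.r
  have hs := hat Q.s
  have h3 := hat Q.c₁
  have h4 := hat Q.d₂
  have h5 := hat Q.d₁
  rcases hL with ⟨rfl, -⟩ | ⟨rfl, hδ, hc, hd, -⟩ | ⟨rfl, hδ, hc, hd, hc0, hd1, -⟩
  · refine ⟨fun y => -y ^ 2 * w₆ y ^ 2 + y ^ 2 * S₆ y ^ 2 + t₂ y ^ 2 *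
      (2 * Q.δ * (aeval ![1, zh y] Q.r * q y
          - aeval ![1, zh y] Q.s * (-aeval ![1, zh y] Q.s + y * q y))
        + 2 * aeval ![1, zh y] Q.c₁ * t₂ y * (-aeval ![1, zh y] Q.s + y * q y)
        + aeval ![1, zh y] Q.d₂ * t₂ y ^ 2
        + 2 * (Q.c₀ + y * aeval ![1, zh y] Q.d₁) * t₂ y ^ 3 + y ^ 2 * Q.d₀ * t₂ y ^ 4),
      by fun_prop, ?_, ?_⟩
    · simp only [he.zh_zero, he.t₂_zero, he.q_zero, lead]
      simp only [map_mul, map_pow, map_add, map_sub, map_ofNat, aeval_C, Algebra.algebraMap_self,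
        RingHom.id_apply]
      ring
    · filter_upwards [hS₆, hw₆, he.z_eq, he.t_eq, he.t₂_eq] with y e1 e2 e3 e4 e5
      rw [eval_section₃, e1, e3, e4, e2, E_scaled]
      -- Eliminating `r` in favour of `t₂` makes the divisibility by `y¹⁰` a polynomial identity.
      have e6 : aeval ![1, zh y] Q.r = -t₂ y + y * (-aeval ![1, zh y] Q.s + y * q y) := by
        linear_combination e5
      generalize aeval ![1, zh y] Q.r = r at *
      subst e6
      ring
  · have hd' : ∀ z : ℂ, aeval ![1, z] Q.d₂ = 2 * Q.c₀ * aeval ![1, z] Q.r := fun z => by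
      simp [hd]
    have hd'' : ∀ z : ℂ, aeval ![1, z] (pderiv 1 Q.d₂)
        = 2 * Q.c₀ * aeval ![1, z] (pderiv 1 Q.r) := fun z => by
      simp [hd, Derivation.leibniz, pderiv_two]
    have h6 := hat (pderiv 1 Q.r)
    have h7 := hat (pderiv 1 Q.d₁)
    obtain ⟨S₈, w₈, hS₈c, hw₈c, hS₈, hw₈⟩ := hB.order_S_w Q (k := 4)
      (E₂ := fun y => 2 * Q.c₀ * (aeval ![1, zh y] Q.r * t₂ y ^ 2 + t₂ y ^ 3)
        + 2 * y * aeval ![1, zh y] Q.d₁ * t₂ y ^ 3 + y ^ 2 * Q.d₀ * t₂ y ^ 4)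
      (V := fun y => 2 * y * Q.c₀ * aeval ![1, zh y] (pderiv 1 Q.r) * mu * t₂ y ^ 2
        + 4 * Q.c₀ * aeval ![1, zh y] Q.r * t₂ y
        + 6 * (Q.c₀ + y * aeval ![1, zh y] Q.d₁) * t₂ y ^ 2
        + 2 * y ^ 2 * aeval ![1, zh y] (pderiv 1 Q.d₁) * mu * t₂ y ^ 3
        + 4 * y ^ 2 * Q.d₀ * t₂ y ^ 3)
      (V' := fun y => 2 * y * Q.c₀ * aeval ![1, zh y] (pderiv 1 Q.r) * nu * t₂ y ^ 2
        + 2 * y ^ 2 * aeval ![1, zh y] (pderiv 1 Q.d₁) * nu * t₂ y ^ 3)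
      ht₂ (by fun_prop) (by fun_prop) (by fun_prop) he.t_eq (by
        filter_upwards [he.z_eq, he.t_eq] with y e3 e4
        rw [e3, e4, E_scaled, hδ, hc, hd']; simp only [map_zero]; ring) (by
        filter_upwards [he.z_eq, he.t_eq] with y e3 e4
        rw [e3, e4, dE_scaled, hδ, hc, hd', hd'']; simp only [map_zero]; ring) (by
        filter_upwards [he.z_eq, he.t_eq] with y e3 e4
        rw [e3, e4, dE_scaled, hδ, hc, hd', hd'']; simp only [map_zero]; ring)
    refine ⟨fun y => -y ^ 5 * w₈ y ^ 2 + y ^ 5 * S₈ y ^ 2 + t₂ y ^ 2 *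
      (2 * Q.c₀ * t₂ y ^ 2 * (-aeval ![1, zh y] Q.s + y * q y)
        + 2 * aeval ![1, zh y] Q.d₁ * t₂ y ^ 3 + y * Q.d₀ * t₂ y ^ 4),
      by fun_prop, ?_, ?_⟩
    · simp only [he.zh_zero, he.t₂_zero, he.q_zero, lead]
      simp only [map_mul, map_pow, map_add, map_neg, map_ofNat, aeval_C,
        Algebra.algebraMap_self, RingHom.id_apply]
      ring
    · filter_upwards [hS₈, hw₈, he.z_eq, he.t_eq, he.t₂_eq] with y e1 e2 e3 e4 e5
      rw [eval_section₃, e1, e3, e4, e2, E_scaled, hδ, hc, hd']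
      have e6 : aeval ![1, zh y] Q.r = -t₂ y + y * (-aeval ![1, zh y] Q.s + y * q y) := by
        linear_combination e5
      simp only [map_zero]
      generalize aeval ![1, zh y] Q.r = r at *
      subst e6
      ring
  · rw [hc0, C_0, mul_zero, zero_mul] at hd
    -- Here the critical value has order 12, and with `S, w = O(y⁶)` the difference `S² - w²` could
    -- interfere. Only the coefficient `d₀` of `E` survives, which improves both to `O(y⁸)`.
    obtain ⟨S₈, w₈, hS₈c, hw₈c, hS₈, hw₈⟩ := hB.order_S_w Q (k := 4)
      (E₂ := fun y => y ^ 2 * Q.d₀ * t₂ y ^ 4) (V := fun y => 4 * y ^ 2 * Q.d₀ * t₂ y ^ 3)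
      (V' := fun y => 0)
      ht₂ (by fun_prop) (by fun_prop) (by fun_prop) he.t_eq (by
        filter_upwards [he.z_eq, he.t_eq] with y e3 e4
        rw [e3, e4, E_scaled, hδ, hc, hd, hc0, hd1]; simp only [map_zero]; ring) (by
        filter_upwards [he.z_eq, he.t_eq] with y e3 e4
        rw [e3, e4, dE_scaled, hδ, hc, hd, hc0, hd1]; simp only [map_zero]; ring) (by
        filter_upwards [he.z_eq, he.t_eq] with y e3 e4
        rw [e3, e4, dE_scaled, hδ, hc, hd, hc0, hd1]; simp only [map_zero]; ring)
    refine ⟨fun y => -y ^ 4 * w₈ y ^ 2 + y ^ 4 * S₈ y ^ 2 + Q.d₀ * t₂ y ^ 6, by fun_prop, ?_, ?_⟩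
    · simp only [he.t₂_zero, lead]
      simp only [map_mul, map_pow, aeval_C, Algebra.algebraMap_self, RingHom.id_apply]
      ring
    · filter_upwards [hS₈, hw₈, he.z_eq, he.t_eq] with y e1 e2 e3 e4
      rw [eval_section₃, e1, e3, e4, e2, E_scaled, hδ, hc, hd, hc0, hd1]
      simp only [map_zero]
      ring
end SplitSextic


/-! ## Coprimality -/

lemma MvPolynomial.IsHomogeneous.not_isUnit {σ : Type*} {p : MvPolynomial σ ℂ} {k : ℕ}
    (hp : p.IsHomogeneous k) (hk : k ≠ 0) : ¬ IsUnit p := by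
  intro hu
  have h0 : p ≠ 0 := hu.ne_zero
  obtain ⟨-, h2⟩ := MvPolynomial.isUnit_iff_totalDegree_of_isReduced.1 hu
  exact hk ((hp.totalDegree h0).symm.trans h2)

lemma MvPolynomial.IsHomogeneous.eq_zero_of_dvd {σ : Type*} {p q : MvPolynomial σ ℂ} {k l : ℕ}
    (hp : p.IsHomogeneous k) (hq : q.IsHomogeneous l) (hlk : l < k) (h : p ∣ q) : q = 0 := by
  by_contra h0
  have hp0 : p ≠ 0 := by rintro rfl; exact h0 (zero_dvd_iff.1 h)
  have := totalDegree_le_of_dvd_of_isDomain h h0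
  rw [hp.totalDegree hp0, hq.totalDegree h0] at this
  omega

lemma exists_prime_dvd {p : PolyYZ} (h0 : p ≠ 0) (hu : ¬ IsUnit p) : ∃ l, Prime l ∧ l ∣ p := by
  obtain ⟨l, hl, hd⟩ := WfDvdMonoid.exists_irreducible_factor hu h0
  exact ⟨l, hl.prime, hd⟩

lemma NoCommonPrime.isRelPrime {p q : PolyYZ} (h : NoCommonPrime p q) (hp : p ≠ 0) :
    IsRelPrime p q := by
  intro d h1 h2
  by_contra hu
  have hd : d ≠ 0 := by rintro rfl; exact hp (zero_dvd_iff.1 h1)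
  obtain ⟨l, hl, hld⟩ := exists_prime_dvd hd hu
  exact h l hl (hld.trans h1) (hld.trans h2)

namespace SplitSextic

variable (Q : SplitSextic)

/-- If `r = 0`, any prime divisor of `s`, or any prime at all when `s = 0`, is common to both. -/
lemma r_ne_zero : Q.r ≠ 0 := by
  intro h0
  have h := Q.coprime
  rw [h0] at h
  by_cases hs : Q.s = 0
  · rw [hs] at h
    exact h (X 0) (X_prime) (dvd_zero _) (dvd_zero _)
  · obtain ⟨l, hl, hd⟩ := exists_prime_dvd hs (Q.hom_s.not_isUnit three_ne_zero)
    exact h l hl (dvd_zero _) hd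

lemma isRelPrime : IsRelPrime Q.r Q.s := Q.coprime.isRelPrime Q.r_ne_zero

/-- Successive reduction modulo `r`, of degree 2 and coprime to `s`. At level 9, vanishing gives `r
∣ 2 δ s²`, so `δ = 0`; after division by `r` it gives `r ∣ 2 c₁ s`, so `c₁ = 0` by degree; what
remains is `d₂ = 2 c₀ r`. At level 10, `r ∣ c₀ s` forces `c₀ = 0` and then `d₁ = 0`. -/
lemma lead_ne_zero {n : ℕ} (hL : Q.Level n) : Q.lead n ≠ 0 := by
  have hr := Q.r_ne_zero
  have hrel := Q.isRelPrime
  rcases hL with ⟨rfl, h⟩ | ⟨rfl, -, -, -, h⟩ | ⟨rfl, -, -, -, -, -, h⟩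
  · intro h0
    apply h
    rw [lead, mul_eq_zero_iff_left (pow_ne_zero 2 hr)] at h0
    have hδ : Q.δ = 0 := by
      have h1 : Q.r ∣ C (2 * Q.δ) * Q.s ^ 2 := by
        refine ⟨-(2 * C Q.δ * (2 * Q.a₁ * Q.s + (Q.m - C Q.α * Q.r) * Q.r)
          + 2 * Q.c₁ * Q.s + Q.d₂ * Q.r - 2 * C Q.c₀ * Q.r ^ 2), ?_⟩
        rw [C_mul, map_ofNat C 2]
        linear_combination h0
      have h2 := (hrel.pow_right (n := 2)).dvd_of_dvd_mul_right h1
      have h3 := Q.hom_r.eq_zero_of_dvd (isHomogeneous_C _ _) two_pos h2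
      simpa using h3
    have h1 : Q.r * (2 * Q.c₁ * Q.s + Q.d₂ * Q.r - 2 * C Q.c₀ * Q.r ^ 2) = 0 := by
      rw [hδ, C_0] at h0
      linear_combination h0
    replace h1 := (mul_eq_zero_iff_left hr).1 h1
    have hc : Q.c₁ = 0 := by
      have h2 : Q.r ∣ C 2 * Q.c₁ * Q.s := ⟨-(Q.d₂ - 2 * C Q.c₀ * Q.r), by
        rw [map_ofNat C 2]; linear_combination h1⟩
      have h3 := Q.hom_r.eq_zero_of_dvd (Q.hom_c₁.C_mul 2) one_lt_two
        (hrel.dvd_of_dvd_mul_right h2)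
      simpa using h3
    refine ⟨hδ, hc, ?_⟩
    apply mul_left_cancel₀ hr
    rw [hc] at h1
    linear_combination h1
  · intro h0
    apply h
    rw [lead, mul_eq_zero_iff_left (neg_ne_zero.2 (pow_ne_zero 2 hr)),
      mul_eq_zero_iff_left (mul_ne_zero two_ne_zero (pow_ne_zero 2 hr))] at h0
    have hc : Q.c₀ = 0 := by
      have h3 := Q.hom_r.eq_zero_of_dvd (isHomogeneous_C _ Q.c₀) two_pos
        (hrel.dvd_of_dvd_mul_right ⟨-Q.d₁, by linear_combination h0⟩)
      simpa using h3
    refine ⟨hc, ?_⟩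
    rw [hc, C_0, zero_mul, zero_add] at h0
    exact (mul_eq_zero_iff_right hr).1 h0
  · simp [lead, h, hr]

lemma isHomogeneous_lead {n : ℕ} (hL : Q.Level n) : (Q.lead n).IsHomogeneous (n + 1) := by
  have hr := Q.hom_r
  have hs := Q.hom_s
  have h2 : ∀ p : PolyYZ, ∀ k, p.IsHomogeneous k → (2 * p).IsHomogeneous k := fun p k hp => by
    rw [← map_ofNat C 2]; exact hp.C_mul 2
  rcases hL with ⟨rfl, -⟩ | ⟨rfl, -⟩ | ⟨rfl, -⟩
  · have e1 : (Q.s ^ 2).IsHomogeneous 6 := hs.pow 2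
    have e2 : (Q.a₁ * Q.s).IsHomogeneous 4 := Q.hom_a₁.mul hs
    have e3 : ((Q.m - C Q.α * Q.r) * Q.r).IsHomogeneous 4 := (Q.hom_m.sub (hr.C_mul _)).mul hr
    have e4 : (Q.r * (2 * Q.a₁ * Q.s + (Q.m - C Q.α * Q.r) * Q.r)).IsHomogeneous 6 := by
      rw [mul_assoc 2]
      exact hr.mul ((h2 _ _ e2).add e3)
    have e5 : (Q.c₁ * Q.r * Q.s).IsHomogeneous 6 := (Q.hom_c₁.mul hr).mul hs
    have e6 : (Q.d₂ * Q.r ^ 2).IsHomogeneous 6 := Q.hom_d₂.mul (hr.pow 2)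
    have e7 : (C Q.c₀ * Q.r ^ 3).IsHomogeneous 6 := (hr.pow 3).C_mul _
    have e8 : (Q.r ^ 2).IsHomogeneous 4 := hr.pow 2
    have e9 := e8.mul ((((h2 _ _ ((e1.add e4).C_mul Q.δ)).add (h2 _ _ e5)).add e6).sub (h2 _ _ e7))
    convert e9 using 1
    simp only [lead]; ring
  · have e1 : (C Q.c₀ * Q.s + Q.d₁ * Q.r).IsHomogeneous 3 :=
      (hs.C_mul _).add (Q.hom_d₁.mul hr)
    have e8 : (Q.r ^ 2).IsHomogeneous 4 := hr.pow 2
    have e9 : Q.lead 10 = -(Q.r ^ 2 * (2 * (Q.r ^ 2 * (C Q.c₀ * Q.s + Q.d₁ * Q.r)))) := by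
      simp only [lead]; ring
    rw [e9]
    exact (e8.mul (h2 _ _ (e8.mul e1))).neg
  · exact (hr.pow 6).C_mul _

/-! ### The general hyperplane section -/

theorem critical_value_analytic {n : ℕ} (hL : Q.Level n) {lam mu nu : ℂ} {t w : ℂ → ℂ}
    (hb : (Q.section₃ lam mu nu).IsCriticalBranch t w) (hlam : aeval ![1, lam] (Q.lead n) ≠ 0) :
    ∃ g : ℂ → ℂ, AnalyticAt ℂ g 0 ∧ g 0 ≠ 0 ∧
      ∀ᶠ y in 𝓝 (0 : ℂ), eval ![y, t y, w y] (Q.section₃ lam mu nu) = y ^ (n + 1) * g y := by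
  obtain ⟨g, hg, hg0, h⟩ := Q.critical_value hL hb
  have hf : AnalyticAt ℂ (fun y => eval ![y, t y, w y] (Q.section₃ lam mu nu)) 0 := by
    refine AnalyticAt.aeval_mvPolynomial (𝕜 := ℂ) (f := fun y : ℂ => ![y, t y, w y])
      (fun i => ?_) _
    fin_cases i
    exacts [analyticAt_id, hb.analytic_t, hb.analytic_w]
  have h' : ∀ᶠ y in 𝓝 (0 : ℂ), eval ![y, t y, w y] (Q.section₃ lam mu nu) = y ^ (n + 1) * g y := by
    rw [eventually_nhdsWithin_iff] at h
    filter_upwards [h] with y hy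
    by_cases h0 : y = 0
    · subst h0
      have := Q.S_scaled 0 0 0
      simp [eval_section₃, hb.t_zero, hb.w_zero] at this ⊢
      exact this
    · exact hy h0
  have hO : (fun y => eval ![y, t y, w y] (Q.section₃ lam mu nu)) =O[𝓝 0] fun y => y ^ (n + 1) := by
    have h1 : g =O[𝓝 0] fun _ => (1 : ℂ) := hg.isBigO_one ℂ
    have h2 := (Asymptotics.isBigO_refl (fun y : ℂ => y ^ (n + 1)) (𝓝 0)).mul h1
    exact h2.congr' (h'.mono fun y hy => hy.symm) (by simp)
  obtain ⟨G, hG, hfG⟩ := hf.exists_eventually_eq_pow_mul_of_isBigO hO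
  refine ⟨G, hG, ?_, hfG⟩
  have : G 0 = g 0 := by
    refine eq_at_zero_of_eventually hG.continuousAt hg ?_
    filter_upwards [hfG.filter_mono nhdsWithin_le_nhds, h, self_mem_nhdsWithin] with y h1 h2 h3
    exact mul_left_cancel₀ (pow_ne_zero _ h3) (h1.symm.trans h2)
  rwa [this, hg0]

lemma chartEquation_zero : chartEquation Q.poly 0 = -X 3 ^ 2 + Q.h 1 (X 0) (X 1) (X 2) := by
  simp only [chartEquation, poly, map_add, map_neg, map_pow, map_h, aeval_X]
  rfl

lemma germAtPx_poly (p : Fin 4 → ℂ) :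
    germAtPx Q.poly p = -p 3 ^ 2 + Q.S 1 (p 0) (p 1) (p 2) ^ 2 + p 2 ^ 2 * Q.E 1 (p 0) (p 1) (p 2) := by
  rw [germAtPx, chartEquation_zero]
  change aeval p _ = _
  simp only [h, map_add, map_neg, map_pow, map_mul, map_S, map_E, aeval_X, map_one]
  ring

/-- A hyperplane with `c 1 ≠ 0` is solved for `z`, with slope `lam = -c 0 / c 1`. By homogeneity
`lead n` is nonzero at `(1, lam)` exactly when it is nonzero at `(c 1, -c 0)`; hence the polynomial
`Δ`. Every parametrization `ι` differs from the one by `y, t, w` by the linear automorphism `L`. -/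
theorem isCompoundA {n : ℕ} (hL : Q.Level n) : IsCompoundA n (germAtPx Q.poly) := by
  have hhom := Q.isHomogeneous_lead hL
  have hne := Q.lead_ne_zero hL
  let Λ' : MvPolynomial (Fin 4) ℂ := aeval ![X 1, -X 0] (Q.lead n)
  have hΛ' : ∀ c : Fin 4 → ℂ, eval c Λ' = aeval ![c 1, -c 0] (Q.lead n) := by
    intro c
    change aeval c Λ' = _
    simp only [Λ', map_aeval_pair, map_neg, aeval_X]
  refine ⟨X 1 * Λ', mul_ne_zero (X_ne_zero 1) ?_, ?_⟩
  · intro h0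
    apply hne
    apply MvPolynomial.funext
    intro x
    have := hΛ' ![-x 1, x 0, 0, 0]
    rw [h0, map_zero] at this
    rw [map_zero]
    convert this.symm using 1
    change aeval x _ = _
    congr 2
    ext i; fin_cases i <;> simp
  · intro c hc ι hι hrange
    rw [map_mul, eval_X, hΛ'] at hc
    have hc1 : c 1 ≠ 0 := left_ne_zero_of_mul hc
    have hlam : aeval ![1, -c 0 / c 1] (Q.lead n) ≠ 0 := by
      intro h0
      apply right_ne_zero_of_mul hc
      have := aeval_pair_mul_of_isHomogeneous hhom (c 1) 1 (-c 0 / c 1)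
      rw [h0, mul_zero, mul_one, mul_div_cancel₀ _ hc1] at this
      exact this
    have hmem : ∀ p, ι p 1 = (-c 0 / c 1) * ι p 0 + (-c 2 / c 1) * ι p 2 + (-c 3 / c 1) * ι p 3 := by
      intro p
      have : ι p ∈ Set.range ι := ⟨p, rfl⟩
      rw [hrange, Set.mem_ofPred_eq, Fin.sum_univ_four] at this
      field_simp
      linear_combination this
    let L : (Fin 3 → ℂ) →ₗ[ℂ] (Fin 3 → ℂ) := LinearMap.pi
      ![LinearMap.proj 0 ∘ₗ ι, LinearMap.proj 2 ∘ₗ ι, LinearMap.proj 3 ∘ₗ ι]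
    have hL0 : ∀ p, L p = ![ι p 0, ι p 2, ι p 3] := by
      intro p; ext i; fin_cases i <;> rfl
    have hLinj : Function.Injective L := by
      rw [injective_iff_map_eq_zero]
      intro p hp
      rw [hL0] at hp
      have e0 : ι p 0 = 0 := congrFun hp 0
      have e2 : ι p 2 = 0 := congrFun hp 1
      have e3 : ι p 3 = 0 := congrFun hp 2
      apply hι
      rw [map_zero]
      ext i
      fin_cases i
      · exact e0
      · simpa [e0, e2, e3] using hmem p
      · exact e2
      · exact e3
    have hsplit := Q.isSplitAtZero (-c 0 / c 1) (-c 2 / c 1) (-c 3 / c 1)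
    obtain ⟨t, w, hb⟩ := hsplit.exists_criticalBranch
    obtain ⟨g, hg, hg0, hcrit⟩ := Q.critical_value_analytic hL hb hlam
    have := (hsplit.contactEquiv hb (Nat.succ_ne_zero n) hg hg0 hcrit).comp_linearEquiv
      (LinearEquiv.ofInjectiveEndo L hLinj)
    unfold IsDuValA
    convert this using 2 with p
    have e : (LinearEquiv.ofInjectiveEndo L hLinj) p = L p := rfl
    rw [e, hL0, eval_section₃, germAtPx_poly, hmem p]
end SplitSextic


/-! ## Irreducibility -/

namespace MvPolynomial

/-- Polynomials in `n + 1` variables as polynomials in the last variable. -/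
def lastEquiv (n : ℕ) :
    MvPolynomial (Fin (n + 1)) ℂ ≃ₐ[ℂ] Polynomial (MvPolynomial (Fin n) ℂ) :=
  (renameEquiv ℂ finSuccEquivLast).trans (optionEquivLeft ℂ (Fin n))

lemma lastEquiv_X_last (n : ℕ) : lastEquiv n (X (Fin.last n)) = Polynomial.X := by
  simp [lastEquiv, optionEquivLeft_X_none, finSuccEquivLast_last]

lemma lastEquiv_rename {n : ℕ} (p : MvPolynomial (Fin n) ℂ) :
    lastEquiv n (rename Fin.castSucc p) = Polynomial.C p := by
  induction p using MvPolynomial.induction_on with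
  | C a => simp [lastEquiv, optionEquivLeft_C]
  | add p q hp hq => simp only [map_add, hp, hq]
  | mul_X p i hp =>
    simp only [map_mul, hp, rename_X]
    simp [lastEquiv, optionEquivLeft_X_some, finSuccEquivLast_castSucc]

lemma irreducible_X_last_sq_sub {n : ℕ} {p : MvPolynomial (Fin n) ℂ} (hp : ∀ q, p ≠ q ^ 2) :
    Irreducible (X (Fin.last n) ^ 2 - rename Fin.castSucc p : MvPolynomial (Fin (n + 1)) ℂ) := by
  rw [← MulEquiv.irreducible_iff (lastEquiv n)]
  rw [map_sub, map_pow, lastEquiv_X_last, lastEquiv_rename]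
  rw [(Polynomial.monic_X_pow_sub_C p two_ne_zero).irreducible_iff_roots_eq_zero_of_degree_le_three
    (by rw [Polynomial.natDegree_X_pow_sub_C]) (by rw [Polynomial.natDegree_X_pow_sub_C]; omega)]
  rw [Multiset.eq_zero_iff_forall_notMem]
  intro a ha
  have := Polynomial.isRoot_of_mem_roots ha
  simp only [Polynomial.IsRoot, Polynomial.eval_sub, Polynomial.eval_pow, Polynomial.eval_X,
    Polynomial.eval_C] at this
  exact hp a (sub_eq_zero.1 this).symm

end MvPolynomial

namespace SplitSextic

variable (Q : SplitSextic)

lemma exists_aeval_lead_ne_zero {n : ℕ} (hL : Q.Level n) :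
    ∃ lam : ℂ, aeval ![1, lam] (Q.lead n) ≠ 0 := by
  by_contra! h
  have h0 : X 0 * Q.lead n = 0 := by
    apply MvPolynomial.funext
    intro v
    rw [map_mul, eval_X, map_zero]
    by_cases hv : v 0 = 0
    · rw [hv, zero_mul]
    · have := aeval_pair_mul_of_isHomogeneous (Q.isHomogeneous_lead hL) (v 0) 1 (v 1 / v 0)
      rw [h, mul_zero, mul_one, mul_div_cancel₀ _ hv] at this
      have e : ![v 0, v 1] = v := by ext i; fin_cases i <;> rfl
      rw [e] at this
      change _ * aeval v (Q.lead n) = 0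
      rw [this, mul_zero]
  exact (mul_ne_zero (X_ne_zero 0) (Q.lead_ne_zero hL)) h0

/-- If `h = P²`, a section has equation `-w² + p²` with `p` free of `w` and `∂_t p` invertible at 0.
The critical equations then force `p = w = 0` on the branch, so the critical value is zero,
contradicting its finite order. -/
theorem h_ne_sq {n : ℕ} (hL : Q.Level n) (P : MvPolynomial (Fin 4) ℂ) :
    Q.h (X 0) (X 1) (X 2) (X 3) ≠ P ^ 2 := by
  intro hP
  obtain ⟨lam, hlam⟩ := Q.exists_aeval_lead_ne_zero hL
  have hsplit := Q.isSplitAtZero lam 0 0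
  obtain ⟨t, w, hb⟩ := hsplit.exists_criticalBranch
  obtain ⟨g, hg, hg0, hcrit⟩ := Q.critical_value_analytic hL hb hlam
  obtain ⟨p, hp⟩ : ∃ p : MvPolynomial (Fin 3) ℂ,
      p = aeval ![1, X 0, planeZ lam 0 0, X 1] P := ⟨_, rfl⟩
  have hh : Q.h 1 (X 0) (planeZ lam 0 0) (X 1) = p ^ 2 := by
    have := congrArg (aeval ![1, X 0, planeZ lam 0 0, X 1]) hP
    rw [map_pow, map_h, ← hp] at this
    simpa using this
  have hsec : Q.section₃ lam 0 0 = -X 2 ^ 2 + p ^ 2 := by rw [section₃, hh]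
  have hp2 : pderiv 2 p = 0 := by
    have h1 : pderiv 2 (Q.h 1 (X 0) (planeZ lam 0 0) (X 1)) = 0 := by
      simp [h, S, S₁, S₀, E, Derivation.leibniz, Derivation.leibniz_pow, pderiv_X,
        Derivation.aeval_pair, pderiv_two, -aeval_eq_bind₁, pderiv_planeZ_two]
    rw [hh, Derivation.leibniz_pow] at h1
    by_cases h0 : p = 0
    · rw [h0, map_zero]
    · simpa [h0] using h1
  have d1 : pderiv 1 (Q.section₃ lam 0 0) = 2 * p * pderiv 1 p := by
    rw [hsec]; simp [Derivation.leibniz_pow, pderiv_X]; ring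
  have d2 : pderiv 2 (Q.section₃ lam 0 0) = -2 * X 2 := by
    rw [hsec]; simp [Derivation.leibniz_pow, pderiv_X, hp2]
  have hp0 : eval 0 p = 0 := by
    have h1 := Q.eval_section₃ lam 0 0 0 0 0
    have h2 := Q.S_scaled 0 0 0
    simp at h2
    rw [hsec, vec3_zero] at h1
    simp [h2, -MvPolynomial.eval_zero] at h1
    exact h1
  have hp1 : eval 0 (pderiv 1 p) ≠ 0 := by
    intro h0
    have h1 := hsplit.d11
    rw [d1] at h1
    simp [Derivation.leibniz, h0, hp0, pderiv_two, -MvPolynomial.eval_zero] at h1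
  have hcont : ContinuousAt (fun y => eval ![y, t y, w y] (pderiv 1 p)) 0 := by
    refine (AnalyticAt.aeval_mvPolynomial (𝕜 := ℂ) (f := fun y : ℂ => ![y, t y, w y]) (z := (0 : ℂ))
      (fun i => ?_) _).continuousAt
    fin_cases i
    exacts [analyticAt_id, hb.analytic_t, hb.analytic_w]
  have hne : ∀ᶠ y in 𝓝 (0 : ℂ), eval ![y, t y, w y] (pderiv 1 p) ≠ 0 :=
    hcont.eventually_ne (by simpa only [hb.t_zero, hb.w_zero, vec3_zero] using hp1)
  have hgne : ∀ᶠ y in 𝓝[≠] (0 : ℂ), g y ≠ 0 :=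
    (hg.continuousAt.eventually_ne hg0).filter_mono nhdsWithin_le_nhds
  have hfalse : ∀ᶠ y in 𝓝[≠] (0 : ℂ), False := by
    filter_upwards [hb.d1.filter_mono nhdsWithin_le_nhds, hb.d2.filter_mono nhdsWithin_le_nhds,
      hne.filter_mono nhdsWithin_le_nhds, hcrit.filter_mono nhdsWithin_le_nhds, hgne,
      self_mem_nhdsWithin] with y h1 h2 h3 h4 h5 h6
    rw [d1, map_mul, map_mul, map_ofNat (eval _) 2] at h1
    have hpz : eval ![y, t y, w y] p = 0 := by simpa [h3] using h1
    have hwz : w y = 0 := by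
      rw [d2] at h2; simpa using h2
    rw [hsec, hwz] at h4
    rw [hwz] at hpz
    simp [hpz] at h4
    exact h4.elim h6 h5
  exact hfalse.exists.elim fun _ h => h

lemma isHomogeneous_h : (Q.h (X 0) (X 1) (X 2) (X 3) : MvPolynomial (Fin 4) ℂ).IsHomogeneous 6 := by
  have hX : ∀ i : Fin 4, (X i : MvPolynomial (Fin 4) ℂ).IsHomogeneous 1 := isHomogeneous_X ℂ
  have hC : ∀ a : ℂ, (algebraMap ℂ (MvPolynomial (Fin 4) ℂ) a).IsHomogeneous 0 :=
    fun a => isHomogeneous_C _ a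
  have h2 : (2 : MvPolynomial (Fin 4) ℂ).IsHomogeneous 0 := by
    rw [← map_ofNat C 2]; exact isHomogeneous_C _ _
  have ha : ∀ {p : PolyYZ} {k : ℕ}, p.IsHomogeneous k →
      IsHomogeneous (aeval ![X 1, X 2] p : MvPolynomial (Fin 4) ℂ) k := by
    intro p k hp
    have h1 : ∀ i : Fin 2, IsHomogeneous ((![X 1, X 2] : Fin 2 → MvPolynomial (Fin 4) ℂ) i) 1 := by
      intro i; fin_cases i
      · exact hX 1
      · exact hX 2
    exact (one_mul k) ▸ hp.aeval _ h1
  have hr := ha Q.hom_r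
  have hs := ha Q.hom_s
  have ha1 := ha Q.hom_a₁
  have hl := ha Q.hom_l
  have hm := ha Q.hom_m
  have hc := ha Q.hom_c₁
  have hd1 := ha Q.hom_d₁
  have hd2 := ha Q.hom_d₂
  have hS₁ : IsHomogeneous (Q.S₁ (X 0) (X 1) (X 2) (X 3) : MvPolynomial (Fin 4) ℂ) 2 := by
    have e1 := (hX 0).pow 2
    have e2 := (hX 0).mul (((hC Q.α).mul (hX 3)).add (h2.mul ha1))
    have e3 := (hC Q.β).mul ((hX 3).pow 2)
    have e4 := hl.mul (hX 3)
    exact (((e1.add e2).add e3).add e4).add hm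
  have hS₀ : IsHomogeneous (Q.S₀ (X 0) (X 1) (X 2) : MvPolynomial (Fin 4) ℂ) 3 :=
    ((hX 0).mul hr).add (hs.add ((h2.mul ha1).mul hr))
  have hS : IsHomogeneous (Q.S (X 0) (X 1) (X 2) (X 3) : MvPolynomial (Fin 4) ℂ) 3 :=
    ((hX 3).mul hS₁).add hS₀
  have hE : IsHomogeneous (Q.E (X 0) (X 1) (X 2) (X 3) : MvPolynomial (Fin 4) ℂ) 4 := by
    have e1 := (h2.mul (hC Q.δ)).mul (((hr.pow 2).add (((hX 0).mul (hX 3)).mul hr)).sub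
      (hs.mul (hX 3)))
    have e2 := (h2.mul hc).mul ((hr.mul (hX 3)).add ((hX 0).mul ((hX 3).pow 2)))
    have e3 := hd2.mul ((hX 3).pow 2)
    have e4 := (h2.mul (((hC Q.c₀).mul (hX 0)).add hd1)).mul ((hX 3).pow 3)
    have e5 := (hC Q.d₀).mul ((hX 3).pow 4)
    exact (((e1.add e2).add e3).add e4).add e5
  exact (hS.pow 2).add (((hX 3).pow 2).mul hE)

theorem isSexticDoubleSolid {n : ℕ} (hL : Q.Level n) : IsSexticDoubleSolid Q.poly := by
  have hren : rename Fin.castSucc (Q.h (X 0) (X 1) (X 2) (X 3) : MvPolynomial (Fin 4) ℂ)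
      = Q.h (X 0) (X 1) (X 2) (X 3) := by
    rw [map_h]; simp
  have hirr := irreducible_X_last_sq_sub (Q.h_ne_sq hL)
  rw [sub_eq_add_neg, ← map_neg] at hirr
  refine ⟨-Q.h (X 0) (X 1) (X 2) (X 3), Q.isHomogeneous_h.neg, hirr, ⟨-1, ?_⟩⟩
  rw [map_neg, hren, poly, Units.val_neg, Units.val_one]
  ring

/-! ## The singular curve -/

/-- Nullstellensatz: otherwise `s` vanishes on the zero set of a prime divisor `l` of `r`, and then
`l ∣ s`. -/
lemma exists_zero_r : ∃ v : Fin 2 → ℂ, aeval v Q.r = 0 ∧ aeval v Q.s ≠ 0 := by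
  obtain ⟨l, hl, hlr⟩ := exists_prime_dvd Q.r_ne_zero (Q.hom_r.not_isUnit two_ne_zero)
  by_contra! h
  apply Q.coprime l hl hlr
  have h1 : Q.s ∈ vanishingIdeal ℂ (zeroLocus ℂ (Ideal.span {l})) := by
    rw [mem_vanishingIdeal_iff]
    intro v hv
    apply h
    rw [mem_zeroLocus_iff] at hv
    exact hv _ (Ideal.mem_span_singleton.2 hlr)
  have hp : (Ideal.span {l}).IsPrime := (Ideal.span_singleton_prime hl.ne_zero).2 hl
  rw [vanishingIdeal_zeroLocus_eq_radical, hp.radical, Ideal.mem_span_singleton] at h1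
  exact h1

/-- The equation is `-w² + S² + t² E`, and `w`, `S`, `t` all vanish at the point. -/
lemma fderiv_germAtPx_eq_zero {p : Fin 4 → ℂ} (h2 : p 2 = 0) (h3 : p 3 = 0)
    (hS : Q.S 1 (p 0) (p 1) (p 2) = 0) : fderiv ℂ (germAtPx Q.poly) p = 0 := by
  have h1 : HasFDerivAt (germAtPx Q.poly) _ p := hasFDerivAt_eval (chartEquation Q.poly 0) p
  rw [h1.fderiv]
  refine Finset.sum_eq_zero fun i _ => ?_
  have hS' : eval p (Q.S 1 (X 0) (X 1) (X 2) : MvPolynomial (Fin 4) ℂ) = 0 := by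
    change aeval p _ = 0
    rw [map_S]; simpa using hS
  rw [chartEquation_zero, h]
  generalize (Q.S 1 (X 0) (X 1) (X 2) : MvPolynomial (Fin 4) ℂ) = S at *
  generalize (Q.E 1 (X 0) (X 1) (X 2) : MvPolynomial (Fin 4) ℂ) = E at *
  have : eval p (pderiv i (-X 3 ^ 2 + (S ^ 2 + X 2 ^ 2 * E))) = 0 := by
    simp [Derivation.leibniz, Derivation.leibniz_pow, h2, h3, hS']
  rw [this]
  ext; simp

/-- At `μ (y, z)` and `t = 0`, the form `S` equals `μ² (r + μ s')` with `s' = s + 2 a₁ r`. So `μ =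
-r / s'` puts a singular point in each direction with `s' ≠ 0`, and it tends to `P_x` as the
direction tends to a zero `v` of `r` with `s(v) ≠ 0`. -/
theorem not_isIsolatedSing : ¬ IsIsolatedSing (germAtPx Q.poly) := by
  intro hiso
  obtain ⟨v, hv, hsv⟩ := Q.exists_zero_r
  obtain ⟨u, hu⟩ : ∃ u : Fin 2 → ℂ, aeval u Q.r ≠ 0 := by
    by_contra! h
    exact Q.r_ne_zero (MvPolynomial.funext fun u => by simpa using h u)
  -- the line through `v` and `u`
  let y : ℂ → ℂ := fun τ => v 0 + τ * (u 0 - v 0)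
  let z : ℂ → ℂ := fun τ => v 1 + τ * (u 1 - v 1)
  let s' : PolyYZ := Q.s + 2 * Q.a₁ * Q.r
  have hy : Continuous y := by fun_prop
  have hz : Continuous z := by fun_prop
  have hcont : ∀ p : PolyYZ, Continuous fun τ => aeval ![y τ, z τ] p := by
    intro p
    have h1 : Continuous fun τ => ![y τ, z τ] := by
      rw [continuous_pi_iff]
      intro i; fin_cases i
      exacts [hy, hz]
    exact (p.continuous_eval).comp h1
  have hv0 : ![y 0, z 0] = v := by ext i; fin_cases i <;> simp [y, z]
  have hu0 : ![y 1, z 1] = u := by ext i; fin_cases i <;> simp [y, z]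
  have hv' : eval v Q.r = 0 := hv
  have hs'0 : aeval ![y 0, z 0] s' ≠ 0 := by simpa [hv0, s', hv'] using hsv
  have hr0 : aeval ![y 0, z 0] Q.r = 0 := by rw [hv0, hv]
  -- Along the line from `v` to `u` the form `r` is a polynomial in `τ`, nonzero at `τ = 1`, so its
  -- zeros are isolated. This keeps the singular points away from `P_x` itself.
  have hrne : ∀ᶠ τ in 𝓝[≠] (0 : ℂ), aeval ![y τ, z τ] Q.r ≠ 0 := by
    obtain ⟨ρ, hρ⟩ : ∃ ρ : Polynomial ℂ, ∀ τ, ρ.eval τ = aeval ![y τ, z τ] Q.r := by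
      refine ⟨aeval ![Polynomial.C (v 0) + Polynomial.X * Polynomial.C (u 0 - v 0),
        Polynomial.C (v 1) + Polynomial.X * Polynomial.C (u 1 - v 1)] Q.r, fun τ => ?_⟩
      have := map_aeval_pair (Polynomial.aeval τ) Q.r
        (Polynomial.C (v 0) + Polynomial.X * Polynomial.C (u 0 - v 0))
        (Polynomial.C (v 1) + Polynomial.X * Polynomial.C (u 1 - v 1))
      simpa [Polynomial.coe_aeval_eq_eval, y, z] using this
    have hρ0 : ρ ≠ 0 := by
      rintro rfl
      have := hρ 1
      rw [hu0] at this
      exact hu (by simpa using this.symm)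
    have hfin : (ρ.roots.toFinset : Set ℂ).Finite := Finset.finite_toSet _
    have h1 : ∀ᶠ τ in 𝓝[≠] (0 : ℂ), τ ∉ ((ρ.roots.toFinset : Set ℂ) \ {0}) := by
      have h2 := (hfin.subset (Set.sdiff_subset (t := {(0 : ℂ)}))).isClosed.isOpen_compl.mem_nhds
        (x := (0 : ℂ)) (by simp)
      exact (Filter.eventually_of_mem h2 fun τ hτ => hτ).filter_mono nhdsWithin_le_nhds
    filter_upwards [h1, self_mem_nhdsWithin] with τ h2 h3 h4
    apply h2
    refine ⟨?_, h3⟩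
    simp [hρ0, Polynomial.IsRoot, hρ, h4]
  let μ : ℂ → ℂ := fun τ => -aeval ![y τ, z τ] Q.r / aeval ![y τ, z τ] s'
  have hμ : ContinuousAt μ 0 :=
    ContinuousAt.div₀ (hcont _).continuousAt.neg (hcont _).continuousAt hs'0
  have hμ0 : μ 0 = 0 := by simp only [μ, hr0]; simp
  have hs'ne : ∀ᶠ τ in 𝓝[≠] (0 : ℂ), aeval ![y τ, z τ] s' ≠ 0 :=
    ((hcont s').continuousAt.eventually_ne hs'0).filter_mono nhdsWithin_le_nhds
  let p : ℂ → (Fin 4 → ℂ) := fun τ => ![μ τ * y τ, μ τ * z τ, 0, 0]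
  have hp : ContinuousAt p 0 := by
    rw [continuousAt_pi]
    intro i; fin_cases i
    exacts [hμ.mul hy.continuousAt, hμ.mul hz.continuousAt, continuousAt_const, continuousAt_const]
  have hp0 : p 0 = 0 := by ext i; fin_cases i <;> simp [p, hμ0]
  have hpne : ∀ᶠ τ in 𝓝[≠] (0 : ℂ), p τ ∈ ({0}ᶜ : Set (Fin 4 → ℂ)) := by
    filter_upwards [hrne, hs'ne] with τ h1 h2 h3
    have e0 : μ τ * y τ = 0 := congrFun h3 0
    have e1 : μ τ * z τ = 0 := congrFun h3 1
    have hμτ : μ τ ≠ 0 := div_ne_zero (neg_ne_zero.2 h1) h2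
    have hyτ : y τ = 0 := (mul_eq_zero_iff_left hμτ).1 e0
    have hzτ : z τ = 0 := (mul_eq_zero_iff_left hμτ).1 e1
    have := aeval_pair_mul_of_isHomogeneous Q.hom_r (0 : ℂ) 0 0
    rw [hyτ, hzτ] at h1
    simp at this
    exact h1 this
  have htend : Filter.Tendsto p (𝓝[≠] 0) (𝓝[≠] 0) := by
    refine tendsto_nhdsWithin_of_tendsto_nhds_of_eventually_within _ ?_ hpne
    have := hp.tendsto
    rw [hp0] at this
    exact this.mono_left nhdsWithin_le_nhds
  have hfalse : ∀ᶠ τ in 𝓝[≠] (0 : ℂ), False := by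
    filter_upwards [htend.eventually hiso, hs'ne] with τ h1 h2
    have hSz : Q.S 1 (p τ 0) (p τ 1) (p τ 2) = 0 := by
      change Q.S 1 (μ τ * y τ) (μ τ * z τ) 0 = 0
      simp only [S, S₀, aeval_pair_mul_of_isHomogeneous Q.hom_r,
        aeval_pair_mul_of_isHomogeneous Q.hom_s, aeval_pair_mul_of_isHomogeneous Q.hom_a₁]
      have e : μ τ * aeval ![y τ, z τ] s' = -aeval ![y τ, z τ] Q.r := div_mul_cancel₀ _ h2
      simp only [s', map_add, map_mul, map_ofNat] at e
      linear_combination μ τ ^ 2 * e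
    refine h1 ?_ (Q.fderiv_germAtPx_eq_zero rfl rfl hSz)
    rw [germAtPx_poly, hSz]
    simp [p]
  exact hfalse.exists.elim fun _ h => h
end SplitSextic



/-! ## Discrete valuation rings at principal primes -/

section PrincipalPrime

variable {R K : Type*} [CommRing R] [Field K] [Algebra R K]

/-- `V` is the localization of `R` at the prime ideal `p`. -/
def IsLocalRingAt (p : Ideal R) (V : ValuationSubring K) : Prop :=
  ∀ g : K, g ∈ V ↔ ∃ a s : R, s ∉ p ∧ g = algebraMap R K a * (algebraMap R K s)⁻¹

/-- The hypothesis says that `π` generates `p` after localization. A noetherian local domain that is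
not a field and has principal maximal ideal is a discrete valuation ring. It serves both for
divisors on `Spec A` and for the exceptional divisor. -/
theorem exists_isLocalRingAt [IsDomain R] [IsFractionRing R K] [IsNoetherianRing R] {p : Ideal R} [hp : p.IsPrime] {π : R}
    (hπ : π ∈ p) (hπ0 : π ≠ 0) (h : ∀ c ∈ p, ∃ u ∉ p, π ∣ u * c) :
    p.height = 1 ∧ ∃ V : ValuationSubring K, IsDiscreteValuationRing V ∧ IsLocalRingAt p V := by
  have hle : p.primeCompl ≤ nonZeroDivisors R := p.primeCompl_le_nonZeroDivisors
  let O : Subalgebra R K := Localization.subalgebra.ofField K p.primeCompl hle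
  have hloc : IsLocalization.AtPrime O p :=
    Localization.subalgebra.isLocalization_ofField K p.primeCompl hle
  have : IsLocalRing O := IsLocalization.AtPrime.isLocalRing O p
  have : IsNoetherianRing O := IsLocalization.isNoetherianRing p.primeCompl O inferInstance
  have hmax : IsLocalRing.maximalIdeal O = Ideal.span {algebraMap R O π} := by
    rw [← IsLocalization.AtPrime.map_eq_maximalIdeal p O]
    apply le_antisymm
    · rw [Ideal.map_le_iff_le_comap]
      intro c hc
      obtain ⟨u, hu, hd⟩ := h c hc
      have hu' : IsUnit (algebraMap R O u) := IsLocalization.map_units O (⟨u, hu⟩ : p.primeCompl)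
      rw [Ideal.mem_comap, Ideal.mem_span_singleton, ← hu'.dvd_mul_left, ← map_mul]
      exact map_dvd _ hd
    · rw [Ideal.span_singleton_le_iff_mem]
      exact Ideal.mem_map_of_mem _ hπ
  have hinj : Function.Injective (algebraMap R O) := IsLocalization.injective O hle
  have hnf : ¬ IsField O := by
    rw [IsLocalRing.isField_iff_maximalIdeal_eq, hmax, Ideal.span_singleton_eq_bot]
    simpa using hπ0
  have hprin : (IsLocalRing.maximalIdeal O).IsPrincipal := ⟨_, hmax⟩
  have hdvr : IsDiscreteValuationRing O :=
    ((IsDiscreteValuationRing.TFAE O hnf).out 4 0).1 hprin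
  refine ⟨?_, ?_⟩
  · have h1 := IsLocalization.AtPrime.ringKrullDim_eq_height p O
    rw [IsDiscreteValuationRing.ringKrullDim_eq_one] at h1
    exact_mod_cast h1.symm
  · refine ⟨⟨O.toSubring, fun x => ?_⟩, hdvr, fun g => ?_⟩
    · obtain ⟨a, ha⟩ | ⟨a, ha⟩ := ValuationRing.isInteger_or_isInteger O x
      · exact Or.inl (ha ▸ a.2)
      · exact Or.inr (ha ▸ a.2)
    · exact ⟨fun ⟨a, s, hs, e⟩ => ⟨a, s, hs, e⟩, fun ⟨a, s, hs, e⟩ => ⟨a, s, hs, e⟩⟩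

namespace IsLocalRingAt

variable {p : Ideal R} {V : ValuationSubring K} (hV : IsLocalRingAt p V)
include hV

lemma algebraMap_mem [hp : p.IsPrime] (a : R) : algebraMap R K a ∈ V :=
  (hV _).2 ⟨a, 1, hp.one_notMem, by simp⟩

lemma valuation_eq_one [p.IsPrime] [IsFractionRing R K] {s : R} (hs : s ∉ p) : V.valuation (algebraMap R K s) = 1 := by
  have hs0 : algebraMap R K s ≠ 0 := by
    rw [Ne, IsFractionRing.to_map_eq_zero_iff]
    rintro rfl
    exact hs p.zero_mem
  apply le_antisymm ((V.valuation_le_one_iff _).2 (hV.algebraMap_mem s))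
  rw [← inv_le_one₀ (by simpa [zero_lt_iff] using hs0), ← map_inv₀, V.valuation_le_one_iff]
  exact (hV _).2 ⟨1, s, hs, by simp⟩

lemma valuation_lt_one [IsFractionRing R K] {c : R} (hc : c ∈ p) : V.valuation (algebraMap R K c) < 1 := by
  rcases eq_or_ne c 0 with rfl | hc0
  · simp
  have hc0' : algebraMap R K c ≠ 0 := by simpa using hc0
  rw [← not_le, ← inv_le_one₀ (by simpa [zero_lt_iff] using hc0'), ← map_inv₀,
    V.valuation_le_one_iff, hV]
  rintro ⟨a, s, hs, e⟩
  apply hs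
  have hs0 : algebraMap R K s ≠ 0 := by
    rw [Ne, IsFractionRing.to_map_eq_zero_iff]
    rintro rfl
    exact hs p.zero_mem
  have : s = a * c := by
    apply IsFractionRing.injective R K
    rw [map_mul]
    field_simp at e
    rw [e]; ring
  rw [this]
  exact p.mul_mem_left _ hc

end IsLocalRingAt

end PrincipalPrime



/-! ## Generators of the regular three-forms -/

section FormGenerator

variable {K : Type} [Field K] (V : ValuationSubring K)

/-- Multilinear expansion with coefficients in `V`: tuples with a repetition contribute zero, and
permutations contribute plus or minus `f v`. -/
lemma AlternatingMap.apply_mem_span_singleton {M N : Type*} [AddCommGroup M] [Module K M]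
    [AddCommGroup N] [Module K N] {k : ℕ} (f : M [⋀^Fin k]→ₗ[K] N) {u v : Fin k → M}
    (h : ∀ i, u i ∈ Submodule.span V (Set.range v)) : f u ∈ Submodule.span V {f v} := by
  choose c hc using fun i => (Submodule.mem_span_range_iff_exists_fun V).1 (h i)
  have hu : u = fun i => ∑ j, (c i j : K) • v j := funext fun i => (hc i).symm
  rw [hu, ← AlternatingMap.coe_multilinearMap, MultilinearMap.map_sum]
  refine Submodule.sum_mem _ fun r _ => ?_
  rw [MultilinearMap.map_smul_univ, AlternatingMap.coe_multilinearMap]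
  have hprod : ∏ i, (c i (r i) : K) = ((∏ i, c i (r i) : V) : K) := by push_cast; rfl
  rw [hprod]
  refine Submodule.smul_mem _ (∏ i, c i (r i) : V) ?_
  by_cases hr : Function.Injective r
  · have hb : Function.Bijective r := Finite.injective_iff_bijective.1 hr
    have := f.map_perm v (Equiv.ofBijective r hb)
    have h2 : f (fun i => v (r i)) = f (v ∘ Equiv.ofBijective r hb) := rfl
    rw [h2, this]
    obtain hs | hs := Int.units_eq_one_or (Equiv.Perm.sign (Equiv.ofBijective r hb))
    · rw [hs, one_smul]; exact Submodule.mem_span_singleton_self _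
    · rw [hs, Units.neg_smul, one_smul]
      exact Submodule.neg_mem _ (Submodule.mem_span_singleton_self _)
  · obtain ⟨i, j, hij, hne⟩ := Function.not_injective_iff.1 hr
    rw [f.map_eq_zero_of_eq (fun i => v (r i)) (by simp only [hij]) hne]
    exact Submodule.zero_mem _

variable [Algebra ℂ K] {V}

/-- Reduces the search for a generator to three elements of `V` whose differentials span those of
all of `V`. -/
theorem isFormGenerator_wedgeD {e : Fin 3 → K} (he : ∀ i, e i ∈ V)
    (h : ∀ g ∈ V, KaehlerDifferential.D ℂ K g ∈
      Submodule.span V (Set.range fun i => KaehlerDifferential.D ℂ K (e i))) :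
    IsFormGenerator V (wedgeD e) := by
  apply le_antisymm
  · rw [Submodule.span_le]
    rintro θ ⟨g, hg, rfl⟩
    exact AlternatingMap.apply_mem_span_singleton V _ fun i => h _ (hg i)
  · rw [Submodule.span_singleton_le_iff_mem]
    exact Submodule.subset_span ⟨e, he, rfl⟩

lemma IsFormGenerator.smul {η : RatThreeForm K} (h : IsFormGenerator V η) {u : K}
    (hu : V.valuation u = 1) : IsFormGenerator V (u • η) := by
  have hu0 : u ≠ 0 := by rintro rfl; simp at hu
  have h1 : u ∈ V := (V.valuation_le_one_iff u).1 hu.le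
  have h2 : u⁻¹ ∈ V := by rw [← V.valuation_le_one_iff, map_inv₀, hu, inv_one]
  unfold IsFormGenerator at h ⊢
  rw [h]
  apply le_antisymm <;> rw [Submodule.span_singleton_le_iff_mem, Submodule.mem_span_singleton]
  · exact ⟨⟨u⁻¹, h2⟩, by change u⁻¹ • u • η = η; rw [smul_smul, inv_mul_cancel₀ hu0, one_smul]⟩
  · exact ⟨⟨u, h1⟩, rfl⟩

/-- The elements of `V` whose differential lies in a given `V`-lattice. -/
def ValuationSubring.withDifferentialIn (hC : ∀ c : ℂ, algebraMap ℂ K c ∈ V)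
    (N : Submodule V (Ω[K⁄ℂ])) : Subalgebra ℂ K where
  carrier := {g | g ∈ V ∧ KaehlerDifferential.D ℂ K g ∈ N}
  mul_mem' {a b} ha hb := by
    refine ⟨V.mul_mem _ _ ha.1 hb.1, ?_⟩
    rw [Derivation.leibniz]
    exact N.add_mem (N.smul_mem ⟨a, ha.1⟩ hb.2) (N.smul_mem ⟨b, hb.1⟩ ha.2)
  add_mem' {a b} ha hb := ⟨V.add_mem _ _ ha.1 hb.1, by rw [map_add]; exact N.add_mem ha.2 hb.2⟩
  algebraMap_mem' c := ⟨hC c, by rw [Derivation.map_algebraMap]; exact N.zero_mem⟩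

lemma ValuationSubring.inv_mem_withDifferentialIn {hC : ∀ c : ℂ, algebraMap ℂ K c ∈ V}
    {N : Submodule V (Ω[K⁄ℂ])} {g : K} (hg : g ∈ V.withDifferentialIn hC N) (hg' : g⁻¹ ∈ V) :
    g⁻¹ ∈ V.withDifferentialIn hC N := by
  refine ⟨hg', ?_⟩
  rw [Derivation.leibniz_inv, neg_smul]
  have := N.smul_mem ⟨g⁻¹ ^ 2, pow_mem hg' 2⟩ hg.2
  exact N.neg_mem this

lemma Derivation.map_aeval_mvPolynomial {σ R M : Type*} [Fintype σ] [CommRing R] [Algebra ℂ R]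
    [AddCommGroup M] [Module R M] [Module ℂ M] [IsScalarTower ℂ R M] (d : Derivation ℂ R M)
    (x : σ → R) (p : MvPolynomial σ ℂ) :
    d (aeval x p) = ∑ i, aeval x (pderiv i p) • d (x i) := by
  classical
  induction p using MvPolynomial.induction_on with
  | C a => simp
  | add p q hp hq => simp [hp, hq, add_smul, Finset.sum_add_distrib]
  | mul_X p j hp =>
    simp only [map_mul, aeval_X, Derivation.leibniz, hp, pderiv_X, map_add, add_smul,
      Finset.sum_add_distrib, smul_eq_mul, Pi.single_apply, mul_ite, mul_one, mul_zero]
    congr 1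
    · simp [apply_ite, ite_smul]
    · simp [Finset.smul_sum, smul_smul]

end FormGenerator



/-! ## Algebraic Hartogs lemma -/

section Hartogs

variable {A K : Type*} [CommRing A] [IsDomain A] [IsNoetherianRing A] [IsIntegrallyClosed A]
  [Field K] [Algebra A K] [IsFractionRing A K]

/-- The ideal of denominators of a fraction. -/
def denominators (A : Type*) {K : Type*} [CommRing A] [Field K] [Algebra A K] (ψ : K) :
    Ideal A where
  carrier := {a | ∃ b : A, algebraMap A K a * ψ = algebraMap A K b}
  add_mem' := by
    rintro a a' ⟨b, h⟩ ⟨b', h'⟩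
    exact ⟨b + b', by rw [map_add, map_add, add_mul, h, h']⟩
  zero_mem' := ⟨0, by simp⟩
  smul_mem' := by
    rintro c a ⟨b, h⟩
    exact ⟨c * b, by rw [smul_eq_mul, map_mul, map_mul, mul_assoc, h]⟩

omit [IsDomain A] [IsIntegrallyClosed A] [IsFractionRing A K] in
/-- A maximal ideal of denominators of multiples of `φ` inside a prime ideal is prime. -/
lemma exists_isPrime_denominators {φ : K} {P : Ideal A} [P.IsPrime] (h : denominators A φ ≤ P) :
    ∃ c : A, denominators A (algebraMap A K c * φ) ≤ P ∧
      (denominators A (algebraMap A K c * φ)).IsPrime := by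
  obtain ⟨p, ⟨hpP, c, rfl⟩, hmax⟩ := set_has_maximal_iff_noetherian.2
    (inferInstance : IsNoetherian A A)
    {p | p ≤ P ∧ ∃ c : A, p = denominators A (algebraMap A K c * φ)}
    ⟨denominators A φ, h, 1, by simp⟩
  set ψ := algebraMap A K c * φ with hψ
  have key : ∀ a : A, denominators A (algebraMap A K a * ψ) ≤ P →
      denominators A (algebraMap A K a * ψ) ≤ denominators A ψ := by
    intro a ha
    have hle : denominators A ψ ≤ denominators A (algebraMap A K a * ψ) := by
      rintro x ⟨b, hb⟩
      exact ⟨a * b, by rw [map_mul, ← hb]; ring⟩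
    by_contra hn
    refine hmax _ ⟨ha, a * c, by rw [hψ, map_mul, mul_assoc]⟩ (lt_of_le_not_ge hle hn)
  refine ⟨c, hpP, ⟨fun ht => ‹P.IsPrime›.ne_top (top_le_iff.1 (ht ▸ hpP)), ?_⟩⟩
  -- If the denominators of `a ψ` stay inside `P`, maximality gives `b`. If not, some `s ∉ P` is a
  -- denominator of `a ψ`; since `s` is a unit at `P`, the denominators of `s ψ` also lie in `P`,
  -- and `a` is one of them, so maximality gives `a`.
  rintro a b ⟨d, hd⟩
  by_cases ha : denominators A (algebraMap A K a * ψ) ≤ P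
  · exact Or.inr (key a ha ⟨d, by rw [← hd, map_mul]; ring⟩)
  · obtain ⟨s, ⟨e, he⟩, hs⟩ := SetLike.not_le_iff_exists.1 ha
    refine Or.inl (key s ?_ ⟨e, by rw [← he]; ring⟩)
    rintro u ⟨v, hv⟩
    have : u * s ∈ P := hpP ⟨v, by rw [← hv, map_mul]; ring⟩
    exact (‹P.IsPrime›.mem_or_mem this).resolve_right hs

/-- A fraction over a noetherian normal domain that is not regular at a prime ideal `P` has a pole
along a prime ideal `p ≤ P` which is principal up to localization. -/
theorem exists_principal_prime_of_not_regular {φ : K} {P : Ideal A} [P.IsPrime]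
    (h : ∀ a s : A, s ∉ P → φ ≠ algebraMap A K a * (algebraMap A K s)⁻¹) :
    ∃ p : Ideal A, p.IsPrime ∧ p ≤ P ∧ (∃ π ∈ p, π ≠ 0 ∧ ∀ c ∈ p, ∃ u ∉ p, π ∣ u * c) ∧
      ∀ a s : A, s ∉ p → φ ≠ algebraMap A K a * (algebraMap A K s)⁻¹ := by
  have hden : denominators A φ ≤ P := by
    rintro s ⟨a, ha⟩
    by_contra hs
    have hs0 : algebraMap A K s ≠ 0 := by
      rw [Ne, IsFractionRing.to_map_eq_zero_iff]
      rintro rfl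
      exact hs P.zero_mem
    exact h a s hs (by rw [← ha]; field_simp)
  obtain ⟨c, hcP, hprime⟩ := exists_isPrime_denominators hden
  set ψ := algebraMap A K c * φ with hψ
  refine ⟨denominators A ψ, hprime, hcP, ?_, ?_⟩
  -- Write `p` for the ideal of denominators. If `p ψ ⊆ p`, then `ψ` is integral, hence in `A`, and
  -- 1 is a denominator. So `π ψ = u ∉ p` for some `π ∈ p`; for `c ∈ p` with `c ψ = v` this yields
  -- `u c = π v`.
  · have hex : ∃ π ∈ denominators A ψ, ∃ u ∉ denominators A ψ,
        algebraMap A K π * ψ = algebraMap A K u := by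
      by_contra! hcon
      have hint : IsIntegral A ψ := by
        refine isIntegral_of_smul_mem_submodule
          (N := Submodule.map (Algebra.linearMap A K) (denominators A ψ)) ?_ ?_ ψ ?_
        · obtain ⟨a, s, hs, e⟩ := IsFractionRing.div_surjective A ψ
          intro hbot
          have hs0 : s ≠ 0 := nonZeroDivisors.ne_zero hs
          have hs0' : algebraMap A K s ≠ 0 := by simpa using hs0
          have : algebraMap A K s ∈ Submodule.map (Algebra.linearMap A K) (denominators A ψ) :=
            Submodule.mem_map_of_mem (f := Algebra.linearMap A K)
              ⟨a, by rw [← e]; field_simp⟩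
          rw [hbot, Submodule.mem_bot] at this
          exact hs0' this
        · exact Submodule.FG.map _ (IsNoetherian.noetherian _)
        · rintro _ ⟨π, hπ, rfl⟩
          obtain ⟨u, hu⟩ := id hπ
          have hu' : u ∈ denominators A ψ := by
            by_contra hu'
            exact hcon π hπ u hu' hu
          refine ⟨u, hu', ?_⟩
          rw [Algebra.linearMap_apply, Algebra.linearMap_apply, ← hu, smul_eq_mul, mul_comm]
      obtain ⟨a, ha⟩ := IsIntegrallyClosed.isIntegral_iff.1 hint
      exact hprime.one_notMem ⟨a, by simp [ha]⟩
    obtain ⟨π, hπ, u, hu, e⟩ := hex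
    refine ⟨π, hπ, ?_, fun a ⟨v, hv⟩ => ⟨u, hu, v, ?_⟩⟩
    · rintro rfl
      apply hu
      have : algebraMap A K u = 0 := by rw [← e]; simp
      rw [IsFractionRing.to_map_eq_zero_iff] at this
      rw [this]
      exact zero_mem _
    · apply IsFractionRing.injective A K
      rw [map_mul, map_mul, ← e, ← hv]
      ring
  · rintro a s hs e
    apply hs
    have hs0 : algebraMap A K s ≠ 0 := by
      rw [Ne, IsFractionRing.to_map_eq_zero_iff]
      rintro rfl
      exact hs (zero_mem _)
    refine ⟨c * a, ?_⟩
    rw [hψ, e, map_mul]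
    field_simp

end Hartogs

/-! ## Degrees of partial derivatives -/

namespace MvPolynomial

variable {σ : Type*}

/-- A nonconstant polynomial does not divide one of its partial derivatives. -/
lemma exists_not_dvd_pderiv {i : σ} {p : MvPolynomial σ ℂ} (hi : p.degreeOf i ≠ 0) :
    ¬ p ∣ pderiv i p := by
  classical
  have hsup := degreeOf_eq_sup i p
  have hne : p.support.Nonempty := by
    rw [Finset.nonempty_iff_ne_empty]
    intro h
    rw [h] at hsup
    exact hi (by simpa using hsup)
  obtain ⟨s, hs, hs'⟩ := Finset.exists_mem_eq_sup p.support hne (fun m => m i)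
  rw [← hsup] at hs'
  have hle : Finsupp.single i 1 ≤ s := Finsupp.single_le_iff.2 (by omega)
  have h0 : pderiv i p ≠ 0 := by
    intro h0
    have h1 := coeff_pderiv (i := i) p (s - Finsupp.single i 1)
    rw [h0, coeff_zero, tsub_add_cancel_of_le hle, eq_comm, mul_eq_zero] at h1
    rcases h1 with h1 | h1
    · exact (mem_support_iff.1 hs) h1
    · exact absurd h1 (by norm_cast)
  rintro ⟨q, hq⟩
  have hq0 : q ≠ 0 := by rintro rfl; simp [h0] at hq
  have hp0 : p ≠ 0 := by rintro rfl; simp at h0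
  -- In characteristic zero the derivative is nonzero, and it has strictly smaller degree in the
  -- variable `i`.
  have h2 : (pderiv i p).degreeOf i < p.degreeOf i := by
    rw [degreeOf_lt_iff (by omega)]
    intro m hm
    rw [mem_support_iff, coeff_pderiv] at hm
    have := monomial_le_degreeOf i (mem_support_iff.2 (left_ne_zero_of_mul hm))
    simp at this
    omega
  rw [hq, degreeOf_mul_eq hp0 hq0] at h2
  omega

lemma exists_degreeOf_ne_zero {π : MvPolynomial (σ) ℂ} (hπ : Prime π) :
    ∃ i, π.degreeOf i ≠ 0 := by
  by_contra! hcon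
  have h1 : π = C (coeff 0 π) := by
    rw [← totalDegree_eq_zero_iff_eq_C]
    rw [totalDegree_eq_zero_iff]
    intro m hm i
    have := monomial_le_degreeOf i hm
    rw [hcon] at this
    omega
  apply hπ.not_isUnit
  rw [h1]
  refine (IsUnit.mk0 _ ?_).map C
  intro h0
  rw [h0, C_0] at h1
  exact hπ.ne_zero h1

end MvPolynomial



/-! ## Double covers of affine space -/

section DoubleCover

variable {A : Type} [CommRing A] [Algebra ℂ A]

/-- `A = ℂ[x, y, t][w] / (w² - h)`. -/
structure IsDoubleCover (j : MvPolynomial (Fin 3) ℂ →ₐ[ℂ] A) (h : MvPolynomial (Fin 3) ℂ)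
    (w : A) : Prop where
  sq : w ^ 2 = j h
  exists_eq (a : A) : ∃ b c, a = j b + j c * w
  eq_zero {b c : MvPolynomial (Fin 3) ℂ} : j b + j c * w = 0 → b = 0 ∧ c = 0

namespace IsDoubleCover

variable {j : MvPolynomial (Fin 3) ℂ →ₐ[ℂ] A} {h : MvPolynomial (Fin 3) ℂ} {w : A}
  (H : IsDoubleCover j h w)
include H

lemma injective : Function.Injective j := by
  rw [injective_iff_map_eq_zero]
  intro b hb
  exact (H.eq_zero (b := b) (c := 0) (by simp [hb])).1

lemma isIntegral : j.toRingHom.IsIntegral := by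
  intro a
  obtain ⟨b, c, rfl⟩ := H.exists_eq a
  have hw : j.toRingHom.IsIntegralElem w := by
    refine ⟨Polynomial.X ^ 2 - Polynomial.C h, Polynomial.monic_X_pow_sub_C h two_ne_zero, ?_⟩
    simp [H.sq]
  have h1 : ∀ b, j.toRingHom.IsIntegralElem (j b) := fun b => j.toRingHom.isIntegralElem_map
  exact RingHom.IsIntegralElem.add _ (h1 b) (RingHom.IsIntegralElem.mul _ (h1 c) hw)

variable [IsDomain A]

/-- Going-down for the integral extension `j` of the normal ring `ℂ[x, y, t]`. -/
lemma exists_lt_of_lt_comap {p : Ideal A} [p.IsPrime] {q : Ideal (MvPolynomial (Fin 3) ℂ)}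
    [q.IsPrime] (hq : q < p.comap j) : ∃ p' < p, p'.IsPrime ∧ p'.comap j = q := by
  let := j.toRingHom.toAlgebra
  have : Algebra.IsIntegral (MvPolynomial (Fin 3) ℂ) A := ⟨H.isIntegral⟩
  have : FaithfulSMul (MvPolynomial (Fin 3) ℂ) A :=
    (faithfulSMul_iff_algebraMap_injective _ _).2 H.injective
  have : p.LiesOver (p.comap j) := ⟨rfl⟩
  obtain ⟨p', hlt, hp', ho⟩ := Ideal.exists_ideal_lt_liesOver_of_lt (p := q) p hq
  exact ⟨p', hlt, hp', ho.over.symm⟩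

/-- A prime ideal of height one lies over a principal prime ideal. -/
lemma exists_prime_comap_eq_span {p : Ideal A} [hp : p.IsPrime] (hp1 : p.height = 1) :
    ∃ π, Prime π ∧ p.comap j = Ideal.span {π} := by
  let := j.toRingHom.toAlgebra
  have : Algebra.IsIntegral (MvPolynomial (Fin 3) ℂ) A := ⟨H.isIntegral⟩
  have hq : (p.comap j).IsPrime := inferInstance
  have hne : p.comap j ≠ ⊥ := by
    intro hb
    have : p = ⊥ := Ideal.eq_bot_of_comap_eq_bot (R := MvPolynomial (Fin 3) ℂ) hb
    rw [this, Ideal.height_bot] at hp1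
    exact zero_ne_one hp1
  obtain ⟨π, hπ, hπp⟩ := hq.exists_mem_prime_of_ne_bot hne
  refine ⟨π, hπp, ?_⟩
  by_contra hcon
  have hs : (Ideal.span {π}).IsPrime := (Ideal.span_singleton_prime hπp.ne_zero).2 hπp
  have hlt : Ideal.span {π} < p.comap j :=
    lt_of_le_of_ne ((Ideal.span_singleton_le_iff_mem _).2 hπ) (Ne.symm hcon)
  obtain ⟨p', hlt', hp', he⟩ := H.exists_lt_of_lt_comap hlt
  have h0 : p'.height < 1 := by
    rw [← hp1]
    have : p'.FiniteHeight := ⟨Or.inr fun ht => ?_⟩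
    · exact Ideal.height_strict_mono_of_isPrime hlt'
    · have := Ideal.height_mono hlt'.le
      rw [ht, hp1, top_le_iff] at this
      exact ENat.one_ne_top this
  rw [Order.lt_one_iff, Ideal.height_eq_zero_iff_eq_bot] at h0
  have : π ∈ p'.comap j := he ▸ Ideal.mem_span_singleton_self π
  rw [h0, Ideal.mem_comap, Ideal.mem_bot, map_eq_zero_iff j H.injective] at this
  exact hπp.ne_zero this

/-- A normal double cover is smooth in codimension one. -/
lemma notMem_or_pderiv_notMem [IsIntegrallyClosed A] {p : Ideal A} [hp : p.IsPrime]
    (hp1 : p.height = 1) : w ∉ p ∨ ∃ i, j (pderiv i h) ∉ p := by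
  by_contra! hcon
  obtain ⟨hw, hd⟩ := hcon
  obtain ⟨π, hπ, he⟩ := H.exists_prime_comap_eq_span hp1
  -- If the claim fails, `π` divides `h` and all its partial derivatives, hence `π² ∣ h = w²`.
  -- Normality gives `π ∣ w` in `A`, impossible because `1, w` is a basis over the polynomial ring.
  have hdvd : ∀ b, j b ∈ p → π ∣ b := fun b hb => by
    rw [← Ideal.mem_span_singleton, ← he]; exact hb
  obtain ⟨k, hk⟩ := hdvd h (by rw [← H.sq]; exact Ideal.pow_mem_of_mem _ hw 2 two_pos)
  obtain ⟨i, hi⟩ := exists_degreeOf_ne_zero hπ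
  have h1 := hdvd _ (hd i)
  rw [hk, Derivation.leibniz, smul_eq_mul, smul_eq_mul, dvd_add_right (dvd_mul_right _ _)] at h1
  obtain ⟨k', hk'⟩ := (hπ.dvd_or_dvd h1).resolve_right (exists_not_dvd_pderiv hi)
  have h2 : j π ^ 2 ∣ w ^ 2 := ⟨j k', by rw [H.sq, hk, hk', map_mul, map_mul]; ring⟩
  rw [IsIntegrallyClosed.pow_dvd_pow_iff two_ne_zero] at h2
  obtain ⟨a, ha⟩ := h2
  obtain ⟨b, c, rfl⟩ := H.exists_eq a
  have h3 := (H.eq_zero (b := π * b) (c := π * c - 1) (by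
    rw [map_sub, map_mul, map_mul, map_one]
    linear_combination -ha)).2
  exact hπ.not_isUnit (IsUnit.of_mul_eq_one c (sub_eq_zero.1 h3))

end IsDoubleCover

end DoubleCover



/-! ## Regular forms and divisors in codimension one on a double cover -/

lemma Subalgebra.aeval_mem_of_forall_mem {σ R : Type*} [CommRing R] [Algebra ℂ R]
    (T : Subalgebra ℂ R) {x : σ → R} (hx : ∀ i, x i ∈ T) (p : MvPolynomial σ ℂ) :
    aeval x p ∈ T := by
  have := T.mvPolynomial_aeval_coe (fun i => (⟨x i, hx i⟩ : T)) p
  exact this ▸ Subtype.prop _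

/-- Cramer's rule, used to exchange one coordinate differential for another in a three-form. -/
lemma AlternatingMap.smul_map_update_of_smul_eq_sum {R M N ι : Type*} [CommRing R]
    [AddCommGroup M] [Module R M] [AddCommGroup N] [Module R N] [Fintype ι] [DecidableEq ι]
    (f : M [⋀^ι]→ₗ[R] N) (v : ι → M) {u : M} {a : R} {c : ι → R} (h : a • u = ∑ k, c k • v k)
    (i : ι) : a • f (Function.update v i u) = c i • f v := by
  rw [← f.map_update_smul, h, f.map_update_sum, Finset.sum_eq_single i]
  · rw [f.map_update_smul, Function.update_eq_self]
  · intro k _ hk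
    rw [f.map_update_smul, f.map_update_self _ hk.symm, smul_zero]
  · simp

section Divisors

variable {A : Type} [CommRing A] [IsDomain A] [Algebra ℂ A]

/-- The canonical three-form `w⁻¹ dx ∧ dy ∧ dt` on a double cover. -/
def residueForm (j : MvPolynomial (Fin 3) ℂ →ₐ[ℂ] A) (w : A) : RatThreeForm (FractionRing A) :=
  (algebraMap A (FractionRing A) w)⁻¹ •
    wedgeD (fun i => algebraMap A (FractionRing A) (j (X i)))

lemma IsLocalRingAt.algebraMap_complex_mem {p : Ideal A} [p.IsPrime]
    {V : ValuationSubring (FractionRing A)} (hV : IsLocalRingAt p V) (c : ℂ) :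
    algebraMap ℂ (FractionRing A) c ∈ V := by
  rw [IsScalarTower.algebraMap_apply ℂ A (FractionRing A)]
  exact hV.algebraMap_mem _

lemma mem_center_iff {V : ValuationSubring (FractionRing A)} (hV : IsPrimeDivisorOver A V) {a : A} :
    a ∈ hV.center ↔ V.valuation (algebraMap A (FractionRing A) a) < 1 := by
  rw [IsPrimeDivisorOver.center, Ideal.mem_comap, ValuationSubring.valuation_lt_one_iff]
  rfl

lemma IsLocalRingAt.center_eq {p : Ideal A} [p.IsPrime] {V : ValuationSubring (FractionRing A)}
    (hV : IsLocalRingAt p V) (hV' : IsPrimeDivisorOver A V) : hV'.center = p := by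
  ext a
  rw [mem_center_iff]
  refine ⟨fun h => ?_, fun h => hV.valuation_lt_one h⟩
  by_contra ha
  exact h.ne (hV.valuation_eq_one ha)

namespace IsDoubleCover

variable {j : MvPolynomial (Fin 3) ℂ →ₐ[ℂ] A} {h : MvPolynomial (Fin 3) ℂ} {w : A}
  (H : IsDoubleCover j h w) {p : Ideal A} [hp : p.IsPrime] {V : ValuationSubring (FractionRing A)}
include H

omit [IsDomain A] in
lemma ne_zero [Nontrivial A] : w ≠ 0 := fun h0 =>
  one_ne_zero (H.eq_zero (b := 0) (c := 1) (by simp [h0])).2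

omit H [IsDomain A] in
lemma algebraMap_j (b : MvPolynomial (Fin 3) ℂ) : algebraMap A (FractionRing A) (j b) =
    aeval (fun i => algebraMap A (FractionRing A) (j (X i))) b := by
  have : (IsScalarTower.toAlgHom ℂ A (FractionRing A)).comp j =
      aeval (fun i => algebraMap A (FractionRing A) (j (X i))) := by
    ext i; simp
  exact DFunLike.congr_fun this b

omit [IsDomain A] in
lemma smul_D_w : (2 * algebraMap A (FractionRing A) w) •
    KaehlerDifferential.D ℂ (FractionRing A) (algebraMap A (FractionRing A) w) =
    ∑ i, algebraMap A (FractionRing A) (j (pderiv i h)) •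
      KaehlerDifferential.D ℂ (FractionRing A) (algebraMap A (FractionRing A) (j (X i))) := by
  have h1 := congrArg (algebraMap A (FractionRing A)) H.sq
  rw [map_pow, algebraMap_j] at h1
  have h2 := congrArg (KaehlerDifferential.D ℂ (FractionRing A)) h1
  rw [Derivation.map_aeval_mvPolynomial, Derivation.leibniz_pow] at h2
  simp only [algebraMap_j (pderiv _ h), ← h2]
  rw [Nat.add_one_sub_one, pow_one, mul_smul, two_smul, two_smul]

/-- Elements of `V` are fractions of polynomials in `x, y, t, w` with denominators invertible in
`V`, so the Leibniz and quotient rules leave only the four coordinate differentials to check. -/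
lemma D_mem_of_forall (hV : IsLocalRingAt p V)
    {N : Submodule V (Ω[FractionRing A⁄ℂ])}
    (hN : ∀ i, KaehlerDifferential.D ℂ (FractionRing A)
      (algebraMap A (FractionRing A) (j (X i))) ∈ N)
    (hw : KaehlerDifferential.D ℂ (FractionRing A) (algebraMap A (FractionRing A) w) ∈ N)
    {g : FractionRing A} (hg : g ∈ V) : KaehlerDifferential.D ℂ (FractionRing A) g ∈ N := by
  let T := V.withDifferentialIn hV.algebraMap_complex_mem N
  have h1 : ∀ a : A, algebraMap A (FractionRing A) a ∈ T := by
    intro a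
    obtain ⟨b, c, rfl⟩ := H.exists_eq a
    have hj : ∀ b, algebraMap A (FractionRing A) (j b) ∈ T := by
      intro b
      rw [algebraMap_j]
      exact T.aeval_mem_of_forall_mem (fun i => ⟨hV.algebraMap_mem _, hN i⟩) b
    rw [map_add, map_mul]
    exact T.add_mem (hj b) (T.mul_mem (hj c) ⟨hV.algebraMap_mem _, hw⟩)
  obtain ⟨a, s, hs, rfl⟩ := (hV g).1 hg
  refine (T.mul_mem (h1 a) (ValuationSubring.inv_mem_withDifferentialIn (h1 s) ?_)).2
  rw [← V.valuation_le_one_iff, map_inv₀, hV.valuation_eq_one hs, inv_one]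

/-- The canonical form generates the regular forms in codimension one. -/
theorem isFormGenerator_residueForm [IsIntegrallyClosed A] (hp1 : p.height = 1)
    (hV : IsLocalRingAt p V) : IsFormGenerator V (residueForm j w) := by
  set W := algebraMap A (FractionRing A) w with hW
  set x : Fin 3 → FractionRing A := fun i => algebraMap A (FractionRing A) (j (X i)) with hx
  have hW0 : W ≠ 0 := by simpa [hW] using H.ne_zero
  have hrel := H.smul_D_w
  have : CharZero (FractionRing A) :=
    charZero_of_injective_algebraMap (algebraMap ℂ (FractionRing A)).injective
  have h2 : V.valuation 2 = 1 := by
    have := hV.valuation_eq_one (s := 2) (fun h2 => hp.ne_top (Ideal.eq_top_of_isUnit_mem _ h2 ?_))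
    · rwa [map_ofNat] at this
    · have : IsUnit (algebraMap ℂ A 2) := (IsUnit.mk0 _ two_ne_zero).map _
      rwa [map_ofNat] at this
  have hinv : ∀ g : FractionRing A, V.valuation g = 1 → g⁻¹ ∈ V := fun g hg => by
    rw [← V.valuation_le_one_iff, map_inv₀, hg, inv_one]
  have hsmul : ∀ (N : Submodule V (Ω[FractionRing A⁄ℂ])) (g : FractionRing A) (_ : g ∈ V)
      (v : Ω[FractionRing A⁄ℂ]), v ∈ N → g • v ∈ N := fun N g hg v hv => N.smul_mem ⟨g, hg⟩ hv
  -- Where `w` is a unit, `x, y, t` are local coordinates. Where `∂_i h` is a unit, `2 w dw = dh`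
  -- lets `w` replace the `i`-th coordinate, and the form becomes `2 / ∂_i h` times the new wedge
  -- product.
  rcases H.notMem_or_pderiv_notMem hp1 with hw | ⟨i, hi⟩
  · have hval := hV.valuation_eq_one hw
    refine IsFormGenerator.smul (isFormGenerator_wedgeD (fun i => hV.algebraMap_mem _)
      fun g hg => H.D_mem_of_forall hV (fun i => Submodule.subset_span (Set.mem_range_self i)) ?_ hg)
      (by rw [map_inv₀, hval, inv_one])
    have h3 : KaehlerDifferential.D ℂ (FractionRing A) W =
        (2 * W)⁻¹ • ((2 * W) • KaehlerDifferential.D ℂ (FractionRing A) W) := by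
      rw [smul_smul, inv_mul_cancel₀ (mul_ne_zero two_ne_zero hW0), one_smul]
    rw [h3, hrel]
    refine hsmul _ _ (hinv _ (by rw [map_mul, h2, hval, one_mul])) _ (Submodule.sum_mem _ ?_)
    exact fun k _ => hsmul _ _ (hV.algebraMap_mem _) _ (Submodule.subset_span ⟨k, rfl⟩)
  · have hval := hV.valuation_eq_one hi
    set d := algebraMap A (FractionRing A) (j (pderiv i h)) with hd
    have hd0 : d ≠ 0 := by intro h0; rw [h0, map_zero] at hval; exact zero_ne_one hval
    let e := Function.update x i W
    have hDe : (fun k => KaehlerDifferential.D ℂ (FractionRing A) (e k)) =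
        Function.update (fun k => KaehlerDifferential.D ℂ (FractionRing A) (x k)) i
          (KaehlerDifferential.D ℂ (FractionRing A) W) :=
      Function.comp_update (KaehlerDifferential.D ℂ (FractionRing A)) x i W
    have hform : residueForm j w = (2 * d⁻¹) • wedgeD e := by
      have := AlternatingMap.smul_map_update_of_smul_eq_sum
        (exteriorPower.ιMulti (FractionRing A) 3) _ hrel i
      rw [← hDe] at this
      change (2 * W) • wedgeD e = d • wedgeD x at this
      change W⁻¹ • wedgeD x = _
      rw [← one_smul (FractionRing A) (wedgeD x), ← inv_mul_cancel₀ hd0, mul_smul, ← this,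
        smul_smul, smul_smul]
      congr 1
      field_simp
    rw [hform]
    refine IsFormGenerator.smul (isFormGenerator_wedgeD (fun k => ?_)
      fun g hg => H.D_mem_of_forall hV ?_ ?_ hg) (by rw [map_mul, map_inv₀, hval, h2]; simp)
    · by_cases hk : k = i
      · subst hk; simpa [e] using hV.algebraMap_mem w
      · simpa [e, hk] using hV.algebraMap_mem _
    · intro k
      have hne : ∀ k ≠ i, KaehlerDifferential.D ℂ (FractionRing A) (x k) ∈ Submodule.span V
          (Set.range fun k => KaehlerDifferential.D ℂ (FractionRing A) (e k)) := fun k hk =>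
        Submodule.subset_span ⟨k, by simp [e, hk]⟩
      by_cases hk : k = i
      · subst hk
        have h3 : KaehlerDifferential.D ℂ (FractionRing A) (x k) =
            d⁻¹ • (d • KaehlerDifferential.D ℂ (FractionRing A) (x k)) := by
          rw [smul_smul, inv_mul_cancel₀ hd0, one_smul]
        change KaehlerDifferential.D ℂ (FractionRing A) (x k) ∈ _
        rw [h3]
        refine hsmul _ _ (hinv _ hval) _ ?_
        rw [Fintype.sum_eq_add_sum_compl k] at hrel
        rw [← sub_eq_iff_eq_add] at hrel
        rw [← hrel]
        refine Submodule.sub_mem _ (hsmul _ _ (V.mul_mem _ _ ?_ (hV.algebraMap_mem _)) _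
          (Submodule.subset_span ⟨k, by simp [e, hW]⟩)) (Submodule.sum_mem _ fun l hl => ?_)
        · rw [← V.valuation_le_one_iff, h2]
        · exact hsmul _ _ (hV.algebraMap_mem _) _ (hne l (by simpa using hl))
      · exact hne k hk
    · exact Submodule.subset_span ⟨i, by simp [e, hW]⟩

/-- `p` lies over a principal prime `(π)`, and `π` involves some variable `i`. A nonzero polynomial
in the other two variables has degree 0 in `i`, so `π` does not divide it, and those two variables
stay independent modulo `p`. -/
theorem isPrimeDivisorOver (hp1 : p.height = 1) (hdvr : IsDiscreteValuationRing V)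
    (hV : IsLocalRingAt p V) : IsPrimeDivisorOver A V where
  mem := hV.algebraMap_mem
  dvr := hdvr
  residue := by
    obtain ⟨π, hπ, he⟩ := H.exists_prime_comap_eq_span hp1
    obtain ⟨i, hi⟩ := exists_degreeOf_ne_zero hπ
    refine ⟨fun k => algebraMap A (FractionRing A) (j (X (i.succAbove k))), fun q hq => ?_⟩
    have h1 : aeval (fun k => algebraMap A (FractionRing A) (j (X (i.succAbove k)))) q =
        algebraMap A (FractionRing A) (j (rename i.succAbove q)) := by
      rw [algebraMap_j, aeval_rename]; rfl
    rw [h1]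
    apply hV.valuation_eq_one
    intro hmem
    have h2 : rename i.succAbove q ∈ p.comap j := hmem
    rw [he, Ideal.mem_span_singleton] at h2
    obtain ⟨m, hm⟩ := h2
    have hr0 : rename i.succAbove q ≠ 0 := by
      rwa [Ne, map_eq_zero_iff _ (rename_injective _ Fin.succAbove_right_injective)]
    have h0 : (rename i.succAbove q).degreeOf i = 0 := by
      classical
      rw [degreeOf_eq_sup, ← Nat.bot_eq_zero, Finset.sup_eq_bot_iff]
      intro s hs
      obtain ⟨u, rfl, -⟩ := coeff_rename_ne_zero _ _ _ (mem_support_iff.1 hs)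
      exact Finsupp.mapDomain_of_notMem_range _ _ (by simp [Fin.range_succAbove])
    rw [hm, degreeOf_mul_eq hπ.ne_zero (by rintro rfl; simp [hr0] at hm)] at h0
    omega

/-- A function which has along all divisors through `P` the same order as a multiple of the
canonical form is regular at `P`. -/
theorem exists_eq_div [IsNoetherianRing A] [IsIntegrallyClosed A] {P : Ideal A} [P.IsPrime]
    {m : ℕ} {φ : FractionRing A}
    (hφ : ∀ (V : ValuationSubring (FractionRing A)) (hV : IsPrimeDivisorOver A V),
      hV.center.height = 1 → hV.center ≤ P →
      ∀ (η : RatThreeForm (FractionRing A)) (g : FractionRing A),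
        IsFormGenerator V η → residueForm j w = g • η → V.valuation g ^ m = V.valuation φ) :
    ∃ a s : A, s ∉ P ∧ φ = algebraMap A _ a * (algebraMap A _ s)⁻¹ := by
  -- Otherwise `φ` has a pole along a divisor through `P`. There the canonical form is itself a
  -- generator, so the hypothesis with `g = 1` says that `φ` has order zero.
  by_contra! hcon
  obtain ⟨p, hp, hpP, ⟨π, hπ, hπ0, hu⟩, hn⟩ := exists_principal_prime_of_not_regular hcon
  obtain ⟨hp1, V, hdvr, hV⟩ := exists_isLocalRingAt (K := FractionRing A) hπ hπ0 hu
  have hV' := H.isPrimeDivisorOver hp1 hdvr hV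
  have h1 := hφ V hV' (by rwa [hV.center_eq]) (by rwa [hV.center_eq]) _ 1
    (H.isFormGenerator_residueForm hp1 hV) (one_smul _ _).symm
  rw [map_one, one_pow] at h1
  obtain ⟨a, s, hs, e⟩ := (hV φ).1 ((V.valuation_le_one_iff φ).1 h1.symm.le)
  exact hn a s hs e

end IsDoubleCover

end Divisors



/-! ## The canonical form of a double cover does not vanish -/

/-- For an étale extension the differentials of the variables form a basis of `Ω[K⁄ℂ]`, and the
determinant of that basis sends their wedge product to 1. -/
lemma wedgeD_ne_zero_of_formallyEtale {K : Type} [Field K] [Algebra ℂ K]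
    [Algebra (MvPolynomial (Fin 3) ℂ) K] [IsScalarTower ℂ (MvPolynomial (Fin 3) ℂ) K]
    [Algebra.FormallyEtale (MvPolynomial (Fin 3) ℂ) K] :
    wedgeD (fun i => algebraMap (MvPolynomial (Fin 3) ℂ) K (X i)) ≠ 0 := by
  let b := ((KaehlerDifferential.mvPolynomialBasis ℂ (Fin 3)).baseChange K).map
    (KaehlerDifferential.tensorKaehlerEquivOfFormallyEtale ℂ (MvPolynomial (Fin 3) ℂ) K)
  have hb : (fun i => KaehlerDifferential.D ℂ K (algebraMap (MvPolynomial (Fin 3) ℂ) K (X i))) =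
      b := by
    ext i
    simp [b, KaehlerDifferential.mvPolynomialBasis_apply]
  intro h0
  unfold wedgeD at h0
  rw [hb] at h0
  have h1 := exteriorPower.alternatingMapLinearEquiv_apply_ιMulti b.det b
  rw [h0, map_zero, Module.Basis.det_self] at h1
  exact zero_ne_one h1

/-- The function field is algebraic, hence separable, over `ℂ(x, y, t)`, so the étale case applies.
-/
theorem IsDoubleCover.residueForm_ne_zero {A : Type} [CommRing A] [IsDomain A] [Algebra ℂ A]
    {j : MvPolynomial (Fin 3) ℂ →ₐ[ℂ] A} {h : MvPolynomial (Fin 3) ℂ} {w : A}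
    (H : IsDoubleCover j h w) : residueForm j w ≠ 0 := by
  have hw : algebraMap A (FractionRing A) w ≠ 0 := by simpa using H.ne_zero
  refine smul_ne_zero (inv_ne_zero hw) ?_
  let : Algebra (MvPolynomial (Fin 3) ℂ) A := j.toRingHom.toAlgebra
  have : IsScalarTower ℂ (MvPolynomial (Fin 3) ℂ) A :=
    IsScalarTower.of_algebraMap_eq fun c => (j.commutes c).symm
  have : Algebra.IsIntegral (MvPolynomial (Fin 3) ℂ) A := ⟨H.isIntegral⟩
  have : FaithfulSMul (MvPolynomial (Fin 3) ℂ) A :=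
    (faithfulSMul_iff_algebraMap_injective _ _).2 H.injective
  have : IsScalarTower ℂ (MvPolynomial (Fin 3) ℂ) (FractionRing A) := inferInstance
  let := FractionRing.liftAlgebra (MvPolynomial (Fin 3) ℂ) (FractionRing A)
  have := FractionRing.isScalarTower_liftAlgebra (MvPolynomial (Fin 3) ℂ) (FractionRing A)
  have : Algebra.IsAlgebraic (FractionRing (MvPolynomial (Fin 3) ℂ)) (FractionRing A) :=
    isAlgebraic_of_isFractionRing (MvPolynomial (Fin 3) ℂ) A _ _
  have : CharZero (FractionRing (MvPolynomial (Fin 3) ℂ)) :=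
    charZero_of_injective_algebraMap (algebraMap ℂ _).injective
  have := Algebra.FormallyEtale.of_isSeparable (FractionRing (MvPolynomial (Fin 3) ℂ))
    (FractionRing A)
  have := Algebra.FormallyEtale.of_isLocalization
    (Rₘ := FractionRing (MvPolynomial (Fin 3) ℂ)) (nonZeroDivisors (MvPolynomial (Fin 3) ℂ))
  have := Algebra.FormallyEtale.comp (MvPolynomial (Fin 3) ℂ)
    (FractionRing (MvPolynomial (Fin 3) ℂ)) (FractionRing A)
  exact wedgeD_ne_zero_of_formallyEtale



/-! ## The double cover in the chart `z = 1` -/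

section HypersurfaceChart

variable {f : MvPolynomial (Fin 4) ℂ} {h : MvPolynomial (Fin 3) ℂ}

/-- A hypersurface `-w² + h(x, y, t) = 0` is a double cover. -/
lemma isDoubleCover_of_eq (hf : f = -X 3 ^ 2 + rename Fin.castSucc h) :
    IsDoubleCover ((Ideal.Quotient.mkₐ ℂ (Ideal.span {f})).comp (rename Fin.castSucc)) h
      (Ideal.Quotient.mk (Ideal.span {f}) (X 3)) where
  sq := by
    change _ = Ideal.Quotient.mk (Ideal.span {f}) (rename Fin.castSucc h)
    rw [← map_pow, Ideal.Quotient.eq, Ideal.mem_span_singleton, hf]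
    exact ⟨-1, by ring⟩
  exists_eq a := by
    obtain ⟨P, rfl⟩ := Ideal.Quotient.mk_surjective a
    have hm : (Polynomial.X ^ 2 - Polynomial.C h).Monic :=
      Polynomial.monic_X_pow_sub_C h two_ne_zero
    let g := Polynomial.X ^ 2 - Polynomial.C h
    have hdeg : (lastEquiv 3 P %ₘ g).natDegree < 2 := by
      have := Polynomial.natDegree_modByMonic_lt (lastEquiv 3 P) hm (fun h1 => by
        have := congrArg Polynomial.natDegree h1
        rw [Polynomial.natDegree_X_pow_sub_C, Polynomial.natDegree_one] at this
        omega)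
      rwa [Polynomial.natDegree_X_pow_sub_C] at this
    refine ⟨(lastEquiv 3 P %ₘ g).coeff 0, (lastEquiv 3 P %ₘ g).coeff 1, ?_⟩
    change _ = Ideal.Quotient.mk (Ideal.span {f}) (rename Fin.castSucc _) +
      Ideal.Quotient.mk (Ideal.span {f}) (rename Fin.castSucc _) * _
    rw [← map_mul, ← map_add, Ideal.Quotient.eq, Ideal.mem_span_singleton]
    refine ⟨-(lastEquiv 3).symm (lastEquiv 3 P /ₘ g), (lastEquiv 3).injective ?_⟩
    rw [hf]
    have e3 : lastEquiv 3 (X 3) = Polynomial.X := lastEquiv_X_last 3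
    simp only [map_sub, map_add, map_mul, map_neg, map_pow, AlgEquiv.apply_symm_apply,
      lastEquiv_rename, e3]
    have h1 := Polynomial.modByMonic_add_div (lastEquiv 3 P) g
    have h2 := Polynomial.eq_X_add_C_of_natDegree_le_one (Nat.lt_succ_iff.1 hdeg)
    generalize (lastEquiv 3 P %ₘ g).coeff 1 = c1 at *
    generalize (lastEquiv 3 P %ₘ g).coeff 0 = c0 at *
    rw [h2] at h1
    linear_combination -h1
  eq_zero {b c} hbc := by
    change Ideal.Quotient.mk (Ideal.span {f}) (rename Fin.castSucc b) +
      Ideal.Quotient.mk (Ideal.span {f}) (rename Fin.castSucc c) * _ = 0 at hbc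
    rw [← map_mul, ← map_add, Ideal.Quotient.eq_zero_iff_mem, Ideal.mem_span_singleton, hf] at hbc
    obtain ⟨q, hq⟩ := hbc
    have e3 : lastEquiv 3 (X 3) = Polynomial.X := lastEquiv_X_last 3
    have h1 := congrArg (lastEquiv 3) hq
    simp only [map_add, map_mul, map_neg, map_pow, lastEquiv_rename, e3] at h1
    have hm : (Polynomial.X ^ 2 - Polynomial.C h).Monic :=
      Polynomial.monic_X_pow_sub_C h two_ne_zero
    have h2 : Polynomial.C c * Polynomial.X + Polynomial.C b = 0 := by
      refine Polynomial.eq_zero_of_dvd_of_natDegree_lt (p := Polynomial.X ^ 2 - Polynomial.C h)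
        ⟨-lastEquiv 3 q, by linear_combination h1⟩ ?_
      rw [Polynomial.natDegree_X_pow_sub_C]
      exact lt_of_le_of_lt Polynomial.natDegree_linear_le one_lt_two
    have h3 := congrArg (fun p => Polynomial.coeff p 0) h2
    have h4 := congrArg (fun p => Polynomial.coeff p 1) h2
    exact ⟨by simpa using h3, by simpa using h4⟩

end HypersurfaceChart

/-! ### Equations of the blowup of the singular curve -/

namespace SplitSextic

variable (Q : SplitSextic)

lemma chartEquation_two : chartEquation Q.poly 2 =
    -X 3 ^ 2 + rename Fin.castSucc (Q.h (X 0) (X 1) 1 (X 2) : MvPolynomial (Fin 3) ℂ) := by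
  rw [map_h]
  simp only [chartEquation, poly, map_add, map_neg, map_pow, map_h, aeval_X, rename_X, map_one]
  rfl

variable {R R' : Type*} [CommRing R] [Algebra ℂ R] [CommRing R'] [Algebra ℂ R']

/-- The coefficient `r` in the chart `z = 1`. -/
def rz (y : R) : R := aeval ![y, 1] Q.r

/-- The coefficient `s + 2 a₁ r` in the chart `z = 1`. -/
def sz (y : R) : R := aeval ![y, 1] Q.s + 2 * aeval ![y, 1] Q.a₁ * Q.rz y

/-- The remainder of `r² S₁` after the substitution `x = (t σ - s) / r`, divided by `t`. -/
def linearTail (y σ t : R) : R :=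
  t * σ ^ 2 - 2 * σ * Q.sz y + σ * (algebraMap ℂ R Q.α * t * Q.rz y
      + 2 * aeval ![y, 1] Q.a₁ * Q.rz y)
    - Q.sz y * algebraMap ℂ R Q.α * Q.rz y + algebraMap ℂ R Q.β * t * Q.rz y ^ 2
    + aeval ![y, 1] Q.l * Q.rz y ^ 2

/-- The value of `r² (σ + S₁)` at `t = 0`, where `x = -s / r`. -/
def linearHead (y σ : R) : R :=
  Q.rz y ^ 2 * σ + (Q.sz y ^ 2 - 2 * aeval ![y, 1] Q.a₁ * Q.sz y * Q.rz y
    + aeval ![y, 1] Q.m * Q.rz y ^ 2)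

/-- The remainder of `r E` after the substitution `x = (t σ - s) / r`, divided by `t`. -/
def quarticTail (y σ t : R) : R :=
  2 * algebraMap ℂ R Q.δ * ((t * σ - Q.sz y) * Q.rz y - aeval ![y, 1] Q.s * Q.rz y)
    + 2 * aeval ![y, 1] Q.c₁ * (Q.rz y ^ 2 + (t * σ - Q.sz y) * t)
    + aeval ![y, 1] Q.d₂ * t * Q.rz y
    + 2 * (algebraMap ℂ R Q.c₀ * (t * σ - Q.sz y) + aeval ![y, 1] Q.d₁ * Q.rz y) * t ^ 2
    + algebraMap ℂ R Q.d₀ * t ^ 3 * Q.rz y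

/-- The value of `r⁴ h / t²` on the exceptional divisor. -/
def conicHead (y σ : R) : R := Q.linearHead y σ ^ 2 + 2 * algebraMap ℂ R Q.δ * Q.rz y ^ 6

/-- The remainder of `r⁴ h / t²`, divided by `t`. -/
def conicTail (y σ t : R) : R :=
  2 * Q.linearHead y σ * Q.linearTail y σ t + t * Q.linearTail y σ t ^ 2
    + Q.rz y ^ 3 * Q.quarticTail y σ t

lemma map_rz (φ : R →ₐ[ℂ] R') (y : R) : φ (Q.rz y) = Q.rz (φ y) := by
  simp [rz, map_aeval_pair]

lemma map_sz (φ : R →ₐ[ℂ] R') (y : R) : φ (Q.sz y) = Q.sz (φ y) := by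
  simp [sz, map_rz, map_aeval_pair, map_ofNat φ 2]

lemma map_conicHead (φ : R →ₐ[ℂ] R') (y σ : R) :
    φ (Q.conicHead y σ) = Q.conicHead (φ y) (φ σ) := by
  simp [conicHead, linearHead, map_rz, map_sz, map_aeval_pair, map_ofNat φ 2]

lemma map_conicTail (φ : R →ₐ[ℂ] R') (y σ t : R) :
    φ (Q.conicTail y σ t) = Q.conicTail (φ y) (φ σ) (φ t) := by
  simp [conicTail, linearHead, linearTail, quarticTail, map_rz, map_sz, map_aeval_pair,
    map_ofNat φ 2]

lemma S₀_chart (x y : R) : Q.S₀ x y 1 = x * Q.rz y + Q.sz y := rfl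

/-- The function whose square root is `w / t`, in terms of `σ = S₀ / t`. -/
def strictTransform (x y σ t : R) : R := (σ + Q.S₁ x y 1 t) ^ 2 + Q.E x y 1 t

lemma map_strictTransform (φ : R →ₐ[ℂ] R') (x y σ t : R) :
    φ (Q.strictTransform x y σ t) = Q.strictTransform (φ x) (φ y) (φ σ) (φ t) := by
  simp [strictTransform, map_S₁, map_E]

lemma h_eq_sq_mul_strictTransform {x y σ t : R} (hσ : Q.S₀ x y 1 = t * σ) :
    Q.h x y 1 t = t ^ 2 * Q.strictTransform x y σ t := by
  rw [h, S, hσ, strictTransform]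
  ring

/-- `S₀ = t σ` means `x r = t σ - sz`. `S₁` is quadratic in `x` and `E` is linear in `x`, so `r²`
and `r` clear the denominators; `r⁴` then suffices for `(σ + S₁)² + E`. The part free of `t` is
`conicHead`. -/
lemma rz_pow_mul_strictTransform {x y σ t : R} (hσ : Q.S₀ x y 1 = t * σ) :
    Q.rz y ^ 4 * Q.strictTransform x y σ t = Q.conicHead y σ + t * Q.conicTail y σ t := by
  rw [S₀_chart] at hσ
  have h1 : Q.rz y ^ 2 * (σ + Q.S₁ x y 1 t) = Q.linearHead y σ + t * Q.linearTail y σ t := by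
    unfold S₁ linearHead linearTail
    linear_combination (x * Q.rz y + t * σ - Q.sz y +
      Q.rz y * (algebraMap ℂ R Q.α * t + 2 * aeval ![y, 1] Q.a₁)) * hσ
  have h2 : Q.rz y * Q.E x y 1 t =
      2 * algebraMap ℂ R Q.δ * Q.rz y ^ 3 + t * Q.quarticTail y σ t := by
    unfold E quarticTail
    rw [← rz]
    linear_combination (2 * algebraMap ℂ R Q.δ * t * Q.rz y + 2 * aeval ![y, 1] Q.c₁ * t ^ 2 +
      2 * algebraMap ℂ R Q.c₀ * t ^ 3) * hσ
  unfold strictTransform conicHead conicTail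
  linear_combination (Q.rz y ^ 2 * (σ + Q.S₁ x y 1 t) + Q.linearHead y σ +
    t * Q.linearTail y σ t) * h1 + Q.rz y ^ 3 * h2

lemma exists_rz_ne_zero : ∃ y : ℂ, Q.rz y ≠ 0 := by
  by_contra! hcon
  have h0 : X 1 * Q.r = 0 := by
    apply MvPolynomial.funext
    intro v
    rw [map_mul, eval_X, map_zero]
    by_cases hv : v 1 = 0
    · rw [hv, zero_mul]
    · have := aeval_pair_mul_of_isHomogeneous Q.hom_r (v 1) (v 0 / v 1) 1
      have h1 : aeval ![v 0 / v 1, 1] Q.r = 0 := hcon _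
      rw [h1, mul_zero, mul_one, mul_div_cancel₀ _ hv] at this
      have e : ![v 0, v 1] = v := by ext i; fin_cases i <;> rfl
      rw [e] at this
      change _ * aeval v Q.r = 0
      rw [this, mul_zero]
  exact mul_ne_zero (X_ne_zero 1) Q.r_ne_zero h0

/-- Where `r(y) ≠ 0`, `linearHead` takes every value as `σ` varies, and `u² + const` is not
identically zero. -/
lemma exists_conicHead_ne_zero : ∃ y σ : ℂ, Q.conicHead y σ ≠ 0 := by
  obtain ⟨y, hy⟩ := Q.exists_rz_ne_zero
  by_contra! hcon
  have key : ∀ u : ℂ, u ^ 2 + 2 * Q.δ * Q.rz y ^ 6 = 0 := by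
    intro u
    rw [← hcon y ((u - (Q.sz y ^ 2 - 2 * aeval ![y, 1] Q.a₁ * Q.sz y * Q.rz y
      + aeval ![y, 1] Q.m * Q.rz y ^ 2)) / Q.rz y ^ 2)]
    unfold conicHead linearHead
    rw [mul_div_cancel₀ _ (pow_ne_zero 2 hy)]
    simp
  have h0 := key 0
  have h1 := key 1
  exact one_ne_zero (by linear_combination h1 - h0 : (1 : ℂ) = 0)

end SplitSextic

/-! ## Square roots of power series -/

/-- Hensel's lemma for `W² - H`, starting at the simple root `a`. -/
lemma PowerSeries.exists_sq_eq_of_constantCoeff {L : Type*} [Field L] [CharZero L]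
    {H : PowerSeries L} {a : L} (ha : a ≠ 0) (h : constantCoeff H = a ^ 2) :
    ∃ W : PowerSeries L, W ^ 2 = H ∧ constantCoeff W = a := by
  have hmem : ∀ g : PowerSeries L, g ∈ Ideal.span {PowerSeries.X} ↔ constantCoeff g = 0 :=
    fun g => by rw [Ideal.mem_span_singleton, X_dvd_iff]
  obtain ⟨W, hW, hW'⟩ := HenselianRing.is_henselian (I := Ideal.span {(X : PowerSeries L)})
    (Polynomial.X ^ 2 - Polynomial.C H) (Polynomial.monic_X_pow_sub_C H two_ne_zero) (C a)
    (by rw [hmem]; simp [h]) (by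
      refine IsUnit.map _ ?_
      rw [isUnit_iff_constantCoeff]
      simp [ha])
  refine ⟨W, ?_, ?_⟩
  · simpa [sub_eq_zero] using hW
  · rw [hmem, map_sub, constantCoeff_C, sub_eq_zero] at hW'
    exact hW'



/-! ## The generic arc through the exceptional divisor -/

/-- An algebraic closure of the field of rational functions in `y` and `σ`. -/
abbrev ExcField : Type := AlgebraicClosure (FractionRing PolyYZ)

namespace ExcField

instance : CharZero (FractionRing PolyYZ) :=
  charZero_of_injective_algebraMap (algebraMap ℂ (FractionRing PolyYZ)).injective

/-- The inclusion of polynomials. -/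
def ofPoly : PolyYZ →ₐ[ℂ] ExcField := IsScalarTower.toAlgHom ℂ PolyYZ ExcField

lemma ofPoly_injective : Function.Injective ofPoly := by
  change Function.Injective (algebraMap PolyYZ ExcField)
  rw [IsScalarTower.algebraMap_eq PolyYZ (FractionRing PolyYZ) ExcField]
  exact (algebraMap (FractionRing PolyYZ) ExcField).injective.comp
    (IsFractionRing.injective PolyYZ (FractionRing PolyYZ))

/-- The constant power series. -/
def toSeries : ExcField →ₐ[ℂ] PowerSeries ExcField :=
  IsScalarTower.toAlgHom ℂ ExcField (PowerSeries ExcField)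

/-- The constant coefficient. -/
def constCoeff : PowerSeries ExcField →ₐ[ℂ] ExcField :=
  { PowerSeries.constantCoeff with
    commutes' := fun c => by
      rw [IsScalarTower.algebraMap_apply ℂ ExcField (PowerSeries ExcField)]
      exact PowerSeries.constantCoeff_C _ }

lemma constCoeff_toSeries (a : ExcField) : constCoeff (toSeries a) = a :=
  PowerSeries.constantCoeff_C a

lemma constCoeff_X : constCoeff PowerSeries.X = 0 := by
  change PowerSeries.constantCoeff PowerSeries.X = 0
  simp

end ExcField

open ExcField

namespace SplitSextic

variable (Q : SplitSextic)

lemma rz_ofPoly_ne_zero : Q.rz (ofPoly (X 0)) ≠ 0 := by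
  rw [← map_rz, Ne, map_eq_zero_iff _ ofPoly_injective]
  intro h0
  obtain ⟨y, hy⟩ := Q.exists_rz_ne_zero
  have := congrArg (aeval ![y, 0]) h0
  rw [map_rz, aeval_X, map_zero] at this
  exact hy this

lemma conicHead_ofPoly_ne_zero : Q.conicHead (ofPoly (X 0)) (ofPoly (X 1)) ≠ 0 := by
  rw [← map_conicHead, Ne, map_eq_zero_iff _ ofPoly_injective]
  intro h0
  obtain ⟨y, σ, hy⟩ := Q.exists_conicHead_ne_zero
  have := congrArg (aeval ![y, σ]) h0
  rw [map_conicHead, aeval_X, aeval_X, map_zero] at this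
  exact hy this

/-- The arc has parameter `t` and generic constant `y, σ`. Then `x = (t σ - sz) / rz`, and `W` is a
square root of the strict transform, which has nonzero constant term because `conicHead` is
generically nonzero. -/
lemma exists_arc : ∃ x W : PowerSeries ExcField,
    Q.S₀ x (toSeries (ofPoly (X 0))) 1 = PowerSeries.X * toSeries (ofPoly (X 1)) ∧
    W ^ 2 = Q.strictTransform x (toSeries (ofPoly (X 0))) (toSeries (ofPoly (X 1))) PowerSeries.X ∧
    constCoeff W ≠ 0 := by
  set y : ExcField := ofPoly (X 0) with hy
  set σ : ExcField := ofPoly (X 1) with hσ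
  have hr : Q.rz y ≠ 0 := Q.rz_ofPoly_ne_zero
  let x : PowerSeries ExcField :=
    (PowerSeries.X * toSeries σ - Q.sz (toSeries y)) * toSeries (Q.rz y)⁻¹
  have hx : Q.S₀ x (toSeries y) 1 = PowerSeries.X * toSeries σ := by
    have : toSeries (Q.rz y)⁻¹ * Q.rz (toSeries y) = 1 := by
      rw [← Q.map_rz toSeries, ← map_mul, inv_mul_cancel₀ hr, map_one]
    rw [S₀_chart]
    linear_combination (PowerSeries.X * toSeries σ - Q.sz (toSeries y)) * this
  have h1 := congrArg constCoeff (Q.rz_pow_mul_strictTransform hx)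
  simp only [map_mul, map_add, map_pow, map_rz, map_conicHead, constCoeff_toSeries,
    constCoeff_X, zero_mul, add_zero] at h1
  have h2 : constCoeff (Q.strictTransform x (toSeries y) (toSeries σ) PowerSeries.X) ≠ 0 := by
    intro h0
    rw [h0, mul_zero] at h1
    exact Q.conicHead_ofPoly_ne_zero h1.symm
  obtain ⟨a, ha⟩ := IsAlgClosed.exists_pow_nat_eq
    (constCoeff (Q.strictTransform x (toSeries y) (toSeries σ) PowerSeries.X)) two_pos
  have ha0 : a ≠ 0 := by
    rintro rfl
    exact h2 (by rw [← ha]; simp)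
  obtain ⟨W, hW, hW'⟩ := PowerSeries.exists_sq_eq_of_constantCoeff
    (H := Q.strictTransform x (toSeries y) (toSeries σ) PowerSeries.X) ha0 ha.symm
  exact ⟨x, W, hx, hW, fun h0 => ha0 (hW'.symm.trans h0)⟩

end SplitSextic



/-! ## The local ring of the exceptional divisor -/

namespace SplitSextic

variable (Q : SplitSextic) {A : Type} [CommRing A] [IsDomain A] [Algebra ℂ A]
  (j : MvPolynomial (Fin 3) ℂ →ₐ[ℂ] A) (w : A)

/-- The rational function `S₀ / t`. -/
def excSigma : FractionRing A :=
  algebraMap A (FractionRing A) (j (Q.S₀ (X 0) (X 1) 1)) *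
    (algebraMap A (FractionRing A) (j (X 2)))⁻¹

/-- The rational function `w / t`. -/
def excW : FractionRing A :=
  algebraMap A (FractionRing A) w * (algebraMap A (FractionRing A) (j (X 2)))⁻¹

/-- The functions `y, S₀ / t, t, w / t` on a chart of the blowup of `S₀ = t = w = 0`. -/
def excMap : MvPolynomial (Fin 4) ℂ →ₐ[ℂ] FractionRing A :=
  aeval ![algebraMap A (FractionRing A) (j (X 1)), Q.excSigma j,
    algebraMap A (FractionRing A) (j (X 2)), excW j w]

variable {j w}

section Relations

variable (H : IsDoubleCover j (Q.h (X 0) (X 1) 1 (X 2)) w)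
include H

omit [IsDomain A] in
lemma algebraMap_t_ne_zero : algebraMap A (FractionRing A) (j (X 2)) ≠ 0 := by
  simp [map_eq_zero_iff _ H.injective]

omit [IsDomain A] in
lemma rz_algebraMap_ne_zero : Q.rz (algebraMap A (FractionRing A) (j (X 1))) ≠ 0 := by
  have h1 := Q.map_rz ((IsScalarTower.toAlgHom ℂ A (FractionRing A)).comp j) (X 1)
  have h2 : (Q.rz (X 1) : MvPolynomial (Fin 3) ℂ) ≠ 0 := by
    intro h0
    obtain ⟨y, hy⟩ := Q.exists_rz_ne_zero
    have := congrArg (aeval ![0, y, 0]) h0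
    rw [map_rz, aeval_X, map_zero] at this
    exact hy this
  intro h0
  change algebraMap A (FractionRing A) (j (Q.rz (X 1))) = Q.rz (algebraMap A _ (j (X 1))) at h1
  rw [h0, IsFractionRing.to_map_eq_zero_iff, map_eq_zero_iff _ H.injective] at h1
  exact h2 h1

lemma S₀_algebraMap : Q.S₀ (algebraMap A (FractionRing A) (j (X 0)))
    (algebraMap A (FractionRing A) (j (X 1))) 1 =
      algebraMap A (FractionRing A) (j (X 2)) * Q.excSigma j := by
  have h1 := Q.map_S₀ ((IsScalarTower.toAlgHom ℂ A (FractionRing A)).comp j) (X 0) (X 1) 1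
  rw [map_one] at h1
  refine h1.symm.trans ?_
  rw [excSigma, mul_comm, mul_assoc, inv_mul_cancel₀ (Q.algebraMap_t_ne_zero H), mul_one]
  rfl

lemma excW_sq : excW j w ^ 2 = Q.strictTransform (algebraMap A (FractionRing A) (j (X 0)))
    (algebraMap A (FractionRing A) (j (X 1))) (Q.excSigma j)
    (algebraMap A (FractionRing A) (j (X 2))) := by
  have ht := Q.algebraMap_t_ne_zero H
  have h1 := Q.map_h ((IsScalarTower.toAlgHom ℂ A (FractionRing A)).comp j) (X 0) (X 1) 1 (X 2)
  rw [map_one] at h1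
  have h2 := Q.h_eq_sq_mul_strictTransform (Q.S₀_algebraMap H)
  have h3 := congrArg (algebraMap A (FractionRing A)) H.sq
  have h4 := (h3.trans h1).trans h2
  rw [map_pow] at h4
  rw [excW, mul_pow, h4]
  field_simp

end Relations

variable (j w) in
/-- The coordinate ring of the chart of the blowup. -/
abbrev ExcRing : Subalgebra ℂ (FractionRing A) := (Q.excMap j w).range

variable (j w) in
/-- The coordinates on the chart of the blowup. -/
abbrev toExcRing : MvPolynomial (Fin 4) ℂ →ₐ[ℂ] Q.ExcRing j w := (Q.excMap j w).rangeRestrict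

lemma toExcRing_surjective : Function.Surjective (Q.toExcRing j w) :=
  (Q.excMap j w).rangeRestrict_surjective

/-- Functions on the blowup become functions on `A` after multiplication by a power of `t`,
compatibly with an arc. -/
lemma exists_mul_pow_eq (H : IsDoubleCover j (Q.h (X 0) (X 1) 1 (X 2)) w)
    {O : Type*} [CommRing O] [Algebra ℂ O] (Θ : A →ₐ[ℂ] O) {σ W : O}
    (hσ : Q.S₀ (Θ (j (X 0))) (Θ (j (X 1))) 1 = Θ (j (X 2)) * σ) (hW : Θ w = Θ (j (X 2)) * W)
    (a : MvPolynomial (Fin 4) ℂ) : ∃ (M : ℕ) (α : A),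
      algebraMap A (FractionRing A) α =
        Q.excMap j w a * algebraMap A (FractionRing A) (j (X 2)) ^ M ∧
      Θ α = aeval ![Θ (j (X 1)), σ, Θ (j (X 2)), W] a * Θ (j (X 2)) ^ M := by
  have ht := Q.algebraMap_t_ne_zero H
  induction a using MvPolynomial.induction_on with
  | C c =>
    refine ⟨0, algebraMap ℂ A c, ?_, ?_⟩
    · rw [pow_zero, mul_one, algHom_C, ← IsScalarTower.algebraMap_apply]
    · rw [pow_zero, mul_one, algHom_C, AlgHom.commutes]
  | add p q hp hq =>
    obtain ⟨M, α, h1, h2⟩ := hp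
    obtain ⟨N, β, h3, h4⟩ := hq
    refine ⟨M + N, α * j (X 2) ^ N + β * j (X 2) ^ M, ?_, ?_⟩
    · rw [map_add, map_mul, map_mul, h1, h3, map_pow, map_pow, map_add]; ring
    · rw [map_add, map_mul, map_mul, h2, h4, map_pow, map_pow, map_add]; ring
  | mul_X p i hp =>
    obtain ⟨M, α, h1, h2⟩ := hp
    have hX : ∀ i, Q.excMap j w (X i) = (![algebraMap A (FractionRing A) (j (X 1)), Q.excSigma j,
      algebraMap A (FractionRing A) (j (X 2)), excW j w]) i := fun i => aeval_X _ _
    fin_cases i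
    · refine ⟨M, α * j (X 1), ?_, ?_⟩
      · rw [map_mul, h1, map_mul, hX]; simp; ring
      · rw [map_mul, h2, map_mul, aeval_X]; simp; ring
    · refine ⟨M + 1, α * j (Q.S₀ (X 0) (X 1) 1), ?_, ?_⟩
      · rw [map_mul, h1, map_mul, hX]; simp [excSigma]; field_simp; ring
      · have h3 := Q.map_S₀ (Θ.comp j) (X 0) (X 1) 1
        rw [map_one] at h3
        rw [map_mul, h2, map_mul, aeval_X, show Θ (j (Q.S₀ (X 0) (X 1) 1)) = _ from h3]
        simp only [AlgHom.comp_apply, hσ]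
        simp; ring
    · refine ⟨M, α * j (X 2), ?_, ?_⟩
      · rw [map_mul, h1, map_mul, hX]; simp; ring
      · rw [map_mul, h2, map_mul, aeval_X]; simp; ring
    · refine ⟨M + 1, α * w, ?_, ?_⟩
      · rw [map_mul, h1, map_mul, hX]; simp [excW]; field_simp; ring
      · rw [map_mul, h2, map_mul, aeval_X, hW]; simp; ring

/-- The generic point of the exceptional divisor. -/
lemma exists_residueMap (H : IsDoubleCover j (Q.h (X 0) (X 1) 1 (X 2)) w)
    (hlift : ∀ x y t W : PowerSeries ExcField, W ^ 2 = Q.h x y 1 t →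
      ∃ Θ : A →ₐ[ℂ] PowerSeries ExcField,
        Θ (j (X 0)) = x ∧ Θ (j (X 1)) = y ∧ Θ (j (X 2)) = t ∧ Θ w = W) :
    ∃ (τ : Q.ExcRing j w →ₐ[ℂ] ExcField) (W₀ : ExcField), W₀ ≠ 0 ∧
      ∀ a, τ (Q.toExcRing j w a) = aeval ![ofPoly (X 0), ofPoly (X 1), 0, W₀] a := by
  obtain ⟨x, W, hx, hW, hW0⟩ := Q.exists_arc
  obtain ⟨Θ, h0, h1, h2, h3⟩ := hlift x (toSeries (ofPoly (X 0))) PowerSeries.X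
    (PowerSeries.X * W) (by rw [mul_pow, hW, Q.h_eq_sq_mul_strictTransform hx])
  let ev : MvPolynomial (Fin 4) ℂ →ₐ[ℂ] PowerSeries ExcField :=
    aeval ![toSeries (ofPoly (X 0)), toSeries (ofPoly (X 1)), PowerSeries.X, W]
  -- Well-definedness of the residue map: if `a` vanishes as a rational function, it comes from `0 ∈
  -- A` after multiplication by a power of `t`. Hence its value on the arc, times that power, is
  -- zero, and power series form a domain.
  have hker : RingHom.ker (Q.toExcRing j w).toRingHom ≤ RingHom.ker (constCoeff.comp ev).toRingHom := by
    intro a ha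
    have ha' : Q.excMap j w a = 0 := congrArg Subtype.val ha
    obtain ⟨M, α, h4, h5⟩ := Q.exists_mul_pow_eq H Θ (σ := toSeries (ofPoly (X 1))) (W := W)
      (by rw [h0, h1, h2, hx]) (by rw [h3, h2]) a
    rw [ha', zero_mul, IsFractionRing.to_map_eq_zero_iff] at h4
    rw [h4, map_zero, h1, h2, eq_comm, mul_eq_zero] at h5
    have h6 : ev a = 0 := h5.resolve_right (pow_ne_zero _ PowerSeries.X_ne_zero)
    change constCoeff (ev a) = 0
    rw [h6, map_zero]
  refine ⟨AlgHom.liftOfSurjective _ Q.toExcRing_surjective _ hker, constCoeff W, hW0, fun a => ?_⟩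
  rw [AlgHom.liftOfSurjective_apply]
  change (constCoeff.comp ev) a = _
  congr 1
  ext i
  fin_cases i <;> simp [ev, constCoeff_toSeries, constCoeff_X]

end SplitSextic



/-! ### The parameter `t` at the exceptional divisor -/

lemma Subalgebra.isFractionRing_of_forall_mem_closure {K : Type*} [Field K] [Algebra ℂ K]
    (R : Subalgebra ℂ K) (h : ∀ z : K, z ∈ Subfield.closure (R : Set K)) : IsFractionRing R K := by
  refine IsFractionRing.of_field R K fun z => ?_
  obtain ⟨a, ha, b, hb, e⟩ := Subfield.mem_closure_iff.1 (h z)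
  have hcl : Subring.closure (R : Set K) = R.toSubring := Subring.closure_eq R.toSubring
  rw [hcl] at ha hb
  exact ⟨⟨a, ha⟩, ⟨b, hb⟩, e.symm⟩

namespace SplitSextic

variable (Q : SplitSextic) {A : Type} [CommRing A] [IsDomain A] [Algebra ℂ A]
  {j : MvPolynomial (Fin 3) ℂ →ₐ[ℂ] A} {w : A}

/-- The equation of the blowup, with denominators cleared. -/
lemma rz_pow_mul_sq_toExcRing (H : IsDoubleCover j (Q.h (X 0) (X 1) 1 (X 2)) w) :
    Q.rz (Q.toExcRing j w (X 0)) ^ 4 * Q.toExcRing j w (X 3) ^ 2 =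
      Q.conicHead (Q.toExcRing j w (X 0)) (Q.toExcRing j w (X 1)) +
      Q.toExcRing j w (X 2) *
        Q.conicTail (Q.toExcRing j w (X 0)) (Q.toExcRing j w (X 1)) (Q.toExcRing j w (X 2)) := by
  apply (show Function.Injective (Q.ExcRing j w).val from Subtype.val_injective)
  have hX : ∀ i, (Q.ExcRing j w).val (Q.toExcRing j w (X i)) =
      (![algebraMap A (FractionRing A) (j (X 1)), Q.excSigma j,
        algebraMap A (FractionRing A) (j (X 2)), excW j w]) i := fun i => aeval_X _ _
  simp only [map_add, map_mul, map_pow, map_rz, map_conicHead, map_conicTail, hX]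
  simpa [Q.excW_sq H] using Q.rz_pow_mul_strictTransform (Q.S₀_algebraMap H)

/-- Functions on the blowup are, up to multiples of `t`, linear in `w / t`. -/
lemma exists_eq_linear_add (H : IsDoubleCover j (Q.h (X 0) (X 1) 1 (X 2)) w)
    (c : Q.ExcRing j w) : ∃ (u c₀ c₁ : PolyYZ) (v : Q.ExcRing j w), u ≠ 0 ∧
      aeval ![Q.toExcRing j w (X 0), Q.toExcRing j w (X 1)] u * c =
        aeval ![Q.toExcRing j w (X 0), Q.toExcRing j w (X 1)] c₀ +
        aeval ![Q.toExcRing j w (X 0), Q.toExcRing j w (X 1)] c₁ * Q.toExcRing j w (X 3) +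
        Q.toExcRing j w (X 2) * v := by
  obtain ⟨a, rfl⟩ := Q.toExcRing_surjective c
  have heq := Q.rz_pow_mul_sq_toExcRing H
  set y := Q.toExcRing j w (X 0) with hy
  set σ := Q.toExcRing j w (X 1) with hσ
  set t := Q.toExcRing j w (X 2) with ht
  set W := Q.toExcRing j w (X 3) with hW
  set κ : PolyYZ →ₐ[ℂ] Q.ExcRing j w := aeval ![y, σ] with hκ
  have hκ0 : κ (X 0) = y := by simp [hκ]
  have hκ1 : κ (X 1) = σ := by simp [hκ]
  induction a using MvPolynomial.induction_on with
  | C c => exact ⟨1, C c, 0, 0, one_ne_zero, by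
    simp only [map_one, map_zero, one_mul, zero_mul, mul_zero, add_zero, algHom_C]⟩
  | add p q hp hq =>
    obtain ⟨u, c₀, c₁, v, hu, h1⟩ := hp
    obtain ⟨u', c₀', c₁', v', hu', h2⟩ := hq
    refine ⟨u * u', u' * c₀ + u * c₀', u' * c₁ + u * c₁', κ u' * v + κ u * v',
      mul_ne_zero hu hu', ?_⟩
    simp only [map_add, map_mul]
    linear_combination κ u' * h1 + κ u * h2
  | mul_X p i hp =>
    obtain ⟨u, c₀, c₁, v, hu, h1⟩ := hp
    rw [map_mul]
    fin_cases i
    · refine ⟨u, c₀ * X 0, c₁ * X 0, v * y, hu, ?_⟩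
      simp only [map_mul, hκ0]
      change _ * (_ * y) = _
      linear_combination y * h1
    · refine ⟨u, c₀ * X 1, c₁ * X 1, v * σ, hu, ?_⟩
      simp only [map_mul, hκ1]
      change _ * (_ * σ) = _
      linear_combination σ * h1
    · refine ⟨u, 0, 0, κ u * Q.toExcRing j w p, hu, ?_⟩
      simp only [map_zero]
      change _ * (_ * t) = _
      ring
    · refine ⟨u * Q.rz (X 0) ^ 4, c₁ * Q.conicHead (X 0) (X 1), Q.rz (X 0) ^ 4 * c₀,
        κ c₁ * Q.conicTail y σ t + Q.rz y ^ 4 * v * W, mul_ne_zero hu (pow_ne_zero 4 ?_), ?_⟩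
      · intro h0
        apply Q.rz_ofPoly_ne_zero
        rw [← map_rz, h0, map_zero]
      · simp only [map_mul, map_pow, map_rz, map_conicHead, hκ0, hκ1]
        change _ * (_ * W) = _
        linear_combination Q.rz y ^ 4 * W * h1 + κ c₁ * heq

/-- The exceptional divisor is locally defined by `t`. -/
lemma exists_notMem_dvd (H : IsDoubleCover j (Q.h (X 0) (X 1) 1 (X 2)) w)
    {τ : Q.ExcRing j w →ₐ[ℂ] ExcField} {W₀ : ExcField} (hW₀ : W₀ ≠ 0)
    (hτ : ∀ a, τ (Q.toExcRing j w a) = aeval ![ofPoly (X 0), ofPoly (X 1), 0, W₀] a)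
    {c : Q.ExcRing j w} (hc : c ∈ RingHom.ker τ) :
    ∃ u ∉ RingHom.ker τ, Q.toExcRing j w (X 2) ∣ u * c := by
  obtain ⟨u, c₀, c₁, v, hu, h1⟩ := Q.exists_eq_linear_add H c
  have heq := Q.rz_pow_mul_sq_toExcRing H
  set y := Q.toExcRing j w (X 0) with hy
  set σ := Q.toExcRing j w (X 1) with hσ
  set t := Q.toExcRing j w (X 2) with ht
  set W := Q.toExcRing j w (X 3) with hW
  set κ : PolyYZ →ₐ[ℂ] Q.ExcRing j w := aeval ![y, σ] with hκ
  have hκ0 : κ (X 0) = y := by simp [hκ]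
  have hκ1 : κ (X 1) = σ := by simp [hκ]
  have hτy : τ y = ofPoly (X 0) := by rw [hy, hτ]; simp
  have hτσ : τ σ = ofPoly (X 1) := by rw [hσ, hτ]; simp
  have hτt : τ t = 0 := by rw [ht, hτ]; simp
  have hτW : τ W = W₀ := by rw [hW, hτ]; simp
  have hτκ : ∀ p, τ (κ p) = ofPoly p := by
    have : τ.comp κ = ofPoly := by
      ext i
      fin_cases i
      · change τ (κ (X 0)) = _; rw [hκ0, hτy]; rfl
      · change τ (κ (X 1)) = _; rw [hκ1, hτσ]; rfl
    exact fun p => DFunLike.congr_fun this p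
  have hr : (Q.rz (X 0) : PolyYZ) ≠ 0 := by
    intro h0
    apply Q.rz_ofPoly_ne_zero
    rw [← map_rz, h0, map_zero]
  have hne : ∀ p : PolyYZ, p ≠ 0 → ofPoly p ≠ 0 := fun p hp => by
    rwa [Ne, map_eq_zero_iff _ ofPoly_injective]
  have h2 := congrArg τ h1
  rw [map_mul, show τ c = 0 from hc, mul_zero, map_add, map_add, map_mul, map_mul, hτκ, hτκ, hτW,
    hτt, zero_mul, add_zero] at h2
  have heq' := congrArg τ heq
  simp only [map_mul, map_add, map_pow, map_rz, map_conicHead, hτy, hτσ, hτt, hτW, zero_mul,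
    add_zero] at heq'
  -- The residue satisfies `c₀ + c₁ W₀ = 0`. If `c₀ = 0`, then `c₁ = 0` because `W₀ ≠ 0`, and `t`
  -- already divides `κ u * c`. Otherwise `W₀` is rational in `y, σ`: the exceptional locus splits,
  -- and only one component is wanted. The conjugate `c₀ - c₁ W` has residue `2 c₀ ≠ 0`, and its
  -- product with `c₀ + c₁ W` is, after multiplication by `r⁴`, divisible by `t`.
  by_cases h0 : c₀ = 0
  · have h3 : c₁ = 0 := by
      by_contra h3
      rw [h0, map_zero, zero_add] at h2
      exact mul_ne_zero (hne _ h3) hW₀ h2.symm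
    refine ⟨κ u, ?_, v, ?_⟩
    · rw [RingHom.mem_ker]
      rw [hτκ]
      exact hne u hu
    · rw [h1, h0, h3]; simp
  · have h4 : Q.rz (X 0) ^ 4 * c₀ ^ 2 = c₁ ^ 2 * Q.conicHead (X 0) (X 1) := by
      apply ofPoly_injective
      simp only [map_mul, map_pow, map_rz, map_conicHead]
      rw [← heq']
      linear_combination -(Q.rz (ofPoly (X 0)) ^ 4) * (ofPoly c₀ - ofPoly c₁ * W₀) * h2
    have h5 := congrArg κ h4
    simp only [map_mul, map_pow, map_rz, map_conicHead, hκ0, hκ1] at h5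
    refine ⟨Q.rz y ^ 4 * (κ c₀ - κ c₁ * W) * κ u, ?_,
      Q.rz y ^ 4 * (κ c₀ - κ c₁ * W) * v - κ c₁ ^ 2 * Q.conicTail y σ t, ?_⟩
    · rw [RingHom.mem_ker]
      rw [map_mul, map_mul, map_pow, map_rz, map_sub, map_mul, hτκ, hτκ, hτκ, hτW, hτy]
      refine mul_ne_zero (mul_ne_zero (pow_ne_zero 4 Q.rz_ofPoly_ne_zero) ?_) (hne u hu)
      intro h6
      have h7 : 2 * ofPoly c₀ = 0 := by linear_combination h6 - h2
      exact hne _ h0 ((mul_eq_zero.1 h7).resolve_left two_ne_zero)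
    · linear_combination Q.rz y ^ 4 * (κ c₀ - κ c₁ * W) * h1 + h5 - κ c₁ ^ 2 * heq

/-- The blowup is birational: `x = (t σ - sz) / rz` and `w = t W` are rational in `y, σ, t, W`. -/
lemma isFractionRing_excRing (H : IsDoubleCover j (Q.h (X 0) (X 1) 1 (X 2)) w) :
    IsFractionRing (Q.ExcRing j w) (FractionRing A) := by
  let F : Subfield (FractionRing A) := Subfield.closure (Q.ExcRing j w)
  have hR : ∀ a, Q.excMap j w a ∈ F := fun a => Subfield.subset_closure ⟨a, rfl⟩
  have hX : ∀ i, (![algebraMap A (FractionRing A) (j (X 1)), Q.excSigma j,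
      algebraMap A (FractionRing A) (j (X 2)), excW j w]) i ∈ F := fun i => by
    have := hR (X i)
    rwa [excMap, aeval_X] at this
  have hC : ∀ c : ℂ, algebraMap ℂ (FractionRing A) c ∈ F := fun c => by
    have := hR (C c)
    rwa [algHom_C] at this
  have hy : algebraMap A (FractionRing A) (j (X 1)) ∈ F := hX 0
  have hσ : Q.excSigma j ∈ F := hX 1
  have ht : algebraMap A (FractionRing A) (j (X 2)) ∈ F := hX 2
  have hW : excW j w ∈ F := hX 3
  let F' : Subalgebra ℂ (FractionRing A) := { F.toSubring with algebraMap_mem' := hC }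
  have hp : ∀ p : PolyYZ, aeval ![algebraMap A (FractionRing A) (j (X 1)), 1] p ∈ F' := fun p => by
    refine F'.aeval_mem_of_forall_mem (fun i => ?_) p
    fin_cases i
    · exact hy
    · exact F'.one_mem
  have hrz : Q.rz (algebraMap A (FractionRing A) (j (X 1))) ∈ F := hp _
  have hsz : Q.sz (algebraMap A (FractionRing A) (j (X 1))) ∈ F' :=
    F'.add_mem (hp _) (F'.mul_mem (F'.mul_mem (ofNat_mem F' 2) (hp _)) (hp _))
  have hx : algebraMap A (FractionRing A) (j (X 0)) ∈ F := by
    have h1 := Q.S₀_algebraMap H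
    rw [S₀_chart] at h1
    rw [eq_div_of_mul_eq (Q.rz_algebraMap_ne_zero H) (eq_sub_of_add_eq h1)]
    exact F.div_mem (F.sub_mem (F.mul_mem ht hσ) hsz) hrz
  have hw : algebraMap A (FractionRing A) w ∈ F := by
    have : algebraMap A (FractionRing A) w =
        excW j w * algebraMap A (FractionRing A) (j (X 2)) := by
      rw [excW, mul_assoc, inv_mul_cancel₀ (Q.algebraMap_t_ne_zero H), mul_one]
    rw [this]
    exact F.mul_mem hW ht
  have hj : ∀ b, algebraMap A (FractionRing A) (j b) ∈ F' := fun b => by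
    rw [IsDoubleCover.algebraMap_j]
    refine F'.aeval_mem_of_forall_mem (fun i => ?_) b
    fin_cases i
    exacts [hx, hy, ht]
  have hA : ∀ a, algebraMap A (FractionRing A) a ∈ F := fun a => by
    obtain ⟨b, c, rfl⟩ := H.exists_eq a
    rw [map_add, map_mul]
    exact F.add_mem (hj b) (F.mul_mem (hj c) hw)
  refine (Q.ExcRing j w).isFractionRing_of_forall_mem_closure fun z => ?_
  obtain ⟨a, b, -, rfl⟩ := IsFractionRing.div_surjective A z
  exact F.div_mem (hA a) (hA b)

end SplitSextic



/-! ## The exceptional divisor has discrepancy zero -/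

namespace SplitSextic

variable (Q : SplitSextic) {A : Type} [CommRing A] [IsDomain A] [Algebra ℂ A]
  {j : MvPolynomial (Fin 3) ℂ →ₐ[ℂ] A} {w : A}

/-- The exceptional divisor of the blowup of `S₀ = t = w = 0`. -/
structure IsExceptional (j : MvPolynomial (Fin 3) ℂ →ₐ[ℂ] A) (w : A)
    (V : ValuationSubring (FractionRing A)) : Prop where
  dvr : IsDiscreteValuationRing V
  complex_mem (c : ℂ) : algebraMap ℂ (FractionRing A) c ∈ V
  mem (a : MvPolynomial (Fin 4) ℂ) : Q.excMap j w a ∈ V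
  exists_eq (g : FractionRing A) : g ∈ V → ∃ a s,
    V.valuation (Q.excMap j w s) = 1 ∧ g = Q.excMap j w a * (Q.excMap j w s)⁻¹
  t_lt : V.valuation (algebraMap A (FractionRing A) (j (X 2))) < 1
  W_eq : V.valuation (excW j w) = 1
  r_eq : V.valuation (Q.rz (algebraMap A (FractionRing A) (j (X 1)))) = 1
  residue (p : PolyYZ) : p ≠ 0 →
    V.valuation (aeval ![algebraMap A (FractionRing A) (j (X 1)), Q.excSigma j] p) = 1

/-- `V` is the localization of `ℂ[y, σ, t, W]` at the kernel of the residue map, where `t` is a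
local parameter. Everything with nonzero residue has valuation 1: `W`, `rz`, and all nonzero
polynomials in `y` and `σ`. -/
lemma exists_isExceptional (H : IsDoubleCover j (Q.h (X 0) (X 1) 1 (X 2)) w)
    (hlift : ∀ x y t W : PowerSeries ExcField, W ^ 2 = Q.h x y 1 t →
      ∃ Θ : A →ₐ[ℂ] PowerSeries ExcField,
        Θ (j (X 0)) = x ∧ Θ (j (X 1)) = y ∧ Θ (j (X 2)) = t ∧ Θ w = W) :
    ∃ V, Q.IsExceptional j w V := by
  obtain ⟨τ, W₀, hW₀, hτ⟩ := Q.exists_residueMap H hlift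
  have := Q.isFractionRing_excRing H
  have : IsNoetherianRing (Q.ExcRing j w) :=
    isNoetherianRing_of_surjective _ _ (Q.toExcRing j w).toRingHom Q.toExcRing_surjective
  have hX : ∀ i, Q.excMap j w (X i) = (![algebraMap A (FractionRing A) (j (X 1)), Q.excSigma j,
      algebraMap A (FractionRing A) (j (X 2)), excW j w]) i := fun i => aeval_X _ _
  have hp : (RingHom.ker τ).IsPrime := RingHom.ker_isPrime τ
  have ht : Q.toExcRing j w (X 2) ∈ RingHom.ker τ := by
    rw [RingHom.mem_ker, hτ]; simp
  have ht0 : Q.toExcRing j w (X 2) ≠ 0 := by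
    intro h0
    apply Q.algebraMap_t_ne_zero H
    have := congrArg Subtype.val h0
    exact (hX 2).symm.trans this
  obtain ⟨-, V, hdvr, hV⟩ := exists_isLocalRingAt (K := FractionRing A) ht ht0
    fun c hc => Q.exists_notMem_dvd H hW₀ hτ hc
  have hone : ∀ a, aeval ![ofPoly (X 0), ofPoly (X 1), 0, W₀] a ≠ 0 →
      V.valuation (Q.excMap j w a) = 1 := fun a ha => by
    refine hV.valuation_eq_one (s := Q.toExcRing j w a) fun hmem => ?_
    rw [RingHom.mem_ker, hτ] at hmem
    exact ha hmem
  have hpair : ∀ p : PolyYZ, p ≠ 0 →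
      V.valuation (aeval ![algebraMap A (FractionRing A) (j (X 1)), Q.excSigma j] p) = 1 := by
    intro p hp0
    have h1 := map_aeval_pair (Q.excMap j w) p (X 0) (X 1)
    rw [hX, hX] at h1
    refine (congrArg V.valuation h1).symm.trans (hone _ ?_)
    rw [map_aeval_pair, aeval_X, aeval_X]
    have h2 := map_aeval_pair ofPoly p (X 0) (X 1)
    have e : ![X 0, X 1] = (X : Fin 2 → PolyYZ) := by ext1 i; fin_cases i <;> rfl
    rw [e, aeval_X_left_apply] at h2
    refine fun h0 => hp0 ?_
    rw [← map_eq_zero_iff _ ofPoly_injective]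
    exact h2.trans h0
  refine ⟨V, hdvr, fun c => hV.algebraMap_mem (algebraMap ℂ (Q.ExcRing j w) c),
    fun a => hV.algebraMap_mem (Q.toExcRing j w a), fun g hg => ?_, ?_, ?_, ?_, hpair⟩
  · obtain ⟨a, s, hs, e⟩ := (hV g).1 hg
    obtain ⟨a, rfl⟩ := Q.toExcRing_surjective a
    obtain ⟨s, rfl⟩ := Q.toExcRing_surjective s
    exact ⟨a, s, hV.valuation_eq_one hs, e⟩
  · rw [← show _ = algebraMap A (FractionRing A) (j (X 2)) from hX 2]
    exact hV.valuation_lt_one ht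
  · rw [← show _ = excW j w from hX 3]
    exact hone _ (by simpa using hW₀)
  · have h1 := Q.map_rz (aeval ![algebraMap A (FractionRing A) (j (X 1)), Q.excSigma j]) (X 0)
    rw [aeval_X] at h1
    refine (congrArg V.valuation h1).symm.trans (hpair _ fun h0 => Q.rz_ofPoly_ne_zero ?_)
    rw [← map_rz, h0, map_zero]

namespace IsExceptional

variable {Q} {V : ValuationSubring (FractionRing A)} (hV : Q.IsExceptional j w V)
  (H : IsDoubleCover j (Q.h (X 0) (X 1) 1 (X 2)) w)
include hV

lemma y_mem : algebraMap A (FractionRing A) (j (X 1)) ∈ V := by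
  have := hV.mem (X 0)
  rwa [excMap, aeval_X] at this

lemma sigma_mem : Q.excSigma j ∈ V := by
  have := hV.mem (X 1)
  rwa [excMap, aeval_X] at this

lemma t_mem : algebraMap A (FractionRing A) (j (X 2)) ∈ V := by
  have := hV.mem (X 2)
  rwa [excMap, aeval_X] at this

lemma W_mem : excW j w ∈ V := by
  have := hV.mem (X 3)
  rwa [excMap, aeval_X] at this

omit [Algebra ℂ A] hV in
lemma inv_mem {g : FractionRing A} (hg : V.valuation g = 1) : g⁻¹ ∈ V := by
  rw [← V.valuation_le_one_iff, map_inv₀, hg, inv_one]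

include H

/-- The regular forms at the exceptional divisor are generated by the differentials of
`S₀ / t, y, t`, and `A` is contained in its valuation ring. -/
lemma mem_and_D_mem {N : Submodule V (Ω[FractionRing A⁄ℂ])}
    (hσ : KaehlerDifferential.D ℂ (FractionRing A) (Q.excSigma j) ∈ N)
    (hy : KaehlerDifferential.D ℂ (FractionRing A) (algebraMap A (FractionRing A) (j (X 1))) ∈ N)
    (ht : KaehlerDifferential.D ℂ (FractionRing A) (algebraMap A (FractionRing A) (j (X 2))) ∈ N) :
    (∀ a, algebraMap A (FractionRing A) a ∈ V) ∧
      ∀ g ∈ V, KaehlerDifferential.D ℂ (FractionRing A) g ∈ N := by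
  let T := V.withDifferentialIn hV.complex_mem N
  have hyT : algebraMap A (FractionRing A) (j (X 1)) ∈ T := ⟨hV.y_mem, hy⟩
  have hσT : Q.excSigma j ∈ T := ⟨hV.sigma_mem, hσ⟩
  have htT : algebraMap A (FractionRing A) (j (X 2)) ∈ T := ⟨hV.t_mem, ht⟩
  have hp : ∀ p : PolyYZ, aeval ![algebraMap A (FractionRing A) (j (X 1)), 1] p ∈ T := fun p => by
    refine T.aeval_mem_of_forall_mem (fun i => ?_) p
    fin_cases i
    · exact hyT
    · exact T.one_mem
  have hsz : Q.sz (algebraMap A (FractionRing A) (j (X 1))) ∈ T :=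
    T.add_mem (hp _) (T.mul_mem (T.mul_mem (ofNat_mem T 2) (hp _)) (hp _))
  have hr : (Q.rz (algebraMap A (FractionRing A) (j (X 1))))⁻¹ ∈ T :=
    ValuationSubring.inv_mem_withDifferentialIn (hp _) (inv_mem hV.r_eq)
  have hxT : algebraMap A (FractionRing A) (j (X 0)) ∈ T := by
    have h1 := Q.S₀_algebraMap H
    rw [S₀_chart] at h1
    rw [eq_div_of_mul_eq (Q.rz_algebraMap_ne_zero H) (eq_sub_of_add_eq h1), div_eq_mul_inv]
    exact T.mul_mem (T.sub_mem (T.mul_mem htT hσT) hsz) hr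
  have hsqT : excW j w ^ 2 ∈ T := by
    rw [Q.excW_sq H]
    have := Q.map_strictTransform T.val ⟨_, hxT⟩ ⟨_, hyT⟩ ⟨_, hσT⟩ ⟨_, htT⟩
    exact this ▸ Subtype.prop _
  -- `W²` is a polynomial in `x, y, σ, t`, and `2 W dW = d(W²)` can be divided by the unit `2 W`.
  have hWT : excW j w ∈ T := by
    refine ⟨hV.W_mem, ?_⟩
    have h1 := hsqT.2
    rw [Derivation.leibniz_pow] at h1
    have hW0 : excW j w ≠ 0 := by
      intro h0
      have := hV.W_eq
      rw [h0, map_zero] at this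
      exact zero_ne_one this
    have h2 := N.smul_mem ⟨(excW j w)⁻¹, inv_mem hV.W_eq⟩
      (N.smul_mem ⟨_, hV.complex_mem 2⁻¹⟩ h1)
    change (excW j w)⁻¹ • algebraMap ℂ (FractionRing A) 2⁻¹ • _ ∈ N at h2
    rwa [Nat.add_one_sub_one, pow_one, algebraMap_smul, ← Nat.cast_smul_eq_nsmul ℂ, smul_smul,
      Nat.cast_ofNat, inv_mul_cancel₀ two_ne_zero, one_smul, smul_smul, inv_mul_cancel₀ hW0,
      one_smul] at h2
  have hwT : algebraMap A (FractionRing A) w ∈ T := by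
    have : algebraMap A (FractionRing A) w =
        excW j w * algebraMap A (FractionRing A) (j (X 2)) := by
      rw [excW, mul_assoc, inv_mul_cancel₀ (Q.algebraMap_t_ne_zero H), mul_one]
    rw [this]
    exact T.mul_mem hWT htT
  refine ⟨fun a => ?_, fun g hg => ?_⟩
  · have hj : ∀ b, algebraMap A (FractionRing A) (j b) ∈ T := fun b => by
      rw [IsDoubleCover.algebraMap_j]
      refine T.aeval_mem_of_forall_mem (fun i => ?_) b
      fin_cases i
      exacts [hxT, hyT, htT]
    obtain ⟨b, c, rfl⟩ := H.exists_eq a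
    rw [map_add, map_mul]
    exact (T.add_mem (hj b) (T.mul_mem (hj c) hwT)).1
  · have hR : ∀ a, Q.excMap j w a ∈ T := by
      refine T.aeval_mem_of_forall_mem fun i => ?_
      fin_cases i
      exacts [hyT, hσT, htT, hWT]
    obtain ⟨a, s, hs, rfl⟩ := hV.exists_eq g hg
    exact (T.mul_mem (hR a)
      (ValuationSubring.inv_mem_withDifferentialIn (hR s) (inv_mem hs))).2

lemma isPrimeDivisorOver : IsPrimeDivisorOver A V where
  mem := (hV.mem_and_D_mem H (N := ⊤) trivial trivial trivial).1
  dvr := hV.dvr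
  residue := ⟨![algebraMap A (FractionRing A) (j (X 1)), Q.excSigma j], hV.residue⟩

lemma isFormGenerator : IsFormGenerator V (wedgeD ![Q.excSigma j,
    algebraMap A (FractionRing A) (j (X 1)), algebraMap A (FractionRing A) (j (X 2))]) := by
  refine isFormGenerator_wedgeD (fun i => ?_) (hV.mem_and_D_mem H ?_ ?_ ?_).2
  · fin_cases i
    exacts [hV.sigma_mem, hV.y_mem, hV.t_mem]
  · exact Submodule.subset_span ⟨0, rfl⟩
  · exact Submodule.subset_span ⟨1, rfl⟩
  · exact Submodule.subset_span ⟨2, rfl⟩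

-- The discrepancy computation. Differentiating `S₀ = t σ` gives `rz dx = t dσ + σ dt + k dy`; the
-- last two terms die against `dy ∧ dt`. The factor `t` cancels with `w = t W`, and `rz W` is a unit
-- at the exceptional divisor.
omit hV in
lemma residueForm_eq : residueForm j w =
    (Q.rz (algebraMap A (FractionRing A) (j (X 1))) * excW j w)⁻¹ • wedgeD ![Q.excSigma j,
      algebraMap A (FractionRing A) (j (X 1)), algebraMap A (FractionRing A) (j (X 2))] := by
  set x := algebraMap A (FractionRing A) (j (X 0)) with hx
  set y := algebraMap A (FractionRing A) (j (X 1)) with hy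
  set t := algebraMap A (FractionRing A) (j (X 2)) with ht
  have hr0 := Q.rz_algebraMap_ne_zero H
  have ht0 := Q.algebraMap_t_ne_zero H
  have hw0 : algebraMap A (FractionRing A) w ≠ 0 := by simpa using H.ne_zero
  have hD : ∀ p : PolyYZ, KaehlerDifferential.D ℂ (FractionRing A) (aeval ![y, 1] p) =
      aeval ![y, 1] (pderiv 0 p) • KaehlerDifferential.D ℂ (FractionRing A) y := fun p => by
    rw [Derivation.aeval_pair, Derivation.map_one_eq_zero, smul_zero, add_zero]
  have h1 := congrArg (KaehlerDifferential.D ℂ (FractionRing A)) (Q.S₀_algebraMap H)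
  obtain ⟨k, hk⟩ : ∃ k : FractionRing A, KaehlerDifferential.D ℂ (FractionRing A) (Q.S₀ x y 1) =
      Q.rz y • KaehlerDifferential.D ℂ (FractionRing A) x -
        k • KaehlerDifferential.D ℂ (FractionRing A) y := by
    have e : Q.sz y = aeval ![y, 1] (Q.s + 2 * Q.a₁ * Q.r) := by
      simp [sz, rz]
    refine ⟨-(x * aeval ![y, 1] (pderiv 0 Q.r) + aeval ![y, 1] (pderiv 0 (Q.s + 2 * Q.a₁ * Q.r))),
      ?_⟩
    rw [S₀_chart, map_add, e, hD, Derivation.leibniz, rz, hD, smul_smul, neg_smul, add_smul]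
    abel
  rw [hk, Derivation.leibniz] at h1
  have h2 : Q.rz y • KaehlerDifferential.D ℂ (FractionRing A) x =
      ∑ i, ![t, k, Q.excSigma j] i • (![KaehlerDifferential.D ℂ (FractionRing A) (Q.excSigma j),
        KaehlerDifferential.D ℂ (FractionRing A) y,
        KaehlerDifferential.D ℂ (FractionRing A) t] : Fin 3 → _) i := by
    simp only [Fin.sum_univ_three, Matrix.cons_val_zero, Matrix.cons_val_one, Matrix.cons_val]
    rw [eq_add_of_sub_eq h1]
    abel
  have h3 := AlternatingMap.smul_map_update_of_smul_eq_sum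
    (exteriorPower.ιMulti (FractionRing A) 3) _ h2 0
  have e1 : (fun i => KaehlerDifferential.D ℂ (FractionRing A) (![Q.excSigma j, y, t] i)) =
      ![KaehlerDifferential.D ℂ (FractionRing A) (Q.excSigma j),
        KaehlerDifferential.D ℂ (FractionRing A) y,
        KaehlerDifferential.D ℂ (FractionRing A) t] := by
    ext1 i; fin_cases i <;> rfl
  have e2 : (fun i => KaehlerDifferential.D ℂ (FractionRing A)
      (algebraMap A (FractionRing A) (j (X i)))) = Function.update
      ![KaehlerDifferential.D ℂ (FractionRing A) (Q.excSigma j),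
        KaehlerDifferential.D ℂ (FractionRing A) y,
        KaehlerDifferential.D ℂ (FractionRing A) t] 0
      (KaehlerDifferential.D ℂ (FractionRing A) x) := by
    ext1 i; fin_cases i <;> rfl
  rw [← e2, ← e1] at h3
  change Q.rz y • wedgeD _ = t • wedgeD _ at h3
  rw [residueForm, ← one_smul (FractionRing A) (wedgeD fun i => _), ← inv_mul_cancel₀ hr0,
    mul_smul, ← hy, h3, smul_smul, smul_smul, excW, ← ht]
  rw [← ht] at ht0
  congr 1
  field_simp

end IsExceptional

end SplitSextic



/-! ## The double solid is not terminal -/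

namespace SplitSextic

variable (Q : SplitSextic) {A : Type} [CommRing A] [IsDomain A] [Algebra ℂ A]
  {j : MvPolynomial (Fin 3) ℂ →ₐ[ℂ] A} {w : A}

lemma not_X_two_dvd_S₀ : ¬ (X 2 : MvPolynomial (Fin 3) ℂ) ∣ Q.S₀ (X 0) (X 1) 1 := by
  rintro ⟨m, hm⟩
  obtain ⟨y, hy⟩ := Q.exists_rz_ne_zero
  have h1 := congrArg (aeval ![(1 - Q.sz y) / Q.rz y, y, 0]) hm
  rw [map_S₀, map_mul, aeval_X, aeval_X, aeval_X, map_one, S₀_chart] at h1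
  change (1 - Q.sz y) / Q.rz y * Q.rz y + Q.sz y = 0 * _ at h1
  rw [div_mul_cancel₀ _ hy, zero_mul, sub_add_cancel] at h1
  exact one_ne_zero h1

/-- The exceptional divisor is indeed exceptional. -/
lemma IsExceptional.two_le_height [IsNoetherianRing A] {V : ValuationSubring (FractionRing A)}
    (hV : Q.IsExceptional j w V) (H : IsDoubleCover j (Q.h (X 0) (X 1) 1 (X 2)) w) :
    2 ≤ (hV.isPrimeDivisorOver H).center.height := by
  set P := (hV.isPrimeDivisorOver H).center with hP
  have hprime : P.IsPrime := Ideal.comap_isPrime _ _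
  have ht : X 2 ∈ P.comap j := (mem_center_iff (hV.isPrimeDivisorOver H)).2 hV.t_lt
  have hS : Q.S₀ (X 0) (X 1) 1 ∈ P.comap j := by
    refine (mem_center_iff (hV.isPrimeDivisorOver H)).2 ?_
    have h1 := Q.map_S₀ ((IsScalarTower.toAlgHom ℂ A (FractionRing A)).comp j) (X 0) (X 1) 1
    rw [map_one] at h1
    have h2 := h1.trans (Q.S₀_algebraMap H)
    refine (congrArg V.valuation h2).trans_lt ?_
    rw [map_mul]
    exact mul_lt_one_of_nonneg_of_lt_one_left zero_le hV.t_lt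
      ((V.valuation_le_one_iff _).2 hV.sigma_mem)
  have hq : (Ideal.span {(X 2 : MvPolynomial (Fin 3) ℂ)}).IsPrime :=
    (Ideal.span_singleton_prime (X_ne_zero 2)).2 X_prime
  -- The centre contains `t` and `S₀ = t σ`, and `t` does not divide `S₀`. Going-down then provides
  -- a nonzero prime strictly below the centre.
  have hlt : Ideal.span {X 2} < P.comap j := by
    refine lt_of_le_of_ne ((Ideal.span_singleton_le_iff_mem _).2 ht) fun he => ?_
    rw [← he, Ideal.mem_span_singleton] at hS
    exact Q.not_X_two_dvd_S₀ hS
  obtain ⟨p, hpP, hp, he⟩ := H.exists_lt_of_lt_comap hlt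
  have h1 := Ideal.height_strict_mono_of_isPrime hpP
  have h0 : p.height ≠ 0 := by
    rw [Ne, Ideal.height_eq_zero_iff_eq_bot]
    rintro rfl
    have h2 : (X 2 : MvPolynomial (Fin 3) ℂ) ∈ Ideal.comap j ⊥ :=
      he ▸ Ideal.mem_span_singleton_self _
    rw [Ideal.mem_comap, Ideal.mem_bot, map_eq_zero_iff _ H.injective] at h2
    exact X_ne_zero 2 h2
  have h2 : 1 ≤ p.height := Order.one_le_iff_ne_zero.2 h0
  calc (2 : ℕ∞) = 1 + 1 := one_add_one_eq_two.symm
    _ ≤ p.height + 1 := by gcongr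
    _ ≤ P.height := Order.add_one_le_of_lt h1

/-- Test the definition at the centre of `V` with the canonical form. The Cartier condition makes
`φ` regular there, so its order along `V` is nonnegative, while the canonical form has order zero;
the strict inequality on discrepancies fails for every `m`. The hypothesis `hlift` says that power
series solutions of `W² = h` are points of `Spec A`. -/
theorem not_isTerminalThreefold [IsNoetherianRing A]
    (H : IsDoubleCover j (Q.h (X 0) (X 1) 1 (X 2)) w)
    (hlift : ∀ x y t W : PowerSeries ExcField, W ^ 2 = Q.h x y 1 t →
      ∃ Θ : A →ₐ[ℂ] PowerSeries ExcField,
        Θ (j (X 0)) = x ∧ Θ (j (X 1)) = y ∧ Θ (j (X 2)) = t ∧ Θ w = W) :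
    ¬ IsTerminalThreefold A := by
  rintro ⟨hnormal, hterm⟩
  obtain ⟨V, hV⟩ := Q.exists_isExceptional H hlift
  have hV' := hV.isPrimeDivisorOver H
  have hprime : hV'.center.IsPrime := Ideal.comap_isPrime _ _
  obtain ⟨m, φ, -, -, hcartier, hdisc⟩ := hterm _ H.residueForm_ne_zero hV'.center hprime
  obtain ⟨a, s, hs, rfl⟩ := H.exists_eq_div hcartier
  have hlt := hdisc V hV' (hV.two_le_height Q H) le_rfl _ _ (hV.isFormGenerator H)
    (IsExceptional.residueForm_eq H)
  rw [map_inv₀, map_mul, hV.r_eq, hV.W_eq, mul_one, inv_one, one_pow] at hlt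
  refine hlt.not_ge ?_
  have hs1 : V.valuation (algebraMap A (FractionRing A) s) = 1 := by
    rw [mem_center_iff, not_lt] at hs
    exact le_antisymm ((V.valuation_le_one_iff _).2 (hV'.mem s)) hs
  rw [map_mul, map_inv₀, hs1, inv_one, mul_one, V.valuation_le_one_iff]
  exact hV'.mem a

theorem not_hasTerminalSingularities : ¬ HasTerminalSingularities Q.poly := by
  intro h
  -- The chart `z = 1`, with remaining variables `x, y, t, w` in this order.
  obtain ⟨hdom, hterm⟩ := h 2
  have heq := Q.chartEquation_two
  refine Q.not_isTerminalThreefold (isDoubleCover_of_eq heq) (fun x y t W hW => ?_) hterm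
  have hker : ∀ a ∈ Ideal.span {chartEquation Q.poly 2},
      aeval ![x, y, t, W] a = 0 := by
    intro a ha
    obtain ⟨b, rfl⟩ := Ideal.mem_span_singleton.1 ha
    have h1 : aeval ![x, y, t, W] (rename Fin.castSucc
        (Q.h (X 0) (X 1) 1 (X 2) : MvPolynomial (Fin 3) ℂ)) = Q.h x y 1 t := by
      rw [aeval_rename, map_h, map_one]
      simp only [aeval_X]
      rfl
    rw [map_mul, heq, map_add, map_neg, map_pow, aeval_X, h1, ← hW]
    simp
  refine ⟨Ideal.Quotient.liftₐ _ (aeval ![x, y, t, W]) hker, ?_, ?_, ?_, ?_⟩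
  · change aeval ![x, y, t, W] (rename Fin.castSucc (X 0)) = x
    rw [rename_X, aeval_X]; rfl
  · change aeval ![x, y, t, W] (rename Fin.castSucc (X 1)) = y
    rw [rename_X, aeval_X]; rfl
  · change aeval ![x, y, t, W] (rename Fin.castSucc (X 2)) = t
    rw [rename_X, aeval_X]; rfl
  · change aeval ![x, y, t, W] (X 3) = W
    rw [aeval_X]; rfl

end SplitSextic

theorem mainTheorem8 (n : ℕ) (hn9 : 9 ≤ n) (hn11 : n ≤ 11) (D : SexticCoeffs)
    (hcond : ∀ k : ℕ, 2 ≤ k → k ≤ n → D.Condition k) (hnot : ¬ D.Condition (n + 1)) :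
    IsSexticDoubleSolid D.f ∧
    IsCompoundA n (germAtPx D.f) ∧
    ¬ IsIsolatedSing (germAtPx D.f) ∧
    ¬ HasTerminalSingularities D.f := by
  obtain ⟨Q, hL, hf⟩ := D.exists_splitSextic n hn9 hn11 hcond hnot
  rw [hf]
  exact ⟨Q.isSexticDoubleSolid hL, Q.isCompoundA hL, Q.not_isIsolatedSing,
    Q.not_hasTerminalSingularities⟩
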